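/- **Theorem (Integration by parts formula).** Let $X$ be a connected, non-compact $C^\infty$ Riemannian manifold (Hausdorff, second countable) with Riemannian volume $m$, and let $\mathbb R_+=(0,\infty)$ with Lebesgue measure $\lambda$. Let $$\Omega=\Omega_X^{\mathbb R_+}=\{\omega\subset X\times\mathbb R_+ \mid (x,s)\neq(x',s')\in\omega\Rightarrow x\ne x',\ \text{and } \mathrm{Pr}_X\,\omega \text{ is locally finite}\},$$ with the $\sigma$-algebra generated by $\omega\mapsto\#(\omega\cap B)$, where $B$ runs through the family $\mathcal B_c(X\times\mathbb R_+)$ of Borel sets of $X\times\mathbb R_+$ whose projection to $X$ is relatively compact, and write $\langle f,\omega\rangle=\sum_{(x,s)\in\omega}f(x,s)$. *Test functions.* Let $\mathfrak D$ be the set of $C^\infty$ functions $\varphi$ on $X\times\mathbb R_+$ that vanish outside $K\times\mathbb R_+$ for some compact $K\subset X$, are bounded with all their derivatives, and satisfy $|\partial_s^n\varphi(x,s)|\le C_{n,\varphi}\max\{1,s\}^{-n}$ for all $n$. Let $\mathcal FC_b^\infty(\mathfrak D,\Omega)$ be the set of functions $F(\omega)=g_F(\langle\varphi_1,\omega\rangle,\dots,\langle\varphi_N,\omega\rangle)$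 with $\varphi_j\in\mathfrak D$ and $g_F\in C_b^\infty(\mathbb R^N)$ (smooth, bounded with all derivatives). Let $H^{1,2}(X\times\mathbb R_+)$ be the closure of (the elements of finite norm of) $\mathfrak D$ in the norm $\|\varphi\|_{1,2}^2=\int(|\nabla^X\varphi|^2+|s\,\partial_s\varphi|^2+|\varphi|^2)\,dm\,d\lambda$, and let $H^{1,2}_0(X\times\mathbb R_+)$ be the set of functions that on each $B\in\mathcal B_c(X\times\mathbb R_+)$ coincide a.e. with an element of $H^{1,2}(X\times\mathbb R_+)$. *The measure.* Let $\rho$ and $p$ be measurable functions on $X$ and $X\times\mathbb R_+$, with $\rho>0$ $m$-a.e. and $p>0$ $m\otimes\lambda$-a.e., such that $\sigma=\rho\,m$ is a Radon measure. Put $q(x,s)=\rho(x)p(x,s)$ and $\tilde\sigma(dx,ds)=q(x,s)\,\lambda(ds)\,m(dx)$, and assume that $\tilde\sigma$ is infinite, that $\int_{K\times\mathbb R_+}\max\{1,s\}\,q\,dm\,d\lambda<\infty$ for all compact $K\subset X$, and that $\sqrt q\in H^{1,2}_0(X\times\mathbb R_+)$. Let $\pi$ be the marked Poisson measure on $\Omega$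 with Lévy measure $\tilde\sigma$: the probability measure whose image under $\omega\mapsto\omega\cap(\Lambda\times\mathbb R_+)$, for each relatively compact open $\Lambda\subset X$, is $e^{-\tilde\sigma(\Lambda\times\mathbb R_+)}\sum_{n\ge0}\frac1{n!}\tilde\sigma_{\Lambda,n}$, where $\tilde\sigma_{\Lambda,n}$ is the image of $\tilde\sigma^{\otimes n}$ on $\{(x_i,s_i)_{i\le n}\in(\Lambda\times\mathbb R_+)^n\mid x_j\neq x_k \text{ for } j\ne k\}$ under $(x_i,s_i)_{i\le n}\mapsto\{(x_1,s_1),\dots,(x_n,s_n)\}$. *Directional and logarithmic derivatives.* Let $(v,a)\in\mathfrak g=V_0(X)\times C_0^\infty(X)$, i.e. $v$ is a smooth vector field and $a$ a smooth real function on $X$, both of compact support. Let $\psi_t^v$ be the flow of $v$, $\theta^a_t=e^{ta}$, let $(\psi_t^v,\theta_t^a)$ act on $X\times\mathbb R_+$ by $(x,s)\mapsto(\psi_t^v(x),\theta_t^a(\psi_t^v(x))s)$ and on $\Omega$ pointwise, and put $$(\nabla^\Omega_{(v,a)}F)(\omega)=\tfrac{d}{dt}F((\psi_t^v,\theta_t^a)\omega)\big|_{t=0}.$$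 Let $\beta_{(v,a)}^{\tilde\sigma}=\frac{\nabla^X_vq}{q}+\operatorname{div}^Xv+\frac{s\,\partial_sq}{q}\,a+a$, where $\operatorname{div}^X$ is the divergence with respect to $m$ and the derivatives of $q=(\sqrt q)^2$ are understood through the Sobolev derivatives of $\sqrt q$, i.e. $\nabla q=2\sqrt q\,\nabla\sqrt q$; and let $B_{(v,a)}(\omega)=\langle\beta^{\tilde\sigma}_{(v,a)},\omega\rangle$. Then $\beta^{\tilde\sigma}_{(v,a)}$ exists, and for every version of it (vanishing outside the supports of $v$ and $a$) the following holds. For each $F\in\mathcal FC_b^\infty(\mathfrak D,\Omega)$ the derivative $\nabla^\Omega_{(v,a)}F$ exists at every $\omega\in\Omega$, and $F$, $\nabla^\Omega_{(v,a)}F$ and $B_{(v,a)}F$ belong to $L^2(\pi)$. For all $F,G\in\mathcal FC_b^\infty(\mathfrak D,\Omega)$, $$\int_\Omega(\nabla^\Omega_{(v,a)}F)\,G\,d\pi=-\int_\Omega F\,\nabla^\Omega_{(v,a)}G\,d\pi-\int_\Omega F\,G\,B_{(v,a)}\,d\pi .$$ Equivalently, $F\mapsto\nabla^\Omega_{(v,a)}F$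 is a (well-defined) densely defined linear operator in $L^2(\pi)$ with domain $\mathcal FC_b^\infty(\mathfrak D,\Omega)$, this domain is contained in the domain of its adjoint, and $$\nabla^{\Omega\,*}_{(v,a)}=-\nabla^\Omega_{(v,a)}-B_{(v,a)}\qquad\text{on }\mathcal FC_b^\infty(\mathfrak D,\Omega).$$ -/

import Mathlib

open MeasureTheory Set Filter Topology Manifold ContDiff

noncomputable section

namespace MarkedPoisson

/-! ### The underlying Riemannian manifold -/

/-- The model space `ℝ^d`. -/
abbrev Eu (d : ℕ) := EuclideanSpace ℝ (Fin d)

/-- A smooth Riemannian metric on the `d`-dimensional manifold `X`. -/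
abbrev RMetric (d : ℕ) (X : Type*) [TopologicalSpace X] [ChartedSpace (Eu d) X]
    [IsManifold (𝓡 d) ∞ X] :=
  Bundle.ContMDiffRiemannianMetric (𝓡 d) ∞ (Eu d) (fun x : X => TangentSpace (𝓡 d) x)

/-- The `i`-th coordinate vector field `∂_i` of the chart centred at `x₀`, at the point with
coordinates `y`. -/
def coordVec (d : ℕ) {X : Type*} [TopologicalSpace X] [ChartedSpace (Eu d) X] (x₀ : X) (y : Eu d)
    (i : Fin d) : TangentSpace (𝓡 d) ((extChartAt (𝓡 d) x₀).symm y) :=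
  mfderiv 𝓘(ℝ, Eu d) (𝓡 d) (extChartAt (𝓡 d) x₀).symm y (EuclideanSpace.single i (1 : ℝ) : Eu d)

/-- The density `√det(g_ij)` of the Riemannian volume in the chart centred at `x₀`. -/
def volDensity {d : ℕ} {X : Type*} [TopologicalSpace X] [ChartedSpace (Eu d) X]
    [IsManifold (𝓡 d) ∞ X] (g : RMetric d X) (x₀ : X) (y : Eu d) : ℝ :=
  Real.sqrt (Matrix.det (Matrix.of fun i j : Fin d =>
    g.inner ((extChartAt (𝓡 d) x₀).symm y) (coordVec d x₀ y i) (coordVec d x₀ y j)))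

/-- The Riemannian volume of the domain of the chart centred at `x₀`: the measure
`√det(g_ij) dy`, transported from the chart to `X`. -/
def chartVolume {d : ℕ} {X : Type*} [TopologicalSpace X] [ChartedSpace (Eu d) X]
    [IsManifold (𝓡 d) ∞ X] [MeasurableSpace X] (g : RMetric d X) (x₀ : X) : Measure X :=
  (((volume : Measure (Eu d)).restrict (extChartAt (𝓡 d) x₀).target).withDensity
    (fun y => ENNReal.ofReal (volDensity g x₀ y))).map (extChartAt (𝓡 d) x₀).symm

theorem exists_chart_cover (d : ℕ) (X : Type*) [TopologicalSpace X] [Nonempty X]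
    [SecondCountableTopology X] [ChartedSpace (Eu d) X] :
    ∃ c : ℕ → X, ⋃ n, (extChartAt (𝓡 d) (c n)).source = univ := by
  obtain ⟨s, hs, hU⟩ := TopologicalSpace.countable_cover_nhds
    (f := fun x : X => (extChartAt (𝓡 d) x).source) (fun x => extChartAt_source_mem_nhds x)
  have hne : s.Nonempty := by
    by_contra h
    rw [Set.not_nonempty_iff_eq_empty] at h
    subst h
    simp only [mem_empty_iff_false, iUnion_of_empty, iUnion_empty] at hU
    exact Set.empty_ne_univ hU
  obtain ⟨c, rfl⟩ := hs.exists_eq_range hne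
  exact ⟨c, by simpa using hU⟩

/-- A sequence of points of `X` whose charts cover `X`. -/
def chartCenters (d : ℕ) (X : Type*) [TopologicalSpace X] [Nonempty X]
    [SecondCountableTopology X] [ChartedSpace (Eu d) X] : ℕ → X :=
  (exists_chart_cover d X).choose

/-- The Riemannian volume `m` on `X`: it is glued from the volumes in countably many charts that
cover `X`, each one cut down to the part of its domain that the earlier ones have not covered. -/
def riemannianVolume {d : ℕ} {X : Type*} [TopologicalSpace X] [Nonempty X]
    [SecondCountableTopology X] [ChartedSpace (Eu d) X] [IsManifold (𝓡 d) ∞ X]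
    [MeasurableSpace X] (g : RMetric d X) : Measure X :=
  Measure.sum fun n : ℕ => (chartVolume g (chartCenters d X n)).restrict
    (disjointed (fun k => (extChartAt (𝓡 d) (chartCenters d X k)).source) n)

/-- The differential of the chart centred at `x₀`, at the point with coordinates `y`. -/
def chartDiff (d : ℕ) {X : Type*} [TopologicalSpace X] [ChartedSpace (Eu d) X] (x₀ : X) (y : Eu d) :
    TangentSpace (𝓡 d) ((extChartAt (𝓡 d) x₀).symm y) →L[ℝ] Eu d :=
  mfderiv (𝓡 d) 𝓘(ℝ, Eu d) (extChartAt (𝓡 d) x₀) ((extChartAt (𝓡 d) x₀).symm y)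

/-- The `i`-th component of the vector field `v` in the chart centred at `x₀`. -/
def coordComp {d : ℕ} {X : Type*} [TopologicalSpace X] [ChartedSpace (Eu d) X]
    (v : (x : X) → TangentSpace (𝓡 d) x) (x₀ : X) (y : Eu d) (i : Fin d) : ℝ :=
  chartDiff d x₀ y (v ((extChartAt (𝓡 d) x₀).symm y)) i

/-- The divergence of a vector field with respect to the Riemannian volume:
`div v = (√det g)⁻¹ ∑ i, ∂_i (√det g * v^i)`, at `x` computed in the chart centred at `x`. -/
def divergence {d : ℕ} {X : Type*} [TopologicalSpace X] [ChartedSpace (Eu d) X]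
    [IsManifold (𝓡 d) ∞ X] (g : RMetric d X) (v : (x : X) → TangentSpace (𝓡 d) x) (x : X) : ℝ :=
  (∑ i : Fin d, fderiv ℝ (fun y : Eu d => volDensity g x y * coordComp v x y i)
      (extChartAt (𝓡 d) x x) (EuclideanSpace.single i (1 : ℝ))) /
    volDensity g x (extChartAt (𝓡 d) x x)

/-! ### The Lie algebra `𝔤 = V₀(X) × C₀^∞(X)` and its flows -/

/-- A pair `(v, a)` of a smooth vector field and a smooth function, both of compact support. -/
structure LieAlg (d : ℕ) (X : Type*) [TopologicalSpace X] [ChartedSpace (Eu d) X]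
    [IsManifold (𝓡 d) ∞ X] where
  v : (x : X) → TangentSpace (𝓡 d) x
  a : X → ℝ
  smooth_v : ContMDiff (𝓡 d) (𝓡 d).tangent ∞ (fun x => (⟨x, v x⟩ : TangentBundle (𝓡 d) X))
  smooth_a : ContMDiff (𝓡 d) 𝓘(ℝ, ℝ) ∞ a
  compact_v : ∃ K : Set X, IsCompact K ∧ ∀ x ∉ K, v x = 0
  compact_a : ∃ K : Set X, IsCompact K ∧ ∀ x ∉ K, a x = 0

open Classical in
/-- The flow `ψ_t^v` of a vector field `v`: `t ↦ ψ_t^v(x)` is the integral curve of `v` on `ℝ` that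
starts at `x` (which exists and is unique for `v` smooth of compact support; the other branch
serves for totality only). -/
def flow {d : ℕ} {X : Type*} [TopologicalSpace X] [ChartedSpace (Eu d) X]
    (v : (x : X) → TangentSpace (𝓡 d) x) (t : ℝ) (x : X) : X :=
  if h : ∃ γ : ℝ → X, γ 0 = x ∧ IsMIntegralCurve (I := 𝓡 d) γ v then h.choose t else x

section flow

variable {d : ℕ} {X : Type*} [TopologicalSpace X] [T2Space X] [ChartedSpace (Eu d) X]
  [IsManifold (𝓡 d) ∞ X]

theorem flow_eq (A : LieAlg d X) {γ : ℝ → X} (hγ : IsMIntegralCurve (I := 𝓡 d) γ A.v) (t : ℝ) :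
    flow A.v t (γ 0) = γ t := by
  have h : ∃ γ' : ℝ → X, γ' 0 = γ 0 ∧ IsMIntegralCurve (I := 𝓡 d) γ' A.v := ⟨γ, rfl, hγ⟩
  have hv : ContMDiff (𝓡 d) (𝓡 d).tangent 1
      (fun x => (⟨x, A.v x⟩ : TangentBundle (𝓡 d) X)) := A.smooth_v.of_le (by simp)
  rw [flow, dif_pos h]
  exact congrFun (isMIntegralCurve_Ioo_eq_of_contMDiff_boundaryless (t₀ := 0) hv
    h.choose_spec.2 hγ h.choose_spec.1) t

theorem flow_of_eq_zero (A : LieAlg d X) {x : X} (hx : A.v x = 0) (t : ℝ) :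
    flow A.v t x = x :=
  flow_eq A (γ := fun _ => x) (isMIntegralCurve_const hx) t

theorem flow_injective (A : LieAlg d X) (t : ℝ) : Function.Injective (flow A.v t) := by
  have key : ∀ (γ : ℝ → X), IsMIntegralCurve (I := 𝓡 d) γ A.v → ∀ s,
      flow A.v (-s) (γ s) = γ 0 := by
    intro γ hγ s
    have := flow_eq A (hγ.comp_add s) (-s)
    simpa using this
  have ex : ∀ x y : X, (∃ γ : ℝ → X, γ 0 = x ∧ IsMIntegralCurve (I := 𝓡 d) γ A.v) →
      flow A.v t x = flow A.v t y →
      ∃ γ : ℝ → X, γ 0 = y ∧ IsMIntegralCurve (I := 𝓡 d) γ A.v := by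
    rintro x y ⟨γ, rfl, hγ⟩ hxy
    by_contra hy
    rw [flow_eq A hγ] at hxy
    have : flow A.v t y = y := by rw [flow, dif_neg hy]
    rw [this] at hxy
    exact hy ⟨γ ∘ (· + t), by simpa using hxy, hγ.comp_add t⟩
  intro x y hxy
  by_cases hx : ∃ γ : ℝ → X, γ 0 = x ∧ IsMIntegralCurve (I := 𝓡 d) γ A.v
  · have hy := ex x y hx hxy
    obtain ⟨γ, rfl, hγ⟩ := hx
    obtain ⟨γ', rfl, hγ'⟩ := hy
    have h1 := key γ hγ t
    have h2 := key γ' hγ' t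
    rw [flow_eq A hγ, flow_eq A hγ'] at hxy
    rw [← h1, ← h2, hxy]
  · have hy : ¬ ∃ γ : ℝ → X, γ 0 = y ∧ IsMIntegralCurve (I := 𝓡 d) γ A.v :=
      fun hy => hx (ex y x hy hxy.symm)
    have h1 : flow A.v t x = x := by rw [flow, dif_neg hx]
    have h2 : flow A.v t y = y := by rw [flow, dif_neg hy]
    rw [← h1, ← h2, hxy]

end flow

/-! ### The marked configuration space

The marks are the positive reals, so that `X × ℝ₊` is the open subset `univ ×ˢ Ioi 0` of `X × ℝ`;
functions "on `X × ℝ₊`" are functions on `X × ℝ` whose values at `(x, s)` with `s ≤ 0` play no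
role. -/

/-- The marked configuration space `Ω_X^{ℝ₊}`. -/
@[ext]
structure Config (X : Type*) [TopologicalSpace X] where
  carrier : Set (X × ℝ)
  pos : ∀ z ∈ carrier, 0 < z.2
  inj : ∀ z ∈ carrier, ∀ z' ∈ carrier, z ≠ z' → z.1 ≠ z'.1
  locallyFinite : ∀ K : Set X, IsCompact K → ((Prod.fst '' carrier) ∩ K).Finite

/-- The family `𝓑_c(X × ℝ₊)` of Borel sets whose projection to `X` is relatively compact. -/
def BorelC (X : Type*) [TopologicalSpace X] [MeasurableSpace X] : Set (Set (X × ℝ)) :=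
  {B | MeasurableSet B ∧ ∃ K : Set X, IsCompact K ∧ B ⊆ K ×ˢ Ioi (0 : ℝ)}

/-- `N_B(η) = #(η ∩ B)`. -/
def count {X : Type*} [TopologicalSpace X] (B : Set (X × ℝ)) (η : Config X) : ℕ :=
  (η.carrier ∩ B).ncard

/-- The σ-algebra on `Ω_X^{ℝ₊}`: the smallest one making all `N_B`, `B ∈ 𝓑_c(X × ℝ₊)`,
measurable. -/
instance instMeasurableSpaceConfig (X : Type*) [TopologicalSpace X] [MeasurableSpace X] :
    MeasurableSpace (Config X) :=
  ⨆ B ∈ BorelC X, MeasurableSpace.comap (count B) ⊤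

/-- `⟨f, η⟩ = ∑_{(x,s) ∈ η} f(x,s)`. -/
def pairing {X : Type*} [TopologicalSpace X] (f : X × ℝ → ℝ) (η : Config X) : ℝ :=
  ∑ᶠ z ∈ η.carrier, f z

/-- The restriction map `p_Λ : η ↦ η ∩ (Λ × ℝ₊)`. -/
def restrictConfig {X : Type*} [TopologicalSpace X] (Λ : Set X) (η : Config X) : Config X where
  carrier := η.carrier ∩ Λ ×ˢ Ioi (0 : ℝ)
  pos z hz := η.pos z hz.1
  inj z hz z' hz' := η.inj z hz.1 z' hz'.1
  locallyFinite K hK := (η.locallyFinite K hK).subset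
    (inter_subset_inter_left _ (image_mono inter_subset_left))

/-- `π` is the marked Poisson measure with Lévy measure `μ`: it is a probability measure such that,
for each relatively compact open `Λ`, its image under `p_Λ` is
`exp(-μ(Λ × ℝ₊)) ∑ n, (1/n!) μ_{Λ,n}`, where `μ_{Λ,n}` is the image of `μ^{⊗n}` on
`{((x₁,s₁),…,(x_n,s_n)) ∈ (Λ × ℝ₊)^n | x_j ≠ x_k for j ≠ k}` under
`((x₁,s₁),…,(x_n,s_n)) ↦ {(x₁,s₁),…,(x_n,s_n)}`. -/
structure IsMarkedPoisson {X : Type*} [TopologicalSpace X] [MeasurableSpace X]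
    (μ : Measure (X × ℝ)) (π : Measure (Config X)) : Prop where
  isProbabilityMeasure : IsProbabilityMeasure π
  law : ∀ Λ : Set X, IsOpen Λ → IsCompact (closure Λ) →
    ∀ A : Set (Config X), MeasurableSet A →
      π (restrictConfig Λ ⁻¹' A) =
        ENNReal.ofReal (Real.exp (-(μ (Λ ×ˢ Ioi (0 : ℝ))).toReal)) *
          ∑' n : ℕ, ((n.factorial : ENNReal))⁻¹ *
            Measure.pi (fun _ : Fin n => μ.restrict (Λ ×ˢ Ioi (0 : ℝ)))
              {ξ | Function.Injective (fun i => (ξ i).1) ∧ ∃ η ∈ A, η.carrier = range ξ}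

/-- The action `η ↦ (ψ_t^v, θ_t^a) η` with `θ_t^a = exp (t a)`, where a pair `(ψ, θ)` acts on
`X × ℝ₊` by `(x, s) ↦ (ψ(x), θ(ψ(x)) s)` and on configurations pointwise. -/
def act {d : ℕ} {X : Type*} [TopologicalSpace X] [T2Space X] [ChartedSpace (Eu d) X]
    [IsManifold (𝓡 d) ∞ X] (A : LieAlg d X) (t : ℝ) (η : Config X) : Config X where
  carrier := (fun z : X × ℝ =>
    (flow A.v t z.1, Real.exp (t * A.a (flow A.v t z.1)) * z.2)) '' η.carrier
  pos := by
    rintro _ ⟨z, hz, rfl⟩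
    exact mul_pos (Real.exp_pos _) (η.pos z hz)
  inj := by
    rintro _ ⟨z, hz, rfl⟩ _ ⟨z', hz', rfl⟩ hne h
    have h1 : z.1 = z'.1 := flow_injective A t h
    have h2 : z = z' := by
      by_contra hzz
      exact η.inj z hz z' hz' hzz h1
    exact hne (by rw [h2])
  locallyFinite K hK := by
    obtain ⟨L, hL, hLv⟩ := A.compact_v
    refine (((η.locallyFinite L hL).image (flow A.v t)).union (η.locallyFinite K hK)).subset ?_
    rintro _ ⟨⟨_, ⟨z, hz, rfl⟩, rfl⟩, hK'⟩
    by_cases hzL : z.1 ∈ L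
    · exact Or.inl ⟨z.1, ⟨⟨z, hz, rfl⟩, hzL⟩, rfl⟩
    · have hfix : flow A.v t z.1 = z.1 := flow_of_eq_zero A (hLv _ hzL) t
      refine Or.inr ⟨⟨z, hz, ?_⟩, hK'⟩
      exact hfix.symm

/-- The directional derivative `(∇^Ω_{(v,a)} F)(η) = d/dt F((ψ_t^v, θ_t^a) η) |_{t=0}`. -/
def dirDeriv {d : ℕ} {X : Type*} [TopologicalSpace X] [T2Space X] [ChartedSpace (Eu d) X]
    [IsManifold (𝓡 d) ∞ X] (A : LieAlg d X) (F : Config X → ℝ) (η : Config X) : ℝ :=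
  deriv (fun t : ℝ => F (act A t η)) 0

/-! ### Test functions and smooth cylinder functions -/

/-- The class `𝔇` of test functions on `X × ℝ₊`. -/
structure IsTest (d : ℕ) {X : Type*} [TopologicalSpace X] [ChartedSpace (Eu d) X]
    (φ : X × ℝ → ℝ) : Prop where
  smooth : ContMDiffOn ((𝓡 d).prod 𝓘(ℝ, ℝ)) 𝓘(ℝ, ℝ) ∞ φ (univ ×ˢ Ioi (0 : ℝ))
  support : ∃ K : Set X, IsCompact K ∧ ∀ x ∉ K, ∀ s : ℝ, 0 < s → φ (x, s) = 0
  /-- `φ` and all its derivatives are bounded (in charts, uniformly over compact subsets of the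
  chart and over all marks; recall that the support of `φ` is compact in the direction of `X`). -/
  bounded : ∀ (x₀ : X) (K : Set (Eu d)), IsCompact K → K ⊆ (extChartAt (𝓡 d) x₀).target →
    ∀ k : ℕ, ∃ C : ℝ, ∀ y ∈ K, ∀ s : ℝ, 0 < s →
      ‖iteratedFDeriv ℝ k
        (fun z : Eu d × ℝ => φ ((extChartAt (𝓡 d) x₀).symm z.1, z.2)) (y, s)‖ ≤ C
  decay : ∀ n : ℕ, ∃ C : ℝ, ∀ (x : X) (s : ℝ), 0 < s →
    |iteratedDeriv n (fun r : ℝ => φ (x, r)) s| ≤ C * ((max 1 s) ^ n)⁻¹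

/-- The class `C_b^∞(ℝ^N)`. -/
def IsCbInfty {N : ℕ} (f : (Fin N → ℝ) → ℝ) : Prop :=
  ContDiff ℝ ∞ f ∧ ∀ k : ℕ, ∃ C : ℝ, ∀ r, ‖iteratedFDeriv ℝ k f r‖ ≤ C

/-- The set `𝓕C_b^∞(𝔇, Ω_X^{ℝ₊})` of smooth cylinder functions. -/
def cylinder (d : ℕ) (X : Type*) [TopologicalSpace X] [ChartedSpace (Eu d) X] :
    Set (Config X → ℝ) :=
  {F | ∃ (N : ℕ) (φ : Fin N → X × ℝ → ℝ) (f : (Fin N → ℝ) → ℝ), (∀ j, IsTest d (φ j)) ∧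
    IsCbInfty f ∧ ∀ η, F η = f (fun j => pairing (φ j) η)}

/-! ### The gradient on `X × ℝ₊` and Sobolev spaces -/

/-- The differential of `φ(·, s)` at `x`. -/
def diffX (d : ℕ) {X : Type*} [TopologicalSpace X] [ChartedSpace (Eu d) X] (φ : X × ℝ → ℝ)
    (z : X × ℝ) : TangentSpace (𝓡 d) z.1 →L[ℝ] ℝ :=
  mfderiv (𝓡 d) 𝓘(ℝ, ℝ) (fun x => φ (x, z.2)) z.1

/-- `(∇^X_v φ)(x,s) + a(x) s (∂φ/∂s)(x,s)`: the derivative of `φ` along `(v, a)`, that is, the scalar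
product of `∇^{X × ℝ₊} φ = (∇^X φ, s ∂φ/∂s)` and `(v, a)`. -/
def dirDerivXR {d : ℕ} {X : Type*} [TopologicalSpace X] [ChartedSpace (Eu d) X]
    (v : (x : X) → TangentSpace (𝓡 d) x) (a : X → ℝ) (φ : X × ℝ → ℝ) (z : X × ℝ) : ℝ :=
  diffX d φ z (v z.1) +
    a z.1 * (z.2 * deriv (fun s => φ (z.1, s)) z.2)

/-- `|∇^X φ(x,s)|²`, as the square of the norm of the differential in `x`, dual to the Riemannian
norm on the tangent space. -/
def gradSq {d : ℕ} {X : Type*} [TopologicalSpace X] [ChartedSpace (Eu d) X]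
    [IsManifold (𝓡 d) ∞ X] (g : RMetric d X) (φ : X × ℝ → ℝ) (z : X × ℝ) : ENNReal :=
  ⨆ (w : TangentSpace (𝓡 d) z.1) (_ : g.inner z.1 w w ≤ 1),
    ‖diffX d φ z w‖ₑ ^ 2

section measures

variable {d : ℕ} {X : Type*} [TopologicalSpace X] [Nonempty X] [SecondCountableTopology X]
  [ChartedSpace (Eu d) X] [IsManifold (𝓡 d) ∞ X] [MeasurableSpace X]

/-- The measure `m ⊗ λ` on `X × ℝ₊`. -/
def refMeasure (g : RMetric d X) : Measure (X × ℝ) :=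
  (riemannianVolume g).prod (volume.restrict (Ioi (0 : ℝ)))

/-- The squared Sobolev norm `‖φ‖²_{1,2}` of a test function (possibly infinite). -/
def sobolevNormSq (g : RMetric d X) (φ : X × ℝ → ℝ) : ENNReal :=
  ∫⁻ z, (gradSq g φ z + ‖z.2 * deriv (fun s => φ (z.1, s)) z.2‖ₑ ^ 2 + ‖φ z‖ₑ ^ 2) ∂(refMeasure g)

/-- The test functions `φ n` of finite norm form a Cauchy sequence for `‖·‖_{1,2}` that converges
to `f` in `L²`; thus `f` is an element of the closure `H^{1,2}` of `𝔇`, represented by the sequence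
`φ n`. -/
structure SobolevApprox (g : RMetric d X) (f : X × ℝ → ℝ) (φ : ℕ → X × ℝ → ℝ) : Prop where
  aestronglyMeasurable : AEStronglyMeasurable f (refMeasure g)
  test : ∀ n, IsTest d (φ n)
  finite : ∀ n, sobolevNormSq g (φ n) < ⊤
  cauchy : ∀ ε : ENNReal, 0 < ε → ∃ N : ℕ, ∀ j ≥ N, ∀ k ≥ N,
    sobolevNormSq g (fun z => φ j z - φ k z) < ε
  tendsto : Tendsto (fun n => ∫⁻ z, ‖φ n z - f z‖ₑ ^ 2 ∂(refMeasure g)) atTop (𝓝 0)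

/-- The Sobolev space `H^{1,2}(X × ℝ₊)`. -/
def MemSobolev (g : RMetric d X) (f : X × ℝ → ℝ) : Prop :=
  ∃ φ : ℕ → X × ℝ → ℝ, SobolevApprox g f φ

/-- The local Sobolev space `H₀^{1,2}(X × ℝ₊)`. -/
def MemLocalSobolev (g : RMetric d X) (f : X × ℝ → ℝ) : Prop :=
  ∀ B ∈ BorelC X, ∃ h : X × ℝ → ℝ, MemSobolev g h ∧
    ∀ᵐ z ∂((refMeasure g).restrict B), f z = h z

/-- `D` is (a version of) the derivative `∇^{X × ℝ₊}_{(v,a)} f` along `(v, a)`, of compact support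
in `X`, of a function `f` that is locally Sobolev: near the supports of `v` and `a` the function `f`
coincides with some `h ∈ H^{1,2}`, and if `φ n` are test functions converging to `h` in `H^{1,2}`,
then `∇_{(v,a)} φ n` converge to `D` in `L²`. -/
def IsSobolevDeriv (g : RMetric d X) (v : (x : X) → TangentSpace (𝓡 d) x) (a : X → ℝ)
    (f D : X × ℝ → ℝ) : Prop :=
  AEStronglyMeasurable D (refMeasure g) ∧
  (∀ z : X × ℝ, z.1 ∉ closure {x | v x ≠ 0} → z.1 ∉ closure {x | a x ≠ 0} → D z = 0) ∧
  ∃ (U : Set X) (h : X × ℝ → ℝ) (φ : ℕ → X × ℝ → ℝ),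
    IsOpen U ∧ closure {x | v x ≠ 0} ⊆ U ∧ closure {x | a x ≠ 0} ⊆ U ∧
    (∀ᵐ z ∂((refMeasure g).restrict (U ×ˢ Ioi (0 : ℝ))), f z = h z) ∧
    SobolevApprox g h φ ∧
    Tendsto (fun n => ∫⁻ z, ‖dirDerivXR v a (φ n) z - D z‖ₑ ^ 2 ∂(refMeasure g)) atTop (𝓝 0)

/-- `β` is (a version of) the logarithmic derivative along `(v, a)` of the measure with density `q`
with respect to `m ⊗ λ`, that is, `β = β_v + β_a` with
`β_v = (∇^X_v q) / q + div v` and `β_a = (s ∂q/∂s) a / q + a`.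
Here `√q` is a Sobolev function, and the derivatives of `q = (√q)²` are given by
`∇_{(v,a)} q = 2 √q ∇_{(v,a)} √q`. -/
def IsLogDeriv (g : RMetric d X) (q : X × ℝ → ℝ) (A : LieAlg d X) (β : X × ℝ → ℝ) : Prop :=
  ∃ Dv Da : X × ℝ → ℝ,
    IsSobolevDeriv g A.v (fun _ => 0) (fun z => √(q z)) Dv ∧
    IsSobolevDeriv g (fun _ => 0) A.a (fun z => √(q z)) Da ∧
    ∀ z, β z = (2 * √(q z) * Dv z / q z + divergence g A.v z.1) +
      (2 * √(q z) * Da z / q z + A.a z.1)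

/-- The Lévy measure `σ̃(dx, ds) = p(x,s) λ(ds) ρ(x) m(dx)` on `X × ℝ₊`. -/
def levyMeasure (g : RMetric d X) (ρ : X → ℝ) (p : X → ℝ → ℝ) : Measure (X × ℝ) :=
  (refMeasure g).withDensity (fun z => ENNReal.ofReal (ρ z.1 * p z.1 z.2))

/-- The standing assumptions on the intensity measure `σ = ρ m` and on the distributions
`p(x, ds) = p(x, s) λ(ds)` of the marks, in terms of `q(x,s) = ρ(x) p(x,s)`. -/
structure IsAdmissible (g : RMetric d X) (ρ : X → ℝ) (p : X → ℝ → ℝ) : Prop where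
  measurable_ρ : Measurable ρ
  measurable_p : Measurable (fun z : X × ℝ => p z.1 z.2)
  ρ_pos : ∀ᵐ x ∂(riemannianVolume g), 0 < ρ x
  p_pos : ∀ᵐ x ∂(riemannianVolume g), ∀ᵐ s ∂(volume.restrict (Ioi (0 : ℝ))), 0 < p x s
  /-- `σ = ρ m` is a Radon measure -/
  radon : ∀ K : Set X, IsCompact K → ∫⁻ x in K, ENNReal.ofReal (ρ x) ∂(riemannianVolume g) < ⊤
  infinite : levyMeasure g ρ p univ = ⊤
  /-- `(max{1,s} q)^{1/2} ∈ L²_loc(X; m) ⊗ L²(ℝ₊; λ)` -/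
  moment : ∀ K : Set X, IsCompact K →
    ∫⁻ z in K ×ˢ Ioi (0 : ℝ), ENNReal.ofReal (max 1 z.2 * (ρ z.1 * p z.1 z.2)) ∂(refMeasure g) < ⊤
  sobolev : MemLocalSobolev g (fun z => √(ρ z.1 * p z.1 z.2))

end measures

/-! ### The directional derivative as an operator in `L²` -/

/-- `T` is the operator `F ↦ ∇^Ω_{(v,a)} F` in `L²(π)` on the domain of smooth cylinder
functions. -/
structure IsDirDerivOperator {d : ℕ} {X : Type*} [TopologicalSpace X] [T2Space X]
    [ChartedSpace (Eu d) X] [IsManifold (𝓡 d) ∞ X] [MeasurableSpace X] (A : LieAlg d X)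
    (π : Measure (Config X)) (T : Lp ℝ 2 π →ₗ.[ℝ] Lp ℝ 2 π) : Prop where
  mem_domain : ∀ u : Lp ℝ 2 π, u ∈ T.domain ↔ ∃ F ∈ cylinder d X, u =ᵐ[π] F
  apply_eq : ∀ F ∈ cylinder d X, ∀ u : T.domain, (u : Lp ℝ 2 π) =ᵐ[π] F →
    T u =ᵐ[π] dirDeriv A F

end MarkedPoisson

end

open MarkedPoisson

set_option linter.unusedSectionVars false

noncomputable section

/-! Cylinder functions form an algebra on which the directional derivative is a derivation, so the
formula for `F` and `G` is the single statement that `∇H + H B` has integral zero, applied to `H = F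
G` (`integral_dirDeriv_add`). The functions `H`, `∇H` and `B` see only the points over a relatively
compact window `Λ`, and there `π` is a Poisson measure of finite intensity `ν`, a mixture of the
images of the powers `ν^n`. On the sector of `n` particles, `∇H + H B` is a sum over the particles,
and its `i`-th term carries a derivative and `β` in the `i`-th variable only. Integrating that
variable first, with the others frozen, leaves the one-particle identity `∫ (∇ψ + ψ β) dσ̃ = 0` for
`ψ = f (c + φ)` (`integral_oneParticle`, `integral_pi_logDeriv`).

For a smooth weight this identity is the divergence theorem on `X` in the direction `v`
(`integral_divIntegrand`) together with `∫ (s w' + w) ds = 0` on the half-line in the direction `a`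
(`integral_Ioi_deriv_scaling`). Here `√q` is only a Sobolev function. Near the supports of `v` and
`a` it is an `L²` limit of test functions `φ n`; the smooth identity is applied to `ψ (φ n)²`, where
every term is a bounded factor times a product of two `L²`-convergent sequences, and therefore
passes to the limit (`sobolev_integration_by_parts`). The divergence is defined at each point in the
chart of that point, so the divergence theorem needs its invariance under coordinate changes
(`wDiv_transition`); this is proved by duality, without differentiating a Jacobian.

Two facts about `π` make the expressions square integrable. The weight gives `(2 √q D / q)² q = 4
D²`, so `β` lies in `L²(σ̃)`; and a Poisson measure of finite intensity maps functions in `L²(ν)`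
supported over a compact set to square integrable linear functionals
(`memLp_pairing_finitePoisson`). Coinciding positions are excluded almost surely because `π` has
total mass one (`IsMarkedPoisson.ae_isSimple`).

For the operator statement, cylinder functions approximate the indicators of events that prescribe
counts on open rectangles, and these events form a π-system generating the σ-algebra; hence cylinder
functions separate integrable functions (`ae_eq_zero_of_integral_cylinder`). This gives density of
the domain. It also gives well-definedness: by the integration by parts formula, the pairing of `∇F`
with a cylinder function depends only on the class of `F` in `L²`. -/

namespace MarkedPoisson

/-! ### Vector fields, transition maps and the Riemannian density in charts -/

section chart

variable {d : ℕ} {X : Type*} [TopologicalSpace X] [ChartedSpace (Eu d) X]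

/-- The vector field `v` in the chart centred at `x₀`. -/
def coordField (v : (x : X) → TangentSpace (𝓡 d) x) (x₀ : X) (y : Eu d) : Eu d :=
  chartDiff d x₀ y (v ((extChartAt (𝓡 d) x₀).symm y))

variable [IsManifold (𝓡 d) ∞ X]

theorem mem_chartAt_source_of_mem_target {x₀ : X} {y : Eu d}
    (hy : y ∈ (extChartAt (𝓡 d) x₀).target) :
    (extChartAt (𝓡 d) x₀).symm y ∈ (chartAt (Eu d) x₀).source := by
  rw [← extChartAt_source (𝓡 d)]
  exact (extChartAt (𝓡 d) x₀).map_target hy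

theorem mdifferentiableAt_chart_symm {x₀ : X} {y : Eu d}
    (hy : y ∈ (extChartAt (𝓡 d) x₀).target) :
    MDifferentiableAt 𝓘(ℝ, Eu d) (𝓡 d) (extChartAt (𝓡 d) x₀).symm y := by
  have := mdifferentiableWithinAt_extChartAt_symm (I := 𝓡 d) hy
  rwa [ModelWithCorners.Boundaryless.range_eq_univ, mdifferentiableWithinAt_univ] at this

theorem chartDiff_mfderiv_symm {x₀ : X} {y : Eu d} (hy : y ∈ (extChartAt (𝓡 d) x₀).target)
    (w : Eu d) :
    chartDiff d x₀ y (mfderiv 𝓘(ℝ, Eu d) (𝓡 d) (extChartAt (𝓡 d) x₀).symm y w) = w := by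
  have := mfderiv_extChartAt_comp_mfderivWithin_extChartAt_symm (I := 𝓡 d) hy
  have h2 := DFunLike.congr_fun this w
  simpa [chartDiff, mfderivWithin_univ] using! h2

theorem mfderiv_symm_chartDiff {x₀ : X} {y : Eu d} (hy : y ∈ (extChartAt (𝓡 d) x₀).target)
    (w : TangentSpace (𝓡 d) ((extChartAt (𝓡 d) x₀).symm y)) :
    mfderiv 𝓘(ℝ, Eu d) (𝓡 d) (extChartAt (𝓡 d) x₀).symm y (chartDiff d x₀ y w) = w := by
  have := mfderivWithin_extChartAt_symm_comp_mfderiv_extChartAt (I := 𝓡 d) hy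
  have h2 := DFunLike.congr_fun this w
  simpa [chartDiff, mfderivWithin_univ] using! h2

/-- Chain rule through the inverse chart, whose differential is inverse to `chartDiff`. -/
theorem mfderiv_apply_eq_fderiv {F : Type*} [NormedAddCommGroup F] [NormedSpace ℝ F]
    {x₀ : X} {y : Eu d} (hy : y ∈ (extChartAt (𝓡 d) x₀).target) {u : X → F}
    (hu : MDifferentiableAt (𝓡 d) 𝓘(ℝ, F) u ((extChartAt (𝓡 d) x₀).symm y))
    (w : TangentSpace (𝓡 d) ((extChartAt (𝓡 d) x₀).symm y)) :
    (mfderiv (𝓡 d) 𝓘(ℝ, F) u ((extChartAt (𝓡 d) x₀).symm y) w : F) =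
      fderiv ℝ (u ∘ (extChartAt (𝓡 d) x₀).symm) y (chartDiff d x₀ y w) := by
  rw [← mfderiv_eq_fderiv, mfderiv_comp y hu (mdifferentiableAt_chart_symm hy)]
  change _ = mfderiv (𝓡 d) 𝓘(ℝ, F) u ((extChartAt (𝓡 d) x₀).symm y) (mfderiv 𝓘(ℝ, Eu d) (𝓡 d) (extChartAt (𝓡 d) x₀).symm y (chartDiff d x₀ y w))
  rw [mfderiv_symm_chartDiff hy]

/-- Over the chart domain the differential of the chart is the trivialization of the tangent bundle
at `x₀`, so smoothness of the section is smoothness of its fibre component. -/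
theorem contDiffOn_coordField {v : (x : X) → TangentSpace (𝓡 d) x}
    (hv : ContMDiff (𝓡 d) (𝓡 d).tangent ∞ (fun x => (⟨x, v x⟩ : TangentBundle (𝓡 d) X)))
    (x₀ : X) : ContDiffOn ℝ ∞ (coordField v x₀) (extChartAt (𝓡 d) x₀).target := by
  set e := trivializationAt (Eu d) (TangentSpace (𝓡 d) : X → Type _) x₀
  have h1 : ContMDiffOn 𝓘(ℝ, Eu d) (𝓡 d).tangent ∞
      (fun y => (⟨(extChartAt (𝓡 d) x₀).symm y, v ((extChartAt (𝓡 d) x₀).symm y)⟩ :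
        TangentBundle (𝓡 d) X)) (extChartAt (𝓡 d) x₀).target :=
    hv.comp_contMDiffOn (contMDiffOn_extChartAt_symm x₀)
  have hmaps : MapsTo (fun y => (⟨(extChartAt (𝓡 d) x₀).symm y, v ((extChartAt (𝓡 d) x₀).symm y)⟩ :
        TangentBundle (𝓡 d) X)) (extChartAt (𝓡 d) x₀).target e.source := by
    intro y hy
    rw [e.mem_source]
    exact mem_chartAt_source_of_mem_target hy
  have h2 := ((e.contMDiffOn_iff hmaps).1 h1).2
  rw [contMDiffOn_iff_contDiffOn] at h2
  refine h2.congr fun y hy => ?_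
  have h3 := TangentBundle.continuousLinearMapAt_trivializationAt (I := 𝓡 d)
    (mem_chartAt_source_of_mem_target hy)
  rw [coordField, chartDiff, ← h3]
  exact e.continuousLinearMapAt_apply_of_mem (R := ℝ) (mem_chartAt_source_of_mem_target hy) _

theorem coordField_of_eq_zero {v : (x : X) → TangentSpace (𝓡 d) x} {x₀ : X} {y : Eu d}
    (h : v ((extChartAt (𝓡 d) x₀).symm y) = 0) : coordField v x₀ y = 0 := by
  rw [coordField, h, map_zero]

theorem eq_zero_of_coordField {v : (x : X) → TangentSpace (𝓡 d) x} {x₀ : X} {y : Eu d}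
    (hy : y ∈ (extChartAt (𝓡 d) x₀).target) (h : coordField v x₀ y = 0) :
    v ((extChartAt (𝓡 d) x₀).symm y) = 0 := by
  rw [← mfderiv_symm_chartDiff hy (v ((extChartAt (𝓡 d) x₀).symm y))]
  exact (congrArg _ h).trans (map_zero _)

/-- Ensures that the closed support of `v` is a neighbourhood of each point where `v` does not
vanish, so that identities valid on the support can be differentiated there. -/
theorem isOpen_ne_zero {v : (x : X) → TangentSpace (𝓡 d) x}
    (hv : ContMDiff (𝓡 d) (𝓡 d).tangent ∞ (fun x => (⟨x, v x⟩ : TangentBundle (𝓡 d) X))) :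
    IsOpen {x | v x ≠ 0} := by
  rw [isOpen_iff_mem_nhds]
  intro z hz
  have hc : ContinuousAt (coordField v z ∘ extChartAt (𝓡 d) z) z :=
    ((contDiffOn_coordField hv z).continuousOn.comp (continuousOn_extChartAt z)
      (fun x hx => (extChartAt (𝓡 d) z).map_source hx)).continuousAt
      (extChartAt_source_mem_nhds z)
  have hz' : (coordField v z ∘ extChartAt (𝓡 d) z) z ≠ 0 := by
    intro h0
    have h1 := eq_zero_of_coordField (mem_extChartAt_target z) h0
    rw [extChartAt_to_inv] at h1
    exact hz h1
  filter_upwards [hc.eventually_ne hz', extChartAt_source_mem_nhds (I := 𝓡 d) z] with w hw hws h0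
  apply hw
  refine coordField_of_eq_zero ?_
  rw [(extChartAt (𝓡 d) z).left_inv hws, h0]

/-- The differential of a real function on `X`. -/
def diffFun (u : X → ℝ) (x : X) : TangentSpace (𝓡 d) x →L[ℝ] ℝ := mfderiv (𝓡 d) 𝓘(ℝ, ℝ) u x

theorem diffFun_symm {x₀ : X} {y : Eu d} (hy : y ∈ (extChartAt (𝓡 d) x₀).target) {u : X → ℝ}
    (hu : MDifferentiableAt (𝓡 d) 𝓘(ℝ, ℝ) u ((extChartAt (𝓡 d) x₀).symm y))
    (w : TangentSpace (𝓡 d) ((extChartAt (𝓡 d) x₀).symm y)) :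
    diffFun u ((extChartAt (𝓡 d) x₀).symm y) w =
      fderiv ℝ (u ∘ (extChartAt (𝓡 d) x₀).symm) y (chartDiff d x₀ y w) :=
  mfderiv_apply_eq_fderiv hy hu w

theorem diffFun_congr {u w : X → ℝ} {x : X} (h : u =ᶠ[𝓝 x] w) :
    (diffFun u x : TangentSpace (𝓡 d) x →L[ℝ] ℝ) = diffFun w x := h.mfderiv_eq

theorem diffFun_const (c : ℝ) (x : X) :
    (diffFun (fun _ : X => c) x : TangentSpace (𝓡 d) x →L[ℝ] ℝ) = 0 := mfderiv_const

theorem diffFun_sum {ι : Type*} (s : Finset ι) {u : ι → X → ℝ} {x : X}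
    (hu : ∀ i ∈ s, MDifferentiableAt (𝓡 d) 𝓘(ℝ, ℝ) (u i) x) :
    MDifferentiableAt (𝓡 d) 𝓘(ℝ, ℝ) (∑ i ∈ s, u i) x ∧
    (diffFun (∑ i ∈ s, u i) x : TangentSpace (𝓡 d) x →L[ℝ] ℝ) = ∑ i ∈ s, diffFun (u i) x := by
  classical
  induction s using Finset.induction_on with
  | empty => exact ⟨mdifferentiableAt_const, mfderiv_const⟩
  | insert a s ha ih =>
    obtain ⟨h1, h2⟩ := ih fun i hi => hu i (Finset.mem_insert_of_mem hi)
    have h3 := hu a (Finset.mem_insert_self a s)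
    rw [Finset.sum_insert ha, Finset.sum_insert ha, ← h2]
    exact ⟨h3.add h1, mfderiv_add h3 h1⟩

theorem contMDiffOn_coordVec (x₀ : X) (w : Eu d) :
    ContMDiffOn 𝓘(ℝ, Eu d) (𝓡 d).tangent ∞
      (fun y => (⟨(extChartAt (𝓡 d) x₀).symm y,
        mfderiv 𝓘(ℝ, Eu d) (𝓡 d) (extChartAt (𝓡 d) x₀).symm y w⟩ :
        TangentBundle (𝓡 d) X)) (extChartAt (𝓡 d) x₀).target := by
  set e := trivializationAt (Eu d) (TangentSpace (𝓡 d) : X → Type _) x₀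
  rw [e.contMDiffOn_iff]
  · refine ⟨contMDiffOn_extChartAt_symm x₀, ?_⟩
    refine (contMDiffOn_const (c := w)).congr fun y hy => ?_
    have h3 := TangentBundle.continuousLinearMapAt_trivializationAt (I := 𝓡 d)
      (mem_chartAt_source_of_mem_target hy)
    have h4 := chartDiff_mfderiv_symm hy w
    rw [chartDiff, ← h3] at h4
    refine Eq.trans ?_ h4
    exact (e.continuousLinearMapAt_apply_of_mem (R := ℝ)
      (mem_chartAt_source_of_mem_target hy) _).symm
  · intro y hy
    rw [e.mem_source]
    exact mem_chartAt_source_of_mem_target hy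

/-- The transition map from the chart at `x₀` to the chart at `x₁`. -/
def transition (d : ℕ) {X : Type*} [TopologicalSpace X] [ChartedSpace (Eu d) X] (x₀ x₁ : X) :
    Eu d → Eu d :=
  extChartAt (𝓡 d) x₁ ∘ (extChartAt (𝓡 d) x₀).symm

/-- The domain of the transition map. -/
def transDom (d : ℕ) {X : Type*} [TopologicalSpace X] [ChartedSpace (Eu d) X] (x₀ x₁ : X) :
    Set (Eu d) :=
  (extChartAt (𝓡 d) x₀).target ∩ (extChartAt (𝓡 d) x₀).symm ⁻¹' (extChartAt (𝓡 d) x₁).source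

theorem isOpen_transDom (x₀ x₁ : X) : IsOpen (transDom d x₀ x₁) :=
  (continuousOn_extChartAt_symm x₀).isOpen_inter_preimage (isOpen_extChartAt_target x₀)
    (isOpen_extChartAt_source x₁)

theorem contDiffOn_transition (x₀ x₁ : X) :
    ContDiffOn ℝ ∞ (transition d x₀ x₁) (transDom d x₀ x₁) := by
  rw [← contMDiffOn_iff_contDiffOn]
  exact (contMDiffOn_extChartAt (x := x₁)).comp
    ((contMDiffOn_extChartAt_symm x₀).mono inter_subset_left)
    (fun y hy => by rw [← extChartAt_source (𝓡 d)]; exact hy.2)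

theorem transition_mem {x₀ x₁ : X} {y : Eu d} (hy : y ∈ transDom d x₀ x₁) :
    transition d x₀ x₁ y ∈ transDom d x₁ x₀ := by
  refine ⟨(extChartAt (𝓡 d) x₁).map_source hy.2, ?_⟩
  change (extChartAt (𝓡 d) x₁).symm (extChartAt (𝓡 d) x₁ ((extChartAt (𝓡 d) x₀).symm y)) ∈
    (extChartAt (𝓡 d) x₀).source
  rw [(extChartAt (𝓡 d) x₁).left_inv hy.2]
  exact (extChartAt (𝓡 d) x₀).map_target hy.1

theorem symm_transition {x₀ x₁ : X} {y : Eu d} (hy : y ∈ transDom d x₀ x₁) :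
    (extChartAt (𝓡 d) x₁).symm (transition d x₀ x₁ y) = (extChartAt (𝓡 d) x₀).symm y :=
  (extChartAt (𝓡 d) x₁).left_inv hy.2

theorem transition_transition {x₀ x₁ : X} {y : Eu d} (hy : y ∈ transDom d x₀ x₁) :
    transition d x₁ x₀ (transition d x₀ x₁ y) = y := by
  change extChartAt (𝓡 d) x₀ _ = _
  rw [symm_transition hy]
  exact (extChartAt (𝓡 d) x₀).right_inv hy.1

theorem mdifferentiableAt_chart {x₁ x : X} (hx : x ∈ (extChartAt (𝓡 d) x₁).source) :
    MDifferentiableAt (𝓡 d) 𝓘(ℝ, Eu d) (extChartAt (𝓡 d) x₁) x := by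
  rw [extChartAt_source] at hx
  exact mdifferentiableAt_extChartAt hx

theorem coordField_transition (v : (x : X) → TangentSpace (𝓡 d) x) {x₀ x₁ : X} {y : Eu d}
    (hy : y ∈ transDom d x₀ x₁) :
    coordField v x₁ (transition d x₀ x₁ y) =
      fderiv ℝ (transition d x₀ x₁) y (coordField v x₀ y) := by
  have := mfderiv_apply_eq_fderiv hy.1 (mdifferentiableAt_chart hy.2)
    (v ((extChartAt (𝓡 d) x₀).symm y))
  rw [coordField, chartDiff, symm_transition hy]
  exact this

/-- The Jacobian matrix, as a linear map of `ℝ^d`, of the inverse chart at `x₀`. -/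
def symmDiff (x₀ : X) (y : Eu d) : Eu d →L[ℝ] Eu d :=
  mfderiv 𝓘(ℝ, Eu d) (𝓡 d) (extChartAt (𝓡 d) x₀).symm y

theorem symmDiff_transition {x₀ x₁ : X} {y : Eu d} (hy : y ∈ transDom d x₀ x₁) :
    symmDiff x₀ y = (symmDiff x₁ (transition d x₀ x₁ y)).comp
      (fderiv ℝ (transition d x₀ x₁) y) := by
  have h1 : (extChartAt (𝓡 d) x₀).symm =ᶠ[𝓝 y]
      (extChartAt (𝓡 d) x₁).symm ∘ transition d x₀ x₁ := by
    filter_upwards [(isOpen_transDom x₀ x₁).mem_nhds hy] with z hz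
    exact (symm_transition hz).symm
  have h2 : DifferentiableAt ℝ (transition d x₀ x₁) y :=
    ((contDiffOn_transition x₀ x₁).differentiableOn (by simp)).differentiableAt
      ((isOpen_transDom x₀ x₁).mem_nhds hy)
  have h3 : mfderiv 𝓘(ℝ, Eu d) (𝓡 d) (extChartAt (𝓡 d) x₀).symm y =
      mfderiv 𝓘(ℝ, Eu d) (𝓡 d) ((extChartAt (𝓡 d) x₁).symm ∘ transition d x₀ x₁) y :=
    h1.mfderiv_eq
  have h4 := mfderiv_comp y (mdifferentiableAt_chart_symm (transition_mem hy).1)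
    h2.mdifferentiableAt
  rw [mfderiv_eq_fderiv] at h4
  exact h3.trans h4

theorem isUnit_det_symmDiff {x₀ : X} {y : Eu d} (hy : y ∈ (extChartAt (𝓡 d) x₀).target) :
    (symmDiff x₀ y).det ≠ 0 := by
  have : Function.Bijective (symmDiff x₀ y : Eu d →ₗ[ℝ] Eu d) :=
    Function.bijective_iff_has_inverse.2 ⟨chartDiff d x₀ y, fun w => chartDiff_mfderiv_symm hy w,
      fun w => mfderiv_symm_chartDiff hy w⟩
  have h2 := (LinearEquiv.ofBijective _ this).isUnit_det'
  exact h2.ne_zero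

/-- The Riemannian metric at `x` as a bilinear form on `ℝ^d`. -/
def metricForm (g : RMetric d X) (x : X) : Eu d →L[ℝ] Eu d →L[ℝ] ℝ := g.inner x

/-- The determinant of the metric at `x` in the standard basis of the tangent space. -/
def metricDet (g : RMetric d X) (x : X) : ℝ :=
  Matrix.det (Matrix.of fun i j : Fin d =>
    metricForm g x (EuclideanSpace.single i (1 : ℝ)) (EuclideanSpace.single j (1 : ℝ)))

/-- If `M` is the matrix of `L`, the Gram matrix `G` becomes `Mᵀ G M`. -/
theorem det_gram_comp (B : Eu d →L[ℝ] Eu d →L[ℝ] ℝ) (L : Eu d →L[ℝ] Eu d) :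
    Matrix.det (Matrix.of fun i j : Fin d =>
      B (L (EuclideanSpace.single i (1 : ℝ))) (L (EuclideanSpace.single j (1 : ℝ)))) =
    L.det ^ 2 * Matrix.det (Matrix.of fun i j : Fin d =>
      B (EuclideanSpace.single i (1 : ℝ)) (EuclideanSpace.single j (1 : ℝ))) := by
  set b := (EuclideanSpace.basisFun (Fin d) ℝ).toBasis with hb
  set M := LinearMap.toMatrix b b (L : Eu d →ₗ[ℝ] Eu d) with hM
  have hL : ∀ j, L (EuclideanSpace.single j (1 : ℝ)) =
      ∑ i, M i j • EuclideanSpace.single i (1 : ℝ) := by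
    intro j
    have := (b.sum_repr (L (EuclideanSpace.single j (1 : ℝ)))).symm
    rw [this]
    refine Finset.sum_congr rfl fun i _ => ?_
    simp [hM, LinearMap.toMatrix_apply, hb]
  have hdet : L.det = M.det := by
    rw [hM, LinearMap.det_toMatrix]
  have : (Matrix.of fun i j : Fin d =>
      B (L (EuclideanSpace.single i (1 : ℝ))) (L (EuclideanSpace.single j (1 : ℝ)))) =
      M.transpose * (Matrix.of fun i j : Fin d =>
      B (EuclideanSpace.single i (1 : ℝ)) (EuclideanSpace.single j (1 : ℝ))) * M := by
    ext i j
    simp only [Matrix.of_apply, Matrix.mul_apply, Matrix.transpose_apply, hL]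
    simp only [map_sum, map_smul, sum_apply, smul_apply,
      smul_eq_mul, Finset.mul_sum, Finset.sum_mul]
    refine Finset.sum_congr rfl fun k _ => Finset.sum_congr rfl fun l _ => ?_
    ring
  rw [this, Matrix.det_mul, Matrix.det_mul, Matrix.det_transpose, hdet]
  ring

theorem metricDet_pos (g : RMetric d X) (x : X) : 0 < metricDet g x := by
  apply Matrix.PosDef.det_pos
  refine Matrix.PosDef.of_dotProduct_mulVec_pos ?_ ?_
  · ext i j
    simp only [Matrix.conjTranspose_apply, Matrix.of_apply, star_trivial]
    exact g.symm x _ _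
  · intro c hc
    set w : Eu d := ∑ i, c i • EuclideanSpace.single i (1 : ℝ) with hw
    have hwc : w = WithLp.toLp 2 c := by
      ext j
      simp [hw, Finset.sum_apply, Pi.single_apply]
    have hw0 : w ≠ 0 := by
      rw [hwc]; simpa using hc
    have h1 := g.pos x w hw0
    have h2 : metricForm g x w w = star c ⬝ᵥ (Matrix.of fun i j : Fin d =>
        metricForm g x (EuclideanSpace.single i (1 : ℝ)) (EuclideanSpace.single j (1 : ℝ))).mulVec
          c := by
      simp only [hw, map_sum, map_smul, sum_apply,
        smul_apply, smul_eq_mul, dotProduct, Matrix.mulVec, Matrix.of_apply,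
        Finset.mul_sum, star_trivial]
      rw [Finset.sum_comm]
      refine Finset.sum_congr rfl fun k _ => Finset.sum_congr rfl fun l _ => ?_
      ring
    rw [← h2]
    exact h1

/-- Collects the dependence on the chart in one Jacobian; the transformation rule of the density is
then the multiplicativity of determinants. -/
theorem volDensity_eq (g : RMetric d X) (x₀ : X) (y : Eu d) :
    volDensity g x₀ y = |(symmDiff x₀ y).det| *
      √(metricDet g ((extChartAt (𝓡 d) x₀).symm y)) := by
  have := det_gram_comp (metricForm g ((extChartAt (𝓡 d) x₀).symm y)) (symmDiff x₀ y)
  rw [← Real.sqrt_sq_eq_abs, ← Real.sqrt_mul (sq_nonneg _)]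
  exact congrArg Real.sqrt this

theorem volDensity_pos (g : RMetric d X) {x₀ : X} {y : Eu d}
    (hy : y ∈ (extChartAt (𝓡 d) x₀).target) : 0 < volDensity g x₀ y := by
  rw [volDensity_eq]
  exact mul_pos (abs_pos.2 (isUnit_det_symmDiff hy)) (Real.sqrt_pos.2 (metricDet_pos g _))

theorem volDensity_transition (g : RMetric d X) {x₀ x₁ : X} {y : Eu d}
    (hy : y ∈ transDom d x₀ x₁) :
    volDensity g x₀ y = |(fderiv ℝ (transition d x₀ x₁) y).det| *
      volDensity g x₁ (transition d x₀ x₁ y) := by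
  rw [volDensity_eq, volDensity_eq, symm_transition hy, symmDiff_transition hy]
  have : ((symmDiff x₁ (transition d x₀ x₁ y)).comp (fderiv ℝ (transition d x₀ x₁) y)).det =
      (symmDiff x₁ (transition d x₀ x₁ y)).det * (fderiv ℝ (transition d x₀ x₁) y).det :=
    LinearMap.det_comp _ _
  rw [this, abs_mul]
  ring

/-- The factorization in `volDensity_eq` is of no use here: `metricDet` refers to the preferred
chart at each point and need not be continuous. Smoothness comes from the entries `g(∂_i, ∂_j)`, the
metric being a smooth section evaluated on smooth coordinate fields, and from positivity of the
determinant under the root. -/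
theorem contDiffOn_volDensity (g : RMetric d X) (x₀ : X) :
    ContDiffOn ℝ ∞ (volDensity g x₀) (extChartAt (𝓡 d) x₀).target := by
  have hG : ∀ i j : Fin d, ContDiffOn ℝ ∞ (fun y => g.inner ((extChartAt (𝓡 d) x₀).symm y)
      (coordVec d x₀ y i) (coordVec d x₀ y j)) (extChartAt (𝓡 d) x₀).target := by
    intro i j
    have h1 : ContMDiffOn 𝓘(ℝ, Eu d) ((𝓡 d).prod 𝓘(ℝ, Eu d →L[ℝ] Eu d →L[ℝ] ℝ)) ∞
        (fun y => Bundle.TotalSpace.mk' (Eu d →L[ℝ] Eu d →L[ℝ] ℝ)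
          (E := fun x : X => TangentSpace (𝓡 d) x →L[ℝ] TangentSpace (𝓡 d) x →L[ℝ] ℝ)
          ((extChartAt (𝓡 d) x₀).symm y) (g.inner ((extChartAt (𝓡 d) x₀).symm y)))
        (extChartAt (𝓡 d) x₀).target :=
      g.contMDiff.comp_contMDiffOn (contMDiffOn_extChartAt_symm x₀)
    have h2 := ContMDiffOn.clm_bundle_apply₂ (F₃ := ℝ) (E₃ := Bundle.Trivial X ℝ) h1
      (contMDiffOn_coordVec x₀ (EuclideanSpace.single i (1 : ℝ)))
      (contMDiffOn_coordVec x₀ (EuclideanSpace.single j (1 : ℝ)))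
    rw [← contMDiffOn_iff_contDiffOn]
    intro y hy
    have h3 := h2 y hy
    rw [Bundle.contMDiffWithinAt_totalSpace] at h3
    exact h3.2
  intro y hy
  refine ContDiffWithinAt.sqrt ?_ ?_
  · simp only [Matrix.det_apply]
    refine ContDiffWithinAt.sum fun σ _ => ?_
    refine ContDiffWithinAt.const_smul _ ?_
    refine contDiffWithinAt_prod fun i _ => ?_
    exact hG _ _ y hy
  · have := volDensity_pos g hy
    rw [volDensity, Real.sqrt_pos] at this
    exact this.ne'

end chart

/-! ### The divergence with respect to a density on open subsets of `ℝ^d` -/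

section euclid

variable {d : ℕ}

theorem integrableOn_of_continuousOn_of_compact {E : Type*} [TopologicalSpace E] [T2Space E]
    [MeasurableSpace E] [BorelSpace E] {μ : Measure E} [IsFiniteMeasureOnCompacts μ]
    {W K : Set E} (hW : MeasurableSet W) (hK : IsCompact K) (hKW : K ⊆ W) {f : E → ℝ}
    (hf : ContinuousOn f W) (hf0 : ∀ y ∈ W \ K, f y = 0) : IntegrableOn f W μ :=
  ((hf.mono hKW).integrableOn_compact hK).of_forall_sdiff_eq_zero hW hf0

/-- Integration by parts against the constant function `1`. -/
theorem integral_fderiv_eq_zero {F : Eu d → ℝ} (hF : ContDiff ℝ 1 F) (hc : HasCompactSupport F)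
    (w : Eu d) : ∫ y, fderiv ℝ F y w = 0 := by
  have h1 : Integrable (fun y => fderiv ℝ F y w) :=
    ((hF.continuous_fderiv (by simp)).clm_apply continuous_const).integrable_of_hasCompactSupport
      (hc.fderiv_apply ℝ w)
  have h2 : Integrable F := hF.continuous.integrable_of_hasCompactSupport hc
  have := integral_mul_fderiv_eq_neg_fderiv_mul_of_integrable (μ := (volume : Measure (Eu d)))
    (f := fun _ => (1 : ℝ)) (g := F) (v := w) (by simp) (by simpa using h1)
    (by simpa using h2) (fun _ _ => differentiableAt_const _)
    (fun x _ => hF.differentiable (by simp) x)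
  simpa using this

theorem setIntegral_sum_fderiv_eq_zero {W K : Set (Eu d)} (hW : IsOpen W) (hK : IsCompact K)
    (hKW : K ⊆ W) {F : Fin d → Eu d → ℝ} (hF : ∀ i, ContDiffOn ℝ 1 (F i) W)
    (hF0 : ∀ i, ∀ y ∈ W \ K, F i y = 0) :
    ∫ y in W, ∑ i, fderiv ℝ (F i) y (EuclideanSpace.single i (1 : ℝ)) = 0 := by
  -- Extension by zero; it is smooth because `W` and the complement of `K` cover the space.
  set G : Fin d → Eu d → ℝ := fun i => K.indicator (F i) with hG
  have hGF : ∀ i, ∀ y ∈ W, G i y = F i y := by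
    intro i y hy
    by_cases hyK : y ∈ K
    · simp [hG, hyK]
    · simp [hG, hyK, hF0 i y ⟨hy, hyK⟩]
  have hG0 : ∀ i, ∀ y ∉ K, G i y = 0 := fun i y hy => by simp [hG, hy]
  have hGs : ∀ i, ContDiff ℝ 1 (G i) := by
    intro i
    rw [contDiff_iff_contDiffAt]
    intro y
    by_cases hy : y ∈ W
    · refine ((hF i).contDiffAt (hW.mem_nhds hy)).congr_of_eventuallyEq ?_
      filter_upwards [hW.mem_nhds hy] with z hz using hGF i z hz
    · refine (contDiffAt_const (c := (0 : ℝ))).congr_of_eventuallyEq ?_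
      filter_upwards [hK.isClosed.isOpen_compl.mem_nhds (fun h => hy (hKW h))] with z hz
      exact hG0 i z hz
  have hGc : ∀ i, HasCompactSupport (G i) := fun i => HasCompactSupport.intro hK (hG0 i)
  have hcongr : ∀ i, ∀ y ∈ W, fderiv ℝ (F i) y = fderiv ℝ (G i) y := by
    intro i y hy
    refine Filter.EventuallyEq.fderiv_eq ?_
    filter_upwards [hW.mem_nhds hy] with z hz using (hGF i z hz).symm
  have hGd : ∀ i, ∀ y ∉ W, fderiv ℝ (G i) y = 0 := by
    intro i y hy
    have : G i =ᶠ[𝓝 y] fun _ => (0 : ℝ) := by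
      filter_upwards [hK.isClosed.isOpen_compl.mem_nhds (fun h => hy (hKW h))] with z hz
      exact hG0 i z hz
    rw [this.fderiv_eq]; simp
  calc ∫ y in W, ∑ i, fderiv ℝ (F i) y (EuclideanSpace.single i (1 : ℝ))
      = ∫ y in W, ∑ i, fderiv ℝ (G i) y (EuclideanSpace.single i (1 : ℝ)) := by
        refine setIntegral_congr_fun hW.measurableSet fun y hy => ?_
        exact Finset.sum_congr rfl fun i _ => by rw [hcongr i y hy]
    _ = ∫ y, ∑ i, fderiv ℝ (G i) y (EuclideanSpace.single i (1 : ℝ)) := by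
        refine setIntegral_eq_integral_of_forall_compl_eq_zero fun y hy => ?_
        exact Finset.sum_eq_zero fun i _ => by rw [hGd i y hy]; rfl
    _ = ∑ i, ∫ y, fderiv ℝ (G i) y (EuclideanSpace.single i (1 : ℝ)) := by
        refine integral_finsetSum _ fun i _ => ?_
        exact (((hGs i).continuous_fderiv (by simp)).clm_apply
          continuous_const).integrable_of_hasCompactSupport ((hGc i).fderiv_apply ℝ _)
    _ = 0 := Finset.sum_eq_zero fun i _ => integral_fderiv_eq_zero (hGs i) (hGc i) _

/-- The divergence of the field `V` with respect to the density `σ`. -/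
def wDiv (σ : Eu d → ℝ) (V : Eu d → Eu d) (y : Eu d) : ℝ :=
  (∑ i : Fin d, fderiv ℝ (fun z => σ z * V z i) y (EuclideanSpace.single i (1 : ℝ))) / σ y

theorem contDiffOn_mul_coord {W : Set (Eu d)} {n : WithTop ℕ∞} {σ : Eu d → ℝ} {V : Eu d → Eu d}
    (hσ : ContDiffOn ℝ n σ W) (hV : ContDiffOn ℝ n V W) (i : Fin d) :
    ContDiffOn ℝ n (fun z => σ z * V z i) W :=
  hσ.mul ((contDiff_piLp_apply (p := 2) (i := i)).comp_contDiffOn hV)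

theorem continuousOn_wDiv {W : Set (Eu d)} (hW : IsOpen W) {σ : Eu d → ℝ} {V : Eu d → Eu d}
    (hσ : ContDiffOn ℝ 1 σ W) (hσ0 : ∀ y ∈ W, σ y ≠ 0) (hV : ContDiffOn ℝ 1 V W) :
    ContinuousOn (wDiv σ V) W := by
  refine ContinuousOn.div ?_ hσ.continuousOn hσ0
  refine continuousOn_finsetSum _ fun i _ => ?_
  exact ((contDiffOn_mul_coord hσ hV i).continuousOn_fderiv_of_isOpen hW (by simp)).clm_apply
    continuousOn_const

theorem continuousOn_weak_integrand {W : Set (Eu d)} (hW : IsOpen W) {σ : Eu d → ℝ}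
    {V : Eu d → Eu d} (hσ : ContDiffOn ℝ 1 σ W) (hσ0 : ∀ y ∈ W, σ y ≠ 0)
    (hV : ContDiffOn ℝ 1 V W) {u : Eu d → ℝ} (hu : ContDiffOn ℝ 1 u W) :
    ContinuousOn (fun y => (fderiv ℝ u y (V y) + u y * wDiv σ V y) * σ y) W :=
  (((hu.continuousOn_fderiv_of_isOpen hW (by simp)).clm_apply hV.continuousOn).add
    (hu.continuousOn.mul (continuousOn_wDiv hW hσ hσ0 hV))).mul hσ.continuousOn

theorem weak_integrand_eq {W : Set (Eu d)} (hW : IsOpen W) {σ : Eu d → ℝ}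
    {V : Eu d → Eu d} (hσ : ContDiffOn ℝ 1 σ W) (hσ0 : ∀ y ∈ W, σ y ≠ 0)
    (hV : ContDiffOn ℝ 1 V W) {u : Eu d → ℝ} (hu : ContDiffOn ℝ 1 u W) {y : Eu d} (hy : y ∈ W) :
    (fderiv ℝ u y (V y) + u y * wDiv σ V y) * σ y =
      ∑ i, fderiv ℝ (fun z => u z * (σ z * V z i)) y (EuclideanSpace.single i (1 : ℝ)) := by
  have hud : DifferentiableAt ℝ u y :=
    (hu.differentiableOn (by simp)).differentiableAt (hW.mem_nhds hy)
  have hVd : ∀ i, DifferentiableAt ℝ (fun z => σ z * V z i) y := fun i =>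
    ((contDiffOn_mul_coord hσ hV i).differentiableOn (by simp)).differentiableAt (hW.mem_nhds hy)
  have hVy : V y = ∑ i, V y i • EuclideanSpace.single i (1 : ℝ) := by
    ext j
    simp [Pi.single_apply]
  have h1 : ∀ i, fderiv ℝ (fun z => u z * (σ z * V z i)) y (EuclideanSpace.single i (1 : ℝ)) =
      u y * fderiv ℝ (fun z => σ z * V z i) y (EuclideanSpace.single i (1 : ℝ)) +
      σ y * V y i * fderiv ℝ u y (EuclideanSpace.single i (1 : ℝ)) := by
    intro i
    have := fderiv_fun_mul hud (hVd i)
    rw [this]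
    simp
  simp only [h1, Finset.sum_add_distrib, ← Finset.mul_sum]
  rw [wDiv, add_mul, mul_assoc, div_mul_cancel₀ _ (hσ0 y hy)]
  conv_lhs => rw [hVy]
  rw [map_sum, Finset.sum_mul, add_comm]
  congr 1
  refine Finset.sum_congr rfl fun i _ => ?_
  rw [map_smul, smul_eq_mul]
  ring

/-- The integrand is `∑ ∂_i (u σ V^i)` with `u V` supported in `K`. Either factor may provide the
vanishing: the test function in the proof of invariance, the field in the divergence theorem. -/
theorem setIntegral_weak_integrand {W K : Set (Eu d)} (hW : IsOpen W) (hK : IsCompact K)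
    (hKW : K ⊆ W) {σ : Eu d → ℝ}
    {V : Eu d → Eu d} (hσ : ContDiffOn ℝ 1 σ W) (hσ0 : ∀ y ∈ W, σ y ≠ 0)
    (hV : ContDiffOn ℝ 1 V W) {u : Eu d → ℝ} (hu : ContDiffOn ℝ 1 u W)
    (huV : ∀ y ∈ W \ K, u y = 0 ∨ V y = 0) :
    ∫ y in W, (fderiv ℝ u y (V y) + u y * wDiv σ V y) * σ y = 0 := by
  rw [setIntegral_congr_fun hW.measurableSet
    (fun y hy => weak_integrand_eq hW hσ hσ0 hV hu hy)]
  refine setIntegral_sum_fderiv_eq_zero hW hK hKW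
    (fun i => hu.mul (contDiffOn_mul_coord hσ hV i)) fun i y hy => ?_
  rcases huV y hy with h | h <;> simp [h]

/-- The divergence is invariant under a change of coordinates. -/
theorem wDiv_transition {W W' : Set (Eu d)} (hW : IsOpen W) (hW' : IsOpen W')
    {T T' : Eu d → Eu d} (hT : ContDiffOn ℝ ∞ T W) (hT' : ContDiffOn ℝ ∞ T' W')
    (hTW : ∀ y ∈ W, T y ∈ W') (hTW' : ∀ y ∈ W', T' y ∈ W) (hTT : ∀ y ∈ W, T' (T y) = y)
    (hTT' : ∀ y ∈ W', T (T' y) = y) {σ σ' : Eu d → ℝ} {V V' : Eu d → Eu d}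
    (hσ : ContDiffOn ℝ 1 σ W) (hσ0 : ∀ y ∈ W, σ y ≠ 0) (hV : ContDiffOn ℝ 1 V W)
    (hσ' : ContDiffOn ℝ 1 σ' W') (hσ0' : ∀ y ∈ W', σ' y ≠ 0) (hV' : ContDiffOn ℝ 1 V' W')
    (hσσ : ∀ y ∈ W, σ y = |(fderiv ℝ T y).det| * σ' (T y))
    (hVV : ∀ y ∈ W, V' (T y) = fderiv ℝ T y (V y)) {y : Eu d} (hy : y ∈ W) :
    wDiv σ V y = wDiv σ' V' (T y) := by
  have hcont : ContinuousOn (fun y => (wDiv σ V y - wDiv σ' V' (T y)) * σ y) W :=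
    ((continuousOn_wDiv hW hσ hσ0 hV).sub
      ((continuousOn_wDiv hW' hσ' hσ0' hV').comp hT.continuousOn hTW)).mul hσ.continuousOn
  have himg : T '' W = W' := by
    ext z
    constructor
    · rintro ⟨y, hy, rfl⟩; exact hTW y hy
    · intro hz; exact ⟨T' z, hTW' z hz, hTT' z hz⟩
  have hTd : ∀ y ∈ W, DifferentiableAt ℝ T y := fun y hy =>
    (hT.differentiableOn (by simp)).differentiableAt (hW.mem_nhds hy)
  have hTd' : ∀ y ∈ W', DifferentiableAt ℝ T' y := fun y hy =>
    (hT'.differentiableOn (by simp)).differentiableAt (hW'.mem_nhds hy)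
  -- Tested against `u`, both weak identities have integral zero, the second one after the change of
  -- variables `T`. Their derivative terms agree since `V'` is the push-forward of `V`, so the
  -- difference leaves `∫ u (wDiv σ V - wDiv σ' V' ∘ T) σ = 0`.
  have hae : ∀ᵐ y ∂(volume : Measure (Eu d)), y ∈ W →
      (wDiv σ V y - wDiv σ' V' (T y)) * σ y = 0 := by
    refine hW.ae_eq_zero_of_integral_contDiff_smul_eq_zero
      (hcont.locallyIntegrableOn hW.measurableSet) fun u hu huc huW => ?_
    have hu1 : ContDiff ℝ 1 u := hu.of_le (by simp)
    have huT : ContDiffOn ℝ 1 (u ∘ T') W' := hu1.comp_contDiffOn (hT'.of_le (by simp))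
    have hK' : IsCompact (T '' tsupport u) := huc.isCompact.image_of_continuousOn
      (hT.continuousOn.mono huW)
    have hK'W : T '' tsupport u ⊆ W' := by
      rintro _ ⟨y, hy, rfl⟩; exact hTW y (huW hy)
    have hu0 : ∀ y ∈ W \ tsupport u, u y = 0 := fun y hy => image_eq_zero_of_notMem_tsupport hy.2
    have hu0' : ∀ y ∈ W' \ T '' tsupport u, u (T' y) = 0 := fun y hy =>
      image_eq_zero_of_notMem_tsupport fun h => hy.2 ⟨T' y, h, hTT' y hy.1⟩
    have I1 := setIntegral_weak_integrand hW huc.isCompact huW hσ hσ0 hV hu1.contDiffOn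
      (fun y hy => Or.inl (hu0 y hy))
    have I2 := setIntegral_weak_integrand hW' hK' hK'W hσ' hσ0' hV' huT
      (fun y hy => Or.inl (hu0' y hy))
    have hinj : InjOn T W := fun a ha b hb hab => by rw [← hTT a ha, ← hTT b hb, hab]
    rw [← himg, integral_image_eq_integral_abs_det_fderiv_smul volume hW.measurableSet
      (fun y hy => (hTd y hy).hasFDerivAt.hasFDerivWithinAt) hinj] at I2
    have hpt : ∀ y ∈ W, |(fderiv ℝ T y).det| • ((fderiv ℝ (u ∘ T') (T y) (V' (T y)) +
        (u ∘ T') (T y) * wDiv σ' V' (T y)) * σ' (T y)) =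
        (fderiv ℝ u y (V y) + u y * wDiv σ' V' (T y)) * σ y := by
      intro y hy
      have h1 : fderiv ℝ u y = (fderiv ℝ (u ∘ T') (T y)).comp (fderiv ℝ T y) := by
        rw [← fderiv_comp y ((hu1.differentiable (by simp) _).comp _ (hTd' _ (hTW y hy)))
          (hTd y hy)]
        refine Filter.EventuallyEq.fderiv_eq ?_
        filter_upwards [hW.mem_nhds hy] with z hz
        simp [hTT z hz]
      rw [h1, hVV y hy, hσσ y hy]
      simp only [Function.comp_apply, hTT y hy, smul_eq_mul, ContinuousLinearMap.comp_apply]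
      ring
    rw [setIntegral_congr_fun hW.measurableSet hpt] at I2
    have hi1 : IntegrableOn (fun y => (fderiv ℝ u y (V y) + u y * wDiv σ V y) * σ y) W := by
      refine integrableOn_of_continuousOn_of_compact hW.measurableSet huc.isCompact huW
        (continuousOn_weak_integrand hW hσ hσ0 hV hu1.contDiffOn) fun y hy => ?_
      rw [hu0 y hy, image_eq_zero_of_notMem_tsupport (f := fderiv ℝ u)
        (fun h => hy.2 (tsupport_fderiv_subset ℝ h))]
      simp
    have hi2 : IntegrableOn (fun y => (fderiv ℝ u y (V y) + u y * wDiv σ' V' (T y)) * σ y) W := by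
      refine integrableOn_of_continuousOn_of_compact hW.measurableSet huc.isCompact huW
        ((((hu1.contDiffOn.continuousOn_fderiv_of_isOpen hW (by simp)).clm_apply
          hV.continuousOn).add (hu1.continuous.continuousOn.mul
          ((continuousOn_wDiv hW' hσ' hσ0' hV').comp hT.continuousOn hTW))).mul hσ.continuousOn)
        fun y hy => ?_
      rw [hu0 y hy, image_eq_zero_of_notMem_tsupport (f := fderiv ℝ u)
        (fun h => hy.2 (tsupport_fderiv_subset ℝ h))]
      simp
    have h3 := integral_sub hi1 hi2
    rw [I1, I2, sub_zero] at h3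
    rw [← h3, ← setIntegral_eq_integral_of_forall_compl_eq_zero (s := W)]
    · congr 1
      ext y
      rw [smul_eq_mul]
      ring
    · intro y hy
      rw [image_eq_zero_of_notMem_tsupport (fun h => hy (huW h)), zero_smul]
  -- Continuity turns the almost everywhere statement into one at every point of `W`, and `σ` can be
  -- cancelled.
  have hE : EqOn (fun y => (wDiv σ V y - wDiv σ' V' (T y)) * σ y) (fun _ => (0 : ℝ)) W := by
    refine Measure.eqOn_open_of_ae_eq (μ := (volume : Measure (Eu d))) ?_ hW hcont
      continuousOn_const
    exact (ae_restrict_iff' hW.measurableSet).2 hae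
  have h4 := hE hy
  rcases mul_eq_zero.1 h4 with h | h
  · exact sub_eq_zero.1 h
  · exact absurd h (hσ0 y hy)

end euclid

/-! ### The Riemannian divergence in an arbitrary chart -/

section divergence

variable {d : ℕ} {X : Type*} [TopologicalSpace X] [ChartedSpace (Eu d) X] [IsManifold (𝓡 d) ∞ X]

/-- By definition `divergence` uses a different chart at every point. Invariance under the
transition map lets one chart serve for its whole domain. -/
theorem divergence_eq_wDiv (g : RMetric d X) {v : (x : X) → TangentSpace (𝓡 d) x}
    (hv : ContMDiff (𝓡 d) (𝓡 d).tangent ∞ (fun x => (⟨x, v x⟩ : TangentBundle (𝓡 d) X)))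
    {x₀ : X} {y : Eu d} (hy : y ∈ (extChartAt (𝓡 d) x₀).target) :
    divergence g v ((extChartAt (𝓡 d) x₀).symm y) = wDiv (volDensity g x₀) (coordField v x₀) y := by
  set x := (extChartAt (𝓡 d) x₀).symm y with hx
  have hyW : y ∈ transDom d x₀ x := ⟨hy, mem_extChartAt_source x⟩
  have hsub : ∀ a b : X, transDom d a b ⊆ (extChartAt (𝓡 d) a).target := fun a b => inter_subset_left
  have := wDiv_transition (isOpen_transDom x₀ x) (isOpen_transDom x x₀)
    (contDiffOn_transition x₀ x) (contDiffOn_transition x x₀)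
    (fun z hz => transition_mem hz) (fun z hz => transition_mem hz)
    (fun z hz => transition_transition hz) (fun z hz => transition_transition hz)
    (((contDiffOn_volDensity g x₀).mono (hsub _ _)).of_le (by simp))
    (fun z hz => (volDensity_pos g hz.1).ne')
    (((contDiffOn_coordField hv x₀).mono (hsub _ _)).of_le (by simp))
    (((contDiffOn_volDensity g x).mono (hsub _ _)).of_le (by simp))
    (fun z hz => (volDensity_pos g hz.1).ne')
    (((contDiffOn_coordField hv x).mono (hsub _ _)).of_le (by simp))
    (fun z hz => volDensity_transition g hz) (fun z hz => coordField_transition v hz) hyW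
  rw [this]
  rfl

end divergence

/-! ### The Riemannian volume in a chart -/

section volume

variable {d : ℕ} {X : Type*} [TopologicalSpace X] [ChartedSpace (Eu d) X] [IsManifold (𝓡 d) ∞ X]
  [MeasurableSpace X] [BorelSpace X]

theorem aemeasurable_chart_symm (x₀ : X) : AEMeasurable (extChartAt (𝓡 d) x₀).symm
    ((volume : Measure (Eu d)).restrict (extChartAt (𝓡 d) x₀).target) :=
  (continuousOn_extChartAt_symm x₀).aemeasurable (isOpen_extChartAt_target x₀).measurableSet

theorem aemeasurable_volDensity (g : RMetric d X) (x₀ : X) :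
    AEMeasurable (fun y => ENNReal.ofReal (volDensity g x₀ y))
      ((volume : Measure (Eu d)).restrict (extChartAt (𝓡 d) x₀).target) :=
  ((contDiffOn_volDensity g x₀).continuousOn.aemeasurable
    (isOpen_extChartAt_target x₀).measurableSet).ennreal_ofReal

theorem aemeasurable_chart_symm_withDensity (g : RMetric d X) (x₀ : X) :
    AEMeasurable (extChartAt (𝓡 d) x₀).symm
      (((volume : Measure (Eu d)).restrict (extChartAt (𝓡 d) x₀).target).withDensity
        (fun y => ENNReal.ofReal (volDensity g x₀ y))) :=
  (aemeasurable_chart_symm x₀).mono_ac (withDensity_absolutelyContinuous _ _)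

theorem measurableSet_target_inter_preimage (x₀ : X) {S : Set X} (hS : MeasurableSet S) :
    MeasurableSet ((extChartAt (𝓡 d) x₀).symm ⁻¹' S ∩ (extChartAt (𝓡 d) x₀).target) := by
  have h1 : Measurable ((extChartAt (𝓡 d) x₀).target.domRestrict (extChartAt (𝓡 d) x₀).symm) :=
    (continuousOn_iff_continuous_domRestrict.1 (continuousOn_extChartAt_symm x₀)).measurable
  have h2 := (isOpen_extChartAt_target x₀).measurableSet.subtype_image (h1 hS)
  convert h2 using 1
  ext y
  constructor
  · rintro ⟨h1, h2⟩
    exact ⟨⟨y, h2⟩, h1, rfl⟩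
  · rintro ⟨⟨y, h2⟩, h1, rfl⟩
    exact ⟨h1, h2⟩

theorem chartVolume_apply (g : RMetric d X) (x₀ : X) {S : Set X} (hS : MeasurableSet S) :
    chartVolume g x₀ S =
      ∫⁻ y in (extChartAt (𝓡 d) x₀).symm ⁻¹' S ∩ (extChartAt (𝓡 d) x₀).target,
        ENNReal.ofReal (volDensity g x₀ y) := by
  rw [chartVolume, Measure.map_apply_of_aemeasurable (aemeasurable_chart_symm_withDensity g x₀) hS,
    withDensity_apply', Measure.restrict_restrict' (isOpen_extChartAt_target x₀).measurableSet]

/-- Change of variables along the transition map: its Jacobian is exactly the factor relating the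
two densities. -/
theorem chartVolume_eq (g : RMetric d X) {x₀ x₁ : X} {S : Set X} (hS : MeasurableSet S)
    (h₀ : S ⊆ (extChartAt (𝓡 d) x₀).source) (h₁ : S ⊆ (extChartAt (𝓡 d) x₁).source) :
    chartVolume g x₀ S = chartVolume g x₁ S := by
  rw [chartVolume_apply g x₀ hS, chartVolume_apply g x₁ hS]
  set P := (extChartAt (𝓡 d) x₀).symm ⁻¹' S ∩ (extChartAt (𝓡 d) x₀).target with hP
  have hPW : P ⊆ transDom d x₀ x₁ := fun y hy => ⟨hy.2, h₁ hy.1⟩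
  have himg : transition d x₀ x₁ '' P =
      (extChartAt (𝓡 d) x₁).symm ⁻¹' S ∩ (extChartAt (𝓡 d) x₁).target := by
    ext z
    constructor
    · rintro ⟨y, hy, rfl⟩
      refine ⟨?_, (transition_mem (hPW hy)).1⟩
      rw [mem_preimage, symm_transition (hPW hy)]
      exact hy.1
    · rintro ⟨hz1, hz2⟩
      have hz : z ∈ transDom d x₁ x₀ := ⟨hz2, h₀ hz1⟩
      refine ⟨transition d x₁ x₀ z, ⟨?_, (transition_mem hz).1⟩, transition_transition hz⟩
      rw [mem_preimage, symm_transition hz]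
      exact hz1
  have hinj : InjOn (transition d x₀ x₁) P := fun a ha b hb hab => by
    rw [← transition_transition (hPW ha), ← transition_transition (hPW hb), hab]
  rw [← himg, lintegral_image_eq_lintegral_abs_det_fderiv_mul volume
    (measurableSet_target_inter_preimage x₀ hS) (f' := fderiv ℝ (transition d x₀ x₁)) ?_ hinj]
  · refine setLIntegral_congr_fun (measurableSet_target_inter_preimage x₀ hS) fun y hy => ?_
    rw [volDensity_transition g (hPW hy), ENNReal.ofReal_mul (abs_nonneg _)]
  · intro y hy
    exact (((contDiffOn_transition x₀ x₁).differentiableOn (by simp)).differentiableAt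
      ((isOpen_transDom x₀ x₁).mem_nhds (hPW hy))).hasFDerivAt.hasFDerivWithinAt

theorem chartVolume_compl_source (g : RMetric d X) (x₀ : X) :
    chartVolume g x₀ (extChartAt (𝓡 d) x₀).sourceᶜ = 0 := by
  rw [chartVolume_apply g x₀ (isOpen_extChartAt_source x₀).measurableSet.compl]
  have : (extChartAt (𝓡 d) x₀).symm ⁻¹' (extChartAt (𝓡 d) x₀).sourceᶜ ∩
      (extChartAt (𝓡 d) x₀).target = ∅ := by
    ext y
    simp only [mem_inter_iff, mem_preimage, mem_compl_iff, mem_empty_iff_false, iff_false, not_and]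
    intro h1 h2
    exact h1 ((extChartAt (𝓡 d) x₀).map_target h2)
  rw [this]
  simp

variable [Nonempty X] [SecondCountableTopology X]

theorem iUnion_chartCenters : ⋃ n, (extChartAt (𝓡 d) (chartCenters d X n)).source = univ :=
  (exists_chart_cover d X).choose_spec

/-- On each piece of the gluing the chosen chart may be exchanged for the one at `x₀`, and the
disjoint pieces then add up again. The volume is thus independent of the chosen cover. -/
theorem riemannianVolume_apply_of_subset (g : RMetric d X) {x₀ : X} {S : Set X}
    (hS : MeasurableSet S) (h₀ : S ⊆ (extChartAt (𝓡 d) x₀).source) :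
    riemannianVolume g S = chartVolume g x₀ S := by
  set D := disjointed (fun k => (extChartAt (𝓡 d) (chartCenters d X k)).source) with hD
  have hDm : ∀ n, MeasurableSet (D n) := fun n =>
    MeasurableSet.disjointed (fun k => (isOpen_extChartAt_source _).measurableSet) n
  rw [riemannianVolume, Measure.sum_apply _ hS]
  have h1 : ∀ n, ((chartVolume g (chartCenters d X n)).restrict (D n)) S =
      chartVolume g x₀ (S ∩ D n) := by
    intro n
    rw [Measure.restrict_apply hS]
    exact chartVolume_eq g (hS.inter (hDm n))
      (inter_subset_right.trans (disjointed_subset _ n)) (inter_subset_left.trans h₀)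
  refine (tsum_congr h1).trans ?_
  rw [← measure_iUnion, ← inter_iUnion, hD, iUnion_disjointed, iUnion_chartCenters, inter_univ]
  · intro i j hij
    exact (disjoint_disjointed _ hij).mono inter_subset_right inter_subset_right
  · exact fun n => hS.inter (hDm n)

theorem riemannianVolume_restrict (g : RMetric d X) (x₀ : X) :
    (riemannianVolume g).restrict (extChartAt (𝓡 d) x₀).source = chartVolume g x₀ := by
  ext S hS
  rw [Measure.restrict_apply hS, riemannianVolume_apply_of_subset g
    (hS.inter (isOpen_extChartAt_source x₀).measurableSet) inter_subset_right]
  refine measure_congr ?_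
  have := chartVolume_compl_source g x₀
  have h2 : ((extChartAt (𝓡 d) x₀).source : Set X) =ᵐ[chartVolume g x₀] univ :=
    ae_eq_univ.2 this
  simpa using ((ae_eq_refl S).inter h2)

instance : SFinite (chartVolume (X := X) (d := d) g x₀) := by unfold chartVolume; infer_instance

instance : SFinite (riemannianVolume (X := X) (d := d) g) := by
  unfold riemannianVolume; infer_instance

theorem setIntegral_source (g : RMetric d X) (x₀ : X) {f : X → ℝ}
    (hf : ContinuousOn f (extChartAt (𝓡 d) x₀).source) :
    ∫ x in (extChartAt (𝓡 d) x₀).source, f x ∂(riemannianVolume g) =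
      ∫ y in (extChartAt (𝓡 d) x₀).target,
        f ((extChartAt (𝓡 d) x₀).symm y) * volDensity g x₀ y := by
  have hfm : AEStronglyMeasurable f (chartVolume g x₀) := by
    rw [← riemannianVolume_restrict]
    exact hf.aestronglyMeasurable (isOpen_extChartAt_source x₀).measurableSet
  rw [riemannianVolume_restrict]
  rw [chartVolume] at hfm ⊢
  rw [integral_map (aemeasurable_chart_symm_withDensity g x₀) hfm,
    integral_withDensity_eq_integral_toReal_smul₀ (aemeasurable_volDensity g x₀)
      (Eventually.of_forall fun _ => ENNReal.ofReal_lt_top)]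
  refine setIntegral_congr_fun (isOpen_extChartAt_target x₀).measurableSet fun y hy => ?_
  simp only [smul_eq_mul]
  rw [ENNReal.toReal_ofReal (volDensity_pos g hy).le, mul_comm]

theorem integrableOn_source (g : RMetric d X) (x₀ : X) {f : X → ℝ}
    (hf : ContinuousOn f (extChartAt (𝓡 d) x₀).source)
    (hi : IntegrableOn (fun y => f ((extChartAt (𝓡 d) x₀).symm y) * volDensity g x₀ y)
      (extChartAt (𝓡 d) x₀).target) :
    IntegrableOn f (extChartAt (𝓡 d) x₀).source (riemannianVolume g) := by
  have hfm : AEStronglyMeasurable f (chartVolume g x₀) := by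
    rw [← riemannianVolume_restrict]
    exact hf.aestronglyMeasurable (isOpen_extChartAt_source x₀).measurableSet
  rw [IntegrableOn, riemannianVolume_restrict]
  rw [chartVolume] at hfm ⊢
  rw [integrable_map_measure hfm (aemeasurable_chart_symm_withDensity g x₀),
    integrable_withDensity_iff_integrable_smul₀' (aemeasurable_volDensity g x₀)
      (Eventually.of_forall fun _ => ENNReal.ofReal_lt_top)]
  refine hi.congr_fun (fun y hy => ?_) (isOpen_extChartAt_target x₀).measurableSet
  simp only [smul_eq_mul, Function.comp_apply]
  rw [ENNReal.toReal_ofReal (volDensity_pos g hy).le, mul_comm]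

end volume

/-! ### The divergence theorem on the manifold -/

section divergence

variable {d : ℕ} {X : Type*} [TopologicalSpace X] [T2Space X] [ChartedSpace (Eu d) X]
  [IsManifold (𝓡 d) ∞ X] [MeasurableSpace X] [BorelSpace X] [Nonempty X]
  [SecondCountableTopology X]

/-- The integrand of the divergence theorem. -/
def divIntegrand (g : RMetric d X) (v : (x : X) → TangentSpace (𝓡 d) x) (u : X → ℝ) (x : X) : ℝ :=
  diffFun u x (v x) + u x * divergence g v x

theorem divIntegrand_symm (g : RMetric d X) {v : (x : X) → TangentSpace (𝓡 d) x}
    (hv : ContMDiff (𝓡 d) (𝓡 d).tangent ∞ (fun x => (⟨x, v x⟩ : TangentBundle (𝓡 d) X)))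
    {u : X → ℝ} (hu : ContMDiff (𝓡 d) 𝓘(ℝ, ℝ) ∞ u) {x₀ : X} {y : Eu d}
    (hy : y ∈ (extChartAt (𝓡 d) x₀).target) :
    divIntegrand g v u ((extChartAt (𝓡 d) x₀).symm y) =
      fderiv ℝ (u ∘ (extChartAt (𝓡 d) x₀).symm) y (coordField v x₀ y) +
        (u ∘ (extChartAt (𝓡 d) x₀).symm) y * wDiv (volDensity g x₀) (coordField v x₀) y := by
  rw [divIntegrand, divergence_eq_wDiv g hv hy,
    diffFun_symm hy (hu.mdifferentiable (by simp) _)]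
  rfl

theorem contDiffOn_comp_symm {u : X → ℝ} (hu : ContMDiff (𝓡 d) 𝓘(ℝ, ℝ) ∞ u) (x₀ : X) :
    ContDiffOn ℝ ∞ (u ∘ (extChartAt (𝓡 d) x₀).symm) (extChartAt (𝓡 d) x₀).target := by
  rw [← contMDiffOn_iff_contDiffOn]
  exact hu.comp_contMDiffOn (contMDiffOn_extChartAt_symm x₀)

theorem continuousOn_source_of_symm {Z : Type*} [TopologicalSpace Z] {f : X → Z} {x₀ : X}
    (hf : ContinuousOn (f ∘ (extChartAt (𝓡 d) x₀).symm) (extChartAt (𝓡 d) x₀).target) :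
    ContinuousOn f (extChartAt (𝓡 d) x₀).source := by
  refine (hf.comp (continuousOn_extChartAt x₀)
    (fun x hx => (extChartAt (𝓡 d) x₀).map_source hx)).congr fun x hx => ?_
  exact congrArg f ((extChartAt (𝓡 d) x₀).left_inv hx).symm

theorem continuous_of_symm {Z : Type*} [TopologicalSpace Z] {f : X → Z}
    (hf : ∀ x₀ : X, ContinuousOn (f ∘ (extChartAt (𝓡 d) x₀).symm) (extChartAt (𝓡 d) x₀).target) :
    Continuous f := by
  rw [continuous_iff_continuousAt]
  intro x
  exact (continuousOn_source_of_symm (hf x)).continuousAt (extChartAt_source_mem_nhds x)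

theorem continuous_divergence (g : RMetric d X) {v : (x : X) → TangentSpace (𝓡 d) x}
    (hv : ContMDiff (𝓡 d) (𝓡 d).tangent ∞ (fun x => (⟨x, v x⟩ : TangentBundle (𝓡 d) X))) :
    Continuous (divergence g v) := by
  refine continuous_of_symm (d := d) fun x₀ => ?_
  exact (continuousOn_wDiv (isOpen_extChartAt_target x₀)
    ((contDiffOn_volDensity g x₀).of_le (by simp)) (fun y hy => (volDensity_pos g hy).ne')
    ((contDiffOn_coordField hv x₀).of_le (by simp))).congr fun y hy => divergence_eq_wDiv g hv hy

theorem continuousOn_divIntegrand_mul (g : RMetric d X) {v : (x : X) → TangentSpace (𝓡 d) x}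
    (hv : ContMDiff (𝓡 d) (𝓡 d).tangent ∞ (fun x => (⟨x, v x⟩ : TangentBundle (𝓡 d) X)))
    {u : X → ℝ} (hu : ContMDiff (𝓡 d) 𝓘(ℝ, ℝ) ∞ u) (x₀ : X) :
    ContinuousOn (divIntegrand g v u ∘ (extChartAt (𝓡 d) x₀).symm)
      (extChartAt (𝓡 d) x₀).target :=
  ((((contDiffOn_comp_symm hu x₀).continuousOn_fderiv_of_isOpen (isOpen_extChartAt_target x₀)
    (by simp)).clm_apply (contDiffOn_coordField hv x₀).continuousOn).add
    ((contDiffOn_comp_symm hu x₀).continuousOn.mul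
    (continuousOn_wDiv (isOpen_extChartAt_target x₀)
    ((contDiffOn_volDensity g x₀).of_le (by simp)) (fun y hy => (volDensity_pos g hy).ne')
    ((contDiffOn_coordField hv x₀).of_le (by simp))))).congr
    fun y hy => divIntegrand_symm g hv hu hy

theorem divergence_eq_zero (g : RMetric d X) {v : (x : X) → TangentSpace (𝓡 d) x}
    {x : X} (hx : x ∉ closure {x | v x ≠ 0}) : divergence g v x = 0 := by
  have h : ∀ᶠ y in 𝓝 (extChartAt (𝓡 d) x x), (extChartAt (𝓡 d) x).symm y ∉ closure {x | v x ≠ 0} := by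
    have h1 : ContinuousAt (extChartAt (𝓡 d) x).symm (extChartAt (𝓡 d) x x) :=
      continuousAt_extChartAt_symm x
    refine h1.eventually (isClosed_closure.isOpen_compl.mem_nhds ?_)
    simpa [extChartAt_to_inv] using hx
  rw [divergence, div_eq_zero_iff]
  left
  refine Finset.sum_eq_zero fun i _ => ?_
  have h2 : (fun y : Eu d => volDensity g x y * coordComp v x y i) =ᶠ[𝓝 (extChartAt (𝓡 d) x x)]
      fun _ => (0 : ℝ) := by
    filter_upwards [h] with y hy
    have : v ((extChartAt (𝓡 d) x).symm y) = 0 := by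
      by_contra h3
      exact hy (subset_closure h3)
    rw [coordComp, this, map_zero]
    simp
  rw [h2.fderiv_eq]
  simp

/-- The divergence theorem for a function supported in a chart. -/
theorem integral_divIntegrand_of_tsupport (g : RMetric d X) {v : (x : X) → TangentSpace (𝓡 d) x}
    (hv : ContMDiff (𝓡 d) (𝓡 d).tangent ∞ (fun x => (⟨x, v x⟩ : TangentBundle (𝓡 d) X)))
    (hvc : IsCompact (closure {x | v x ≠ 0}))
    {u : X → ℝ} (hu : ContMDiff (𝓡 d) 𝓘(ℝ, ℝ) ∞ u) {x₀ : X}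
    (hus : tsupport u ⊆ (extChartAt (𝓡 d) x₀).source) :
    Integrable (divIntegrand g v u) (riemannianVolume g) ∧
      ∫ x, divIntegrand g v u x ∂(riemannianVolume g) = 0 := by
  -- The support of `u` may be non-compact; compactness comes from the support of `v`.
  set K := extChartAt (𝓡 d) x₀ '' (tsupport u ∩ closure {x | v x ≠ 0}) with hKdef
  have hK : IsCompact K := (hvc.inter_left (isClosed_tsupport u)).image_of_continuousOn
    ((continuousOn_extChartAt x₀).mono (inter_subset_left.trans hus))
  have hKW : K ⊆ (extChartAt (𝓡 d) x₀).target := by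
    rintro _ ⟨x, hx, rfl⟩
    exact (extChartAt (𝓡 d) x₀).map_source (hus hx.1)
  have hoff : ∀ y ∈ (extChartAt (𝓡 d) x₀).target \ K,
      (extChartAt (𝓡 d) x₀).symm y ∉ tsupport u ∨
      (extChartAt (𝓡 d) x₀).symm y ∉ closure {x | v x ≠ 0} := by
    rintro y ⟨hy, hyK⟩
    by_contra! h
    exact hyK ⟨_, h, (extChartAt (𝓡 d) x₀).right_inv hy⟩
  have hz : ∀ x, x ∉ tsupport u → divIntegrand g v u x = 0 := by
    intro x hx
    have h1 : u =ᶠ[𝓝 x] fun _ => (0 : ℝ) := notMem_tsupport_iff_eventuallyEq.1 hx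
    rw [divIntegrand, diffFun_congr h1, diffFun_const, h1.self_of_nhds]
    simp
  have hz' : ∀ x, x ∉ closure {x | v x ≠ 0} → divIntegrand g v u x = 0 := by
    intro x hx
    have h1 : v x = 0 := by
      by_contra h3
      exact hx (subset_closure h3)
    rw [divIntegrand, h1, divergence_eq_zero g hx, map_zero]
    simp
  have hzero : ∀ x ∉ (extChartAt (𝓡 d) x₀).source, divIntegrand g v u x = 0 :=
    fun x hx => hz x fun h => hx (hus h)
  have hcont := continuousOn_divIntegrand_mul g hv hu x₀
  have hcs := continuousOn_source_of_symm hcont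
  have hTi : IntegrableOn (divIntegrand g v u) (extChartAt (𝓡 d) x₀).source
      (riemannianVolume g) := by
    refine integrableOn_source g x₀ hcs ?_
    refine integrableOn_of_continuousOn_of_compact (isOpen_extChartAt_target x₀).measurableSet hK
      hKW (hcont.mul (contDiffOn_volDensity g x₀).continuousOn) fun y hy => ?_
    have : divIntegrand g v u ((extChartAt (𝓡 d) x₀).symm y) = 0 := by
      rcases hoff y hy with h | h
      · exact hz _ h
      · exact hz' _ h
    rw [this, zero_mul]
  refine ⟨(integrableOn_iff_integrable_of_support_subset fun x hx => ?_).1 hTi, ?_⟩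
  · by_contra h
    exact hx (hzero x h)
  · rw [← setIntegral_eq_integral_of_forall_compl_eq_zero hzero, setIntegral_source g x₀ hcs,
      setIntegral_congr_fun (isOpen_extChartAt_target x₀).measurableSet
        (fun y hy => by rw [divIntegrand_symm g hv hu hy])]
    refine setIntegral_weak_integrand (isOpen_extChartAt_target x₀) hK hKW
      ((contDiffOn_volDensity g x₀).of_le (by simp)) (fun y hy => (volDensity_pos g hy).ne')
      ((contDiffOn_coordField hv x₀).of_le (by simp))
      ((contDiffOn_comp_symm hu x₀).of_le (by simp)) fun y hy => ?_
    rcases hoff y hy with h | h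
    · exact Or.inl (image_eq_zero_of_notMem_tsupport (f := u) h)
    · right
      have h1 : v ((extChartAt (𝓡 d) x₀).symm y) = 0 := by
        by_contra h3
        exact h (subset_closure h3)
      rw [coordField, h1, map_zero]

/-- The divergence theorem. -/
theorem integral_divIntegrand (g : RMetric d X) {v : (x : X) → TangentSpace (𝓡 d) x}
    (hv : ContMDiff (𝓡 d) (𝓡 d).tangent ∞ (fun x => (⟨x, v x⟩ : TangentBundle (𝓡 d) X)))
    (hvc : IsCompact (closure {x | v x ≠ 0}))
    {u : X → ℝ} (hu : ContMDiff (𝓡 d) 𝓘(ℝ, ℝ) ∞ u) :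
    ∫ x, divIntegrand g v u x ∂(riemannianVolume g) = 0 := by
  have : LocallyCompactSpace X := Manifold.locallyCompact_of_finiteDimensional (𝓡 d)
  obtain ⟨t, -, ht⟩ := hvc.elim_nhds_subcover (fun x => (extChartAt (𝓡 d) x).source)
    (fun x _ => extChartAt_source_mem_nhds x)
  -- The functions `χ i` sum to `1` only on the support of `v`, which is enough because the
  -- integrand vanishes off it. Finitely many charts suffice there.
  obtain ⟨χ, hχ⟩ := SmoothPartitionOfUnity.exists_isSubordinate (𝓡 d)
    (isClosed_closure (s := {x | v x ≠ 0})) (fun i : t => (extChartAt (𝓡 d) (i : X)).source)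
    (fun i => isOpen_extChartAt_source _) (fun x hx => by
      obtain ⟨i, hi, hxi⟩ := mem_iUnion₂.1 (ht hx)
      exact mem_iUnion.2 ⟨⟨i, hi⟩, hxi⟩)
  have hsum : ∀ x ∈ closure {x | v x ≠ 0}, ∑ i, χ i x = 1 := by
    intro x hx
    rw [← finsum_eq_sum_of_fintype]
    exact χ.sum_eq_one hx
  have hw : ∀ i, ContMDiff (𝓡 d) 𝓘(ℝ, ℝ) ∞ (fun x => χ i x * u x) :=
    fun i => (χ i).contMDiff.mul hu
  have hws : ∀ i, tsupport (fun x => χ i x * u x) ⊆ (extChartAt (𝓡 d) (i : X)).source := fun i =>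
    (tsupport_mul_subset_left (f := χ i) (g := u)).trans (hχ i)
  -- The relation `∑ χ i = 1` can be differentiated only in the interior of the support. At the
  -- remaining points of the support `v x = 0`, and the derivative term drops out.
  have hpt : ∀ x, divIntegrand g v u x = ∑ i, divIntegrand g v (fun x => χ i x * u x) x := by
    intro x
    by_cases hx : x ∈ closure {x | v x ≠ 0}
    · simp only [divIntegrand, Finset.sum_add_distrib, ← Finset.sum_mul, hsum x hx, one_mul]
      congr 1
      by_cases hvx : v x = 0
      · rw [hvx, map_zero]
        simp
      · have hU : closure {x | v x ≠ 0} ∈ 𝓝 x := by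
          exact mem_of_superset ((isOpen_ne_zero hv).mem_nhds hvx) subset_closure
        have hE : u =ᶠ[𝓝 x] ∑ i, fun x => χ i x * u x := by
          filter_upwards [hU] with z hz
          rw [Finset.sum_apply, ← Finset.sum_mul, hsum z hz, one_mul]
        rw [diffFun_congr hE, (diffFun_sum _ fun i _ => (hw i).mdifferentiable (by simp) x).2]
        exact sum_apply _ _ _
    · have h1 : v x = 0 := by
        by_contra h3
        exact hx (subset_closure h3)
      simp only [divIntegrand, h1, map_zero, divergence_eq_zero g hx]
      simp
  simp_rw [hpt]
  rw [integral_finsetSum _ fun i _ =>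
    (integral_divIntegrand_of_tsupport g hv hvc (hw i) (hws i)).1]
  exact Finset.sum_eq_zero fun i _ => (integral_divIntegrand_of_tsupport g hv hvc (hw i) (hws i)).2

end divergence

/-! ### Existence of the flow and its derivative at time zero -/

section flow

variable {d : ℕ} {X : Type*} [TopologicalSpace X] [T2Space X] [ChartedSpace (Eu d) X]
  [IsManifold (𝓡 d) ∞ X]

theorem hasMFDerivAt_symm_comp {v : (x : X) → TangentSpace (𝓡 d) x} {x₀ : X} {α : ℝ → Eu d} {t : ℝ}
    (hα : HasDerivAt α (coordField v x₀ (α t)) t) (ht : α t ∈ (extChartAt (𝓡 d) x₀).target) :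
    HasMFDerivAt 𝓘(ℝ, ℝ) (𝓡 d) ((extChartAt (𝓡 d) x₀).symm ∘ α) t
      ((1 : ℝ →L[ℝ] ℝ).smulRight (v ((extChartAt (𝓡 d) x₀).symm (α t)))) := by
  have h1 := (mdifferentiableAt_chart_symm ht).hasMFDerivAt
  have h2 : HasMFDerivAt 𝓘(ℝ, ℝ) 𝓘(ℝ, Eu d) α t
    ((1 : ℝ →L[ℝ] ℝ).smulRight (coordField v x₀ (α t))) := hα.hasFDerivAt.hasMFDerivAt
  have h3 := HasMFDerivAt.comp t h1 h2
  have h6 : ((1 : ℝ →L[ℝ] ℝ).smulRight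
      (show Eu d from v ((extChartAt (𝓡 d) x₀).symm (α t)))) =
      (symmDiff x₀ (α t)).comp ((1 : ℝ →L[ℝ] ℝ).smulRight (coordField v x₀ (α t))) := by
    refine ContinuousLinearMap.ext fun c => ?_
    have h4 := mfderiv_symm_chartDiff ht (v ((extChartAt (𝓡 d) x₀).symm (α t)))
    have h5 := (symmDiff x₀ (α t)).map_smul c (coordField v x₀ (α t))
    refine Eq.trans ?_ h5.symm
    exact congrArg (fun w : Eu d => c • w) h4.symm
  exact (congrArg (fun L => HasMFDerivAt 𝓘(ℝ, ℝ) (𝓡 d) ((extChartAt (𝓡 d) x₀).symm ∘ α) t L)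
    h6).mpr h3

/-- Picard–Lindelöf for the coordinate field gives a common existence time for all nearby initial
points; joint continuity in point and time keeps the solutions inside the chart target, so that they
can be carried back to `X`. -/
theorem exists_local_flow {v : (x : X) → TangentSpace (𝓡 d) x}
    (hv : ContMDiff (𝓡 d) (𝓡 d).tangent ∞ (fun x => (⟨x, v x⟩ : TangentBundle (𝓡 d) X)))
    (x₀ : X) : ∃ U ∈ 𝓝 x₀, ∃ ε > 0, ∀ x ∈ U, ∃ γ : ℝ → X, γ 0 = x ∧
      IsMIntegralCurveOn (I := 𝓡 d) γ v (Ioo (-ε) ε) := by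
  set y₀ := extChartAt (𝓡 d) x₀ x₀ with hy₀
  have hV : ContDiffAt ℝ 1 (coordField v x₀) y₀ :=
    ((contDiffOn_coordField hv x₀).contDiffAt (extChartAt_target_mem_nhds x₀)).of_le (by simp)
  obtain ⟨ε, hε, a, r, L, K, hr, hPL⟩ := IsPicardLindelof.of_contDiffAt_one hV
  obtain ⟨α, hα, hαc⟩ :=
    (hPL 0).exists_forall_mem_closedBall_eq_hasDerivWithinAt_continuousOn
  have hnh : Metric.closedBall y₀ r ×ˢ Icc (0 - ε) (0 + ε) ∈ 𝓝 (y₀, (0 : ℝ)) :=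
    prod_mem_nhds (Metric.closedBall_mem_nhds _ (by exact_mod_cast hr))
      (Icc_mem_nhds (by linarith) (by linarith))
  have hα0 : α (y₀, 0) = y₀ := (hα y₀ (Metric.mem_closedBall_self r.2)).1
  have hev : ∀ᶠ p in 𝓝 (y₀, (0 : ℝ)), α p ∈ (extChartAt (𝓡 d) x₀).target := by
    refine (hαc.continuousAt hnh).eventually ?_
    rw [hα0]
    exact extChartAt_target_mem_nhds x₀
  have hev2 := hev.and hnh
  rw [nhds_prod_eq, Filter.eventually_prod_iff] at hev2
  obtain ⟨P, hP, Q, hQ, hPQ⟩ := hev2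
  obtain ⟨δ, hδ, hδQ⟩ := Metric.eventually_nhds_iff_ball.1 hQ
  refine ⟨{x | x ∈ (extChartAt (𝓡 d) x₀).source ∧ P (extChartAt (𝓡 d) x₀ x)}, ?_, min δ ε,
    lt_min hδ hε, ?_⟩
  · exact Filter.inter_mem (extChartAt_source_mem_nhds x₀)
      ((continuousAt_extChartAt x₀).eventually hP)
  · rintro x ⟨hx, hPx⟩
    have hQ0 : Q 0 := hδQ 0 (Metric.mem_ball_self hδ)
    have hxb : extChartAt (𝓡 d) x₀ x ∈ Metric.closedBall y₀ r := (hPQ hPx hQ0).2.1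
    obtain ⟨h0, h1⟩ := hα _ hxb
    refine ⟨(extChartAt (𝓡 d) x₀).symm ∘ fun t => α (extChartAt (𝓡 d) x₀ x, t), ?_, ?_⟩
    · exact (congrArg _ h0).trans ((extChartAt (𝓡 d) x₀).left_inv hx)
    · intro t ht
      have htQ : Q t := hδQ t (by
        rw [Real.ball_eq_Ioo]
        exact ⟨by linarith [ht.1, min_le_left δ ε], by linarith [ht.2, min_le_left δ ε]⟩)
      have ht1 : -ε < t := by linarith [ht.1, min_le_right δ ε]
      have ht2 : t < ε := by linarith [ht.2, min_le_right δ ε]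
      have hd := (h1 t ⟨by linarith, by linarith⟩).hasDerivAt
        (Icc_mem_nhds (by linarith) (by linarith))
      exact (hasMFDerivAt_symm_comp (α := fun t => α (extChartAt (𝓡 d) x₀ x, t)) hd
        (hPQ hPx htQ).1).hasMFDerivWithinAt

theorem isCompact_closure_v (A : LieAlg d X) : IsCompact (closure {x | A.v x ≠ 0}) := by
  obtain ⟨K, hK, h⟩ := A.compact_v
  exact hK.of_isClosed_subset isClosed_closure
    (closure_minimal (fun x hx => by_contra fun hxK => hx (h x hxK)) hK.isClosed)

theorem isCompact_closure_a (A : LieAlg d X) : IsCompact (closure {x | A.a x ≠ 0}) := by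
  obtain ⟨K, hK, h⟩ := A.compact_a
  exact hK.of_isClosed_subset isClosed_closure
    (closure_minimal (fun x hx => by_contra fun hxK => hx (h x hxK)) hK.isClosed)

/-- Compactness of the support turns the local existence times into a uniform one, and off the
support constant curves serve. Curves with a uniform existence time extend to all of `ℝ`. The
default branch of `flow` therefore never occurs. -/
theorem exists_isMIntegralCurve (A : LieAlg d X) (x : X) :
    ∃ γ : ℝ → X, γ 0 = x ∧ IsMIntegralCurve (I := 𝓡 d) γ A.v := by
  obtain ⟨K, hK, hK0⟩ := A.compact_v
  have hloc : ∃ ε > 0, ∀ x ∈ K, ∃ γ : ℝ → X, γ 0 = x ∧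
      IsMIntegralCurveOn (I := 𝓡 d) γ A.v (Ioo (-ε) ε) := by
    refine hK.induction_on (p := fun S => ∃ ε > 0, ∀ x ∈ S, ∃ γ : ℝ → X, γ 0 = x ∧
      IsMIntegralCurveOn (I := 𝓡 d) γ A.v (Ioo (-ε) ε)) ⟨1, one_pos, by simp⟩ ?_ ?_ ?_
    · rintro S T hST ⟨ε, hε, h⟩
      exact ⟨ε, hε, fun x hx => h x (hST hx)⟩
    · rintro S T ⟨ε, hε, h⟩ ⟨δ, hδ, h'⟩
      refine ⟨min ε δ, lt_min hε hδ, ?_⟩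
      rintro x (hx | hx)
      · obtain ⟨γ, h0, h1⟩ := h x hx
        exact ⟨γ, h0, h1.mono (Ioo_subset_Ioo (neg_le_neg (min_le_left _ _)) (min_le_left _ _))⟩
      · obtain ⟨γ, h0, h1⟩ := h' x hx
        exact ⟨γ, h0, h1.mono (Ioo_subset_Ioo (neg_le_neg (min_le_right _ _)) (min_le_right _ _))⟩
    · intro x _
      obtain ⟨U, hU, ε, hε, h⟩ := exists_local_flow A.smooth_v x
      exact ⟨U, mem_nhdsWithin_of_mem_nhds hU, ε, hε, h⟩
  obtain ⟨ε, hε, h⟩ := hloc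
  refine exists_isMIntegralCurve_of_isMIntegralCurveOn (I := 𝓡 d)
    (A.smooth_v.of_le (by simp)) hε (fun z => ?_) x
  by_cases hz : z ∈ K
  · exact h z hz
  · exact ⟨fun _ => z, rfl, (isMIntegralCurve_const (hK0 z hz)).isMIntegralCurveOn _⟩

/-- The flow in the chart at the starting point. -/
theorem hasDerivAt_chart_flow (A : LieAlg d X) (x : X) :
    HasDerivAt (fun t => extChartAt (𝓡 d) x (flow A.v t x))
      (coordField A.v x (extChartAt (𝓡 d) x x)) 0 ∧ Tendsto (fun t => flow A.v t x) (𝓝 0) (𝓝 x) ∧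
      flow A.v 0 x = x := by
  obtain ⟨γ, rfl, hγ⟩ := exists_isMIntegralCurve A x
  have hfl : (fun t => flow A.v t (γ 0)) = γ := funext fun t => flow_eq A hγ t
  have h1 := hγ 0
  have h2 : HasMFDerivAt (𝓡 d) 𝓘(ℝ, Eu d) (extChartAt (𝓡 d) (γ 0)) (γ 0)
      (mfderiv (𝓡 d) 𝓘(ℝ, Eu d) (extChartAt (𝓡 d) (γ 0)) (γ 0)) :=
    (mdifferentiableAt_chart (mem_extChartAt_source _)).hasMFDerivAt
  set M : Eu d →L[ℝ] Eu d := mfderiv (𝓡 d) 𝓘(ℝ, Eu d) (extChartAt (𝓡 d) (γ 0)) (γ 0) with hM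
  have h3 : HasFDerivAt (extChartAt (𝓡 d) (γ 0) ∘ γ)
      (M.comp ((1 : ℝ →L[ℝ] ℝ).smulRight (show Eu d from A.v (γ 0)))) 0 :=
    (HasMFDerivAt.comp 0 h2 h1).hasFDerivAt
  have h3' := h3.hasDerivAt
  refine ⟨?_, ?_, flow_eq A hγ 0⟩
  · have h4 : (fun t => extChartAt (𝓡 d) (γ 0) (flow A.v t (γ 0))) =
        extChartAt (𝓡 d) (γ 0) ∘ γ := by
      funext t
      exact congrArg _ (congrFun hfl t)
    rw [h4]
    convert! h3' using 1
    have h5 : ∀ z (hz : z = γ 0),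
        (mfderiv (𝓡 d) 𝓘(ℝ, Eu d) (extChartAt (𝓡 d) (γ 0)) z (A.v z) : Eu d) =
          mfderiv (𝓡 d) 𝓘(ℝ, Eu d) (extChartAt (𝓡 d) (γ 0)) (γ 0) (A.v (γ 0)) := by
      rintro z rfl; rfl
    refine (h5 _ (extChartAt_to_inv (I := 𝓡 d) (γ 0))).trans ?_
    refine congrArg M ?_
    exact (one_smul ℝ (show Eu d from A.v (γ 0))).symm
  · rw [hfl]
    exact h1.continuousAt

end flow

/-! ### Calculus for smooth functions on `X × ℝ₊` -/

section smooth

variable {d : ℕ} {X : Type*} [TopologicalSpace X] [ChartedSpace (Eu d) X]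

/-- Smoothness on `X × ℝ₊`. -/
def SmoothXR (d : ℕ) {X : Type*} [TopologicalSpace X] [ChartedSpace (Eu d) X]
    (φ : X × ℝ → ℝ) : Prop :=
  ContMDiffOn ((𝓡 d).prod 𝓘(ℝ, ℝ)) 𝓘(ℝ, ℝ) ∞ φ (univ ×ˢ Ioi (0 : ℝ))

/-- A function on `X × ℝ` in the chart centred at `x₀`. -/
def chartRep (φ : X × ℝ → ℝ) (x₀ : X) (z : Eu d × ℝ) : ℝ :=
  φ ((extChartAt (𝓡 d) x₀).symm z.1, z.2)

/-- The domain of the chart representation on `X × ℝ₊`. -/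
def chartDom (d : ℕ) {X : Type*} [TopologicalSpace X] [ChartedSpace (Eu d) X] (x₀ : X) :
    Set (Eu d × ℝ) := (extChartAt (𝓡 d) x₀).target ×ˢ Ioi (0 : ℝ)

variable [IsManifold (𝓡 d) ∞ X]

theorem isOpen_chartDom (x₀ : X) : IsOpen (chartDom d x₀) :=
  (isOpen_extChartAt_target x₀).prod isOpen_Ioi

theorem SmoothXR.contDiffOn {φ : X × ℝ → ℝ} (hφ : SmoothXR d φ) (x₀ : X) :
    ContDiffOn ℝ ∞ (chartRep φ x₀) (chartDom d x₀) := by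
  rw [← contMDiffOn_iff_contDiffOn]
  have h1 : ContMDiffOn 𝓘(ℝ, Eu d × ℝ) ((𝓡 d).prod 𝓘(ℝ, ℝ)) ∞
      (fun z : Eu d × ℝ => ((extChartAt (𝓡 d) x₀).symm z.1, z.2)) (chartDom d x₀) := by
    refine ContMDiffOn.prodMk ?_ ?_
    · exact (contMDiffOn_extChartAt_symm x₀).comp
        (contDiff_fst.contMDiff.contMDiffOn) (fun z hz => hz.1)
    · exact contDiff_snd.contMDiff.contMDiffOn
  exact ContMDiffOn.comp hφ h1 fun z hz => ⟨mem_univ _, hz.2⟩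

theorem SmoothXR.differentiableAt {φ : X × ℝ → ℝ} (hφ : SmoothXR d φ) {x₀ : X} {z : Eu d × ℝ}
    (hz : z ∈ chartDom d x₀) : DifferentiableAt ℝ (chartRep φ x₀) z :=
  ((hφ.contDiffOn x₀).differentiableOn (by simp)).differentiableAt ((isOpen_chartDom x₀).mem_nhds hz)

theorem SmoothXR.contMDiff_slice {φ : X × ℝ → ℝ} (hφ : SmoothXR d φ) {s : ℝ} (hs : 0 < s) :
    ContMDiff (𝓡 d) 𝓘(ℝ, ℝ) ∞ (fun x => φ (x, s)) := by
  rw [← contMDiffOn_univ]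
  exact ContMDiffOn.comp hφ
    ((contMDiff_id.prodMk contMDiff_const).contMDiffOn (s := (univ : Set X)))
    fun x _ => ⟨mem_univ _, hs⟩

theorem SmoothXR.continuousOn {φ : X × ℝ → ℝ} (hφ : SmoothXR d φ) :
    ContinuousOn φ (univ ×ˢ Ioi (0 : ℝ)) := ContMDiffOn.continuousOn hφ

theorem SmoothXR.differentiableAt_mark {φ : X × ℝ → ℝ} (hφ : SmoothXR d φ) (x : X) {s : ℝ}
    (hs : 0 < s) : DifferentiableAt ℝ (fun r => φ (x, r)) s := by
  have h := hφ.differentiableAt (x₀ := x) (z := (extChartAt (𝓡 d) x x, s))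
    ⟨mem_extChartAt_target x, hs⟩
  have h2 : DifferentiableAt ℝ (fun r : ℝ => (extChartAt (𝓡 d) x x, r)) s :=
    (differentiableAt_const _).prodMk differentiableAt_id
  have h3 := DifferentiableAt.comp s h h2
  have h4 : (chartRep φ x ∘ fun r : ℝ => (extChartAt (𝓡 d) x x, r)) = fun r => φ (x, r) := by
    funext r
    simp only [Function.comp_apply, chartRep]
    rw [extChartAt_to_inv]
  rwa [h4] at h3

theorem diffX_eq (φ : X × ℝ → ℝ) (z : X × ℝ) :
    diffX d φ z = diffFun (fun x => φ (x, z.2)) z.1 := rfl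

/-- The derivative along `(v, a)` in a chart. -/
theorem dirDerivXR_chart {φ : X × ℝ → ℝ} (hφ : SmoothXR d φ)
    (v : (x : X) → TangentSpace (𝓡 d) x) (a : X → ℝ) {x₀ : X} {z : Eu d × ℝ}
    (hz : z ∈ chartDom d x₀) :
    dirDerivXR v a φ ((extChartAt (𝓡 d) x₀).symm z.1, z.2) =
      fderiv ℝ (chartRep φ x₀) z
        (coordField v x₀ z.1, a ((extChartAt (𝓡 d) x₀).symm z.1) * z.2) := by
  have hd := (hφ.differentiableAt hz).hasFDerivAt
  have h1 : HasFDerivAt (fun y : Eu d => (y, z.2)) (ContinuousLinearMap.inl ℝ (Eu d) ℝ) z.1 :=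
    hasFDerivAt_prodMk_left z.1 z.2
  have h2 : HasFDerivAt (fun r : ℝ => (z.1, r)) (ContinuousLinearMap.inr ℝ (Eu d) ℝ) z.2 :=
    hasFDerivAt_prodMk_right z.1 z.2
  have h3 := (HasFDerivAt.comp z.1 (g := chartRep φ x₀) hd h1).fderiv
  have h4 := (HasFDerivAt.comp z.2 (g := chartRep φ x₀) hd h2).hasDerivAt.deriv
  have h5 : deriv (fun s => φ ((extChartAt (𝓡 d) x₀).symm z.1, s)) z.2 =
      fderiv ℝ (chartRep φ x₀) z (0, 1) := h4
  have h6 : diffX d φ ((extChartAt (𝓡 d) x₀).symm z.1, z.2) (v ((extChartAt (𝓡 d) x₀).symm z.1)) =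
      fderiv ℝ (chartRep φ x₀) z (coordField v x₀ z.1, 0) := by
    rw [diffX_eq]
    refine (diffFun_symm hz.1 ((hφ.contMDiff_slice hz.2).mdifferentiable (by simp) _) _).trans ?_
    change fderiv ℝ (chartRep φ x₀ ∘ fun y : Eu d => (y, z.2)) z.1 _ = _
    rw [h3]
    rfl
  rw [dirDerivXR, h6, h5]
  have h7 : (coordField v x₀ z.1, a ((extChartAt (𝓡 d) x₀).symm z.1) * z.2) =
      (coordField v x₀ z.1, (0 : ℝ)) +
        (a ((extChartAt (𝓡 d) x₀).symm z.1) * z.2) • ((0 : Eu d), (1 : ℝ)) := by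
    ext <;> simp
  rw [h7, map_add, map_smul, smul_eq_mul]
  ring

theorem dirDerivXR_add_zero (v : (x : X) → TangentSpace (𝓡 d) x) (a : X → ℝ) (φ : X × ℝ → ℝ)
    (z : X × ℝ) : dirDerivXR v a φ z =
      dirDerivXR v (fun _ => 0) φ z + dirDerivXR (d := d) (fun _ => 0) a φ z := by
  simp [dirDerivXR]

theorem dirDerivXR_eq_zero {v : (x : X) → TangentSpace (𝓡 d) x} {a : X → ℝ} (φ : X × ℝ → ℝ)
    {z : X × ℝ} (hv : v z.1 = 0) (ha : a z.1 = 0) : dirDerivXR v a φ z = 0 := by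
  simp [dirDerivXR, hv, ha]

/-- The value of the chart representation at `z`, and its derivative, in the chart at `z.1`. -/
theorem dirDerivXR_at {φ : X × ℝ → ℝ} (hφ : SmoothXR d φ)
    (v : (x : X) → TangentSpace (𝓡 d) x) (a : X → ℝ) {z : X × ℝ} (hz : 0 < z.2) :
    dirDerivXR v a φ z =
      fderiv ℝ (chartRep φ z.1) (extChartAt (𝓡 d) z.1 z.1, z.2)
        (coordField v z.1 (extChartAt (𝓡 d) z.1 z.1), a z.1 * z.2) := by
  have := dirDerivXR_chart hφ v a (x₀ := z.1) (z := (extChartAt (𝓡 d) z.1 z.1, z.2))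
    ⟨mem_extChartAt_target z.1, hz⟩
  simpa only [extChartAt_to_inv] using this

theorem chartRep_at (φ : X × ℝ → ℝ) (z : X × ℝ) :
    chartRep (d := d) φ z.1 (extChartAt (𝓡 d) z.1 z.1, z.2) = φ z := by
  rw [chartRep]; simp only [extChartAt_to_inv]

theorem mem_chartDom_self {z : X × ℝ} (hz : 0 < z.2) :
    (extChartAt (𝓡 d) z.1 z.1, z.2) ∈ chartDom d z.1 := ⟨mem_extChartAt_target z.1, hz⟩

theorem SmoothXR.mul {φ ψ : X × ℝ → ℝ} (hφ : SmoothXR d φ) (hψ : SmoothXR d ψ) :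
    SmoothXR d (fun z => φ z * ψ z) := ContMDiffOn.mul hφ hψ

theorem SmoothXR.sub {φ ψ : X × ℝ → ℝ} (hφ : SmoothXR d φ) (hψ : SmoothXR d ψ) :
    SmoothXR d (fun z => φ z - ψ z) := ContMDiffOn.sub hφ hψ

theorem dirDerivXR_mul {φ ψ : X × ℝ → ℝ} (hφ : SmoothXR d φ) (hψ : SmoothXR d ψ)
    (v : (x : X) → TangentSpace (𝓡 d) x) (a : X → ℝ) {z : X × ℝ} (hz : 0 < z.2) :
    dirDerivXR v a (fun z => φ z * ψ z) z = dirDerivXR v a φ z * ψ z + φ z * dirDerivXR v a ψ z := by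
  rw [dirDerivXR_at hφ v a hz, dirDerivXR_at hψ v a hz, dirDerivXR_at (hφ.mul hψ) v a hz]
  have h1 : chartRep (d := d) (fun z => φ z * ψ z) z.1 =
      fun w => chartRep φ z.1 w * chartRep ψ z.1 w := rfl
  rw [h1, fderiv_fun_mul (hφ.differentiableAt (mem_chartDom_self hz))
    (hψ.differentiableAt (mem_chartDom_self hz)), chartRep_at, chartRep_at]
  simp only [add_apply, smul_apply, smul_eq_mul]
  ring

theorem dirDerivXR_sub {φ ψ : X × ℝ → ℝ} (hφ : SmoothXR d φ) (hψ : SmoothXR d ψ)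
    (v : (x : X) → TangentSpace (𝓡 d) x) (a : X → ℝ) {z : X × ℝ} (hz : 0 < z.2) :
    dirDerivXR v a (fun z => φ z - ψ z) z = dirDerivXR v a φ z - dirDerivXR v a ψ z := by
  rw [dirDerivXR_at hφ v a hz, dirDerivXR_at hψ v a hz, dirDerivXR_at (hφ.sub hψ) v a hz]
  have h1 : chartRep (d := d) (fun z => φ z - ψ z) z.1 =
      fun w => chartRep φ z.1 w - chartRep ψ z.1 w := rfl
  rw [h1, fderiv_fun_sub (hφ.differentiableAt (mem_chartDom_self hz))
    (hψ.differentiableAt (mem_chartDom_self hz))]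
  rfl

/-- The constants `c j` stand for the contributions of the other particles, which are frozen in the
one-particle argument. -/
theorem SmoothXR.comp {N : ℕ} {f : (Fin N → ℝ) → ℝ} (hf : ContDiff ℝ ∞ f)
    {φ : Fin N → X × ℝ → ℝ} (hφ : ∀ j, SmoothXR d (φ j)) (c : Fin N → ℝ) :
    SmoothXR d (fun z => f (fun j => c j + φ j z)) := by
  refine hf.contMDiff.comp_contMDiffOn ?_
  rw [contMDiffOn_pi_space]
  exact fun j => contMDiffOn_const.add (hφ j)

theorem dirDerivXR_comp {N : ℕ} {f : (Fin N → ℝ) → ℝ} (hf : ContDiff ℝ ∞ f)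
    {φ : Fin N → X × ℝ → ℝ} (hφ : ∀ j, SmoothXR d (φ j)) (c : Fin N → ℝ)
    (v : (x : X) → TangentSpace (𝓡 d) x) (a : X → ℝ) {z : X × ℝ} (hz : 0 < z.2) :
    dirDerivXR v a (fun z => f (fun j => c j + φ j z)) z =
      fderiv ℝ f (fun j => c j + φ j z) (fun j => dirDerivXR v a (φ j) z) := by
  rw [dirDerivXR_at (SmoothXR.comp hf hφ c) v a hz]
  set w : Eu d × ℝ := (extChartAt (𝓡 d) z.1 z.1, z.2) with hw
  have h1 : HasFDerivAt (fun w : Eu d × ℝ => fun j => c j + chartRep (φ j) z.1 w)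
      (ContinuousLinearMap.pi fun j => fderiv ℝ (chartRep (φ j) z.1) w) w := by
    rw [hasFDerivAt_pi]
    exact fun j => ((hφ j).differentiableAt (mem_chartDom_self hz)).hasFDerivAt.const_add (c j)
  have h2 := HasFDerivAt.comp w (hf.differentiable (by simp) _).hasFDerivAt h1
  have h3 : chartRep (d := d) (fun z => f (fun j => c j + φ j z)) z.1 =
      f ∘ fun w : Eu d × ℝ => fun j => c j + chartRep (φ j) z.1 w := rfl
  rw [h3, h2.fderiv]
  simp only [ContinuousLinearMap.comp_apply]
  congr 1
  · congr 1
    funext j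
    rw [hw, chartRep_at]
  · funext j
    exact (dirDerivXR_at (hφ j) v a hz).symm

theorem continuousOn_prod_of_chart {Z : Type*} [TopologicalSpace Z] {f : X × ℝ → Z}
    (hf : ∀ x₀ : X, ContinuousOn (fun z : Eu d × ℝ => f ((extChartAt (𝓡 d) x₀).symm z.1, z.2))
      (chartDom d x₀)) : ContinuousOn f (univ ×ˢ Ioi (0 : ℝ)) := by
  rintro ⟨x, s⟩ ⟨-, hs⟩
  have hS : (extChartAt (𝓡 d) x).source ×ˢ Ioi (0 : ℝ) ∈ 𝓝 (x, s) :=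
    prod_mem_nhds (extChartAt_source_mem_nhds x) (Ioi_mem_nhds hs)
  have h1 : ContinuousOn (fun z : X × ℝ => (extChartAt (𝓡 d) x z.1, z.2))
      ((extChartAt (𝓡 d) x).source ×ˢ Ioi (0 : ℝ)) :=
    ((continuousOn_extChartAt x).comp continuousOn_fst (fun z hz => hz.1)).prodMk continuousOn_snd
  have h2 := (hf x).comp h1 (fun z hz => ⟨(extChartAt (𝓡 d) x).map_source hz.1, hz.2⟩)
  have h3 : ContinuousOn f ((extChartAt (𝓡 d) x).source ×ˢ Ioi (0 : ℝ)) := by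
    refine h2.congr fun z hz => ?_
    simp only [Function.comp_apply]
    rw [(extChartAt (𝓡 d) x).left_inv hz.1]
  exact (h3.continuousAt hS).continuousWithinAt

theorem continuousOn_dirDerivXR {φ : X × ℝ → ℝ} (hφ : SmoothXR d φ)
    {v : (x : X) → TangentSpace (𝓡 d) x} {a : X → ℝ}
    (hv : ContMDiff (𝓡 d) (𝓡 d).tangent ∞ (fun x => (⟨x, v x⟩ : TangentBundle (𝓡 d) X)))
    (ha : Continuous a) : ContinuousOn (dirDerivXR v a φ) (univ ×ˢ Ioi (0 : ℝ)) := by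
  refine continuousOn_prod_of_chart (d := d) fun x₀ => ?_
  refine ContinuousOn.congr ?_ fun z hz => dirDerivXR_chart hφ v a hz
  refine ((hφ.contDiffOn x₀).continuousOn_fderiv_of_isOpen (isOpen_chartDom x₀)
    (by simp)).clm_apply ?_
  have h1 : ContinuousOn (fun z : Eu d × ℝ => (extChartAt (𝓡 d) x₀).symm z.1) (chartDom d x₀) :=
    (continuousOn_extChartAt_symm x₀).comp continuousOn_fst fun z hz => hz.1
  exact ((contDiffOn_coordField hv x₀).continuousOn.comp continuousOn_fst fun z hz => hz.1).prodMk
    ((ha.comp_continuousOn h1).mul continuousOn_snd)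

theorem contMDiff_zero_field : ContMDiff (𝓡 d) (𝓡 d).tangent ∞
    (fun x => (⟨x, 0⟩ : TangentBundle (𝓡 d) X)) :=
  Bundle.contMDiff_zeroSection ℝ (TangentSpace (𝓡 d) : X → Type _)

end smooth

/-! ### Bounds for test functions and their derivative along the flow -/

section test

variable {d : ℕ} {X : Type*} [TopologicalSpace X] [T2Space X] [ChartedSpace (Eu d) X]
  [IsManifold (𝓡 d) ∞ X]

theorem IsTest.smoothXR {φ : X × ℝ → ℝ} (hφ : IsTest d φ) : SmoothXR d φ := hφ.smooth

theorem IsTest.bounded_val {φ : X × ℝ → ℝ} (hφ : IsTest d φ) :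
    ∃ C : ℝ, ∀ x s, 0 < s → |φ (x, s)| ≤ C := by
  obtain ⟨C, hC⟩ := hφ.decay 0
  exact ⟨C, fun x s hs => by simpa using hC x s hs⟩

/-- The decay condition of order one exactly compensates the factor `s` in `s ∂_s`. -/
theorem IsTest.bounded_mark {φ : X × ℝ → ℝ} (hφ : IsTest d φ) (A : LieAlg d X) :
    ∃ C : ℝ, ∀ x s, 0 < s → |dirDerivXR (d := d) (fun _ => 0) A.a φ (x, s)| ≤ C := by
  obtain ⟨C, hC⟩ := hφ.decay 1
  obtain ⟨K, hK, hK0⟩ := A.compact_a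
  obtain ⟨M, hM⟩ := hK.exists_bound_of_continuousOn A.smooth_a.continuous.continuousOn
  have hM' : ∀ x, |A.a x| ≤ max M 0 := by
    intro x
    by_cases hx : x ∈ K
    · exact (hM x hx).trans (le_max_left _ _)
    · rw [hK0 x hx]; simp
  refine ⟨max M 0 * C, fun x s hs => ?_⟩
  have h1 := hC x s hs
  rw [iteratedDeriv_one, pow_one] at h1
  have h2 : |s * deriv (fun r => φ (x, r)) s| ≤ C := by
    rw [abs_mul, abs_of_pos hs]
    have hm : 0 < max 1 s := lt_max_of_lt_left one_pos
    calc s * |deriv (fun r => φ (x, r)) s| ≤ max 1 s * (C * (max 1 s)⁻¹) :=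
          mul_le_mul (le_max_right _ _) h1 (abs_nonneg _) hm.le
      _ = C := by field_simp
  have h3 : dirDerivXR (d := d) (fun _ => 0) A.a φ (x, s) =
      A.a x * (s * deriv (fun r => φ (x, r)) s) := by
    simp [dirDerivXR]
  rw [h3, abs_mul]
  exact mul_le_mul (hM' x) h2 (abs_nonneg _) (le_max_right _ _)

/-- Finitely many compact chart balls cover the support of `v`; on each of them the first
derivatives are bounded uniformly in the mark and the components of `v` are bounded. -/
theorem IsTest.bounded_field {φ : X × ℝ → ℝ} (hφ : IsTest d φ) (A : LieAlg d X) :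
    ∃ C : ℝ, ∀ x s, 0 < s → |dirDerivXR A.v (fun _ => 0) φ (x, s)| ≤ C := by
  obtain ⟨K, hK, hK0⟩ := A.compact_v
  have hloc : ∃ C : ℝ, ∀ x ∈ K, ∀ s, 0 < s → |dirDerivXR A.v (fun _ => 0) φ (x, s)| ≤ C := by
    refine hK.induction_on (p := fun S => ∃ C : ℝ, ∀ x ∈ S, ∀ s, 0 < s →
      |dirDerivXR A.v (fun _ => 0) φ (x, s)| ≤ C) ⟨0, by simp⟩ ?_ ?_ ?_
    · rintro S T hST ⟨C, h⟩
      exact ⟨C, fun x hx => h x (hST hx)⟩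
    · rintro S T ⟨C, h⟩ ⟨C', h'⟩
      refine ⟨max C C', ?_⟩
      rintro x (hx | hx) s hs
      · exact (h x hx s hs).trans (le_max_left _ _)
      · exact (h' x hx s hs).trans (le_max_right _ _)
    · intro x₀ _
      obtain ⟨r, hr, hball⟩ := Metric.nhds_basis_closedBall.mem_iff.1
        (extChartAt_target_mem_nhds (I := 𝓡 d) x₀)
      have hcB : IsCompact (Metric.closedBall (extChartAt (𝓡 d) x₀ x₀) r) :=
        isCompact_closedBall _ _
      obtain ⟨C, hC⟩ := hφ.bounded x₀ _ hcB hball 1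
      obtain ⟨M, hM⟩ := hcB.exists_bound_of_continuousOn
        ((contDiffOn_coordField A.smooth_v x₀).continuousOn.mono hball)
      refine ⟨(extChartAt (𝓡 d) x₀).source ∩
        extChartAt (𝓡 d) x₀ ⁻¹' Metric.closedBall (extChartAt (𝓡 d) x₀ x₀) r,
        mem_nhdsWithin_of_mem_nhds (Filter.inter_mem (extChartAt_source_mem_nhds x₀)
          ((continuousAt_extChartAt x₀).preimage_mem_nhds (Metric.closedBall_mem_nhds _ hr))),
        C * M, ?_⟩
      rintro x ⟨hx1, hx2⟩ s hs
      have h1 := dirDerivXR_chart hφ.smoothXR A.v (fun _ => 0)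
        (z := (extChartAt (𝓡 d) x₀ x, s)) ⟨(extChartAt (𝓡 d) x₀).map_source hx1, hs⟩
      simp only [(extChartAt (𝓡 d) x₀).left_inv hx1] at h1
      rw [h1, ← Real.norm_eq_abs]
      have h2 := hC _ hx2 s hs
      rw [norm_iteratedFDeriv_one] at h2
      refine (ContinuousLinearMap.le_opNorm _ _).trans ?_
      refine mul_le_mul h2 ?_ (norm_nonneg _) ((norm_nonneg _).trans h2)
      rw [Prod.norm_def]
      simp only [zero_mul, norm_zero]
      exact max_le (hM _ hx2) ((norm_nonneg _).trans (hM _ hx2))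
  obtain ⟨C, hC⟩ := hloc
  refine ⟨max C 0, fun x s hs => ?_⟩
  by_cases hx : x ∈ K
  · exact (hC x hx s hs).trans (le_max_left _ _)
  · rw [dirDerivXR_eq_zero φ (hK0 x hx) rfl]; simp

theorem IsTest.bounded_dirDerivXR {φ : X × ℝ → ℝ} (hφ : IsTest d φ) (A : LieAlg d X) :
    ∃ C : ℝ, ∀ x s, 0 < s → |dirDerivXR A.v A.a φ (x, s)| ≤ C := by
  obtain ⟨C, hC⟩ := hφ.bounded_field A
  obtain ⟨C', hC'⟩ := hφ.bounded_mark A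
  refine ⟨C + C', fun x s hs => ?_⟩
  rw [dirDerivXR_add_zero]
  exact (abs_add_le _ _).trans (add_le_add (hC x s hs) (hC' x s hs))

theorem exists_inner_bound (g : RMetric d X) (A : LieAlg d X) :
    ∃ C : ℝ, 0 < C ∧ ∀ x, g.inner x (A.v x) (A.v x) ≤ C ^ 2 := by
  have hc : Continuous fun x => g.inner x (A.v x) (A.v x) := by
    have h2 := ContMDiff.clm_bundle_apply₂ (F₃ := ℝ) (E₃ := Bundle.Trivial X ℝ) g.contMDiff
      A.smooth_v A.smooth_v
    have h3 : ContMDiff (𝓡 d) 𝓘(ℝ, ℝ) ∞ fun x => g.inner x (A.v x) (A.v x) := by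
      intro x
      have h3 := h2 x
      rw [Bundle.contMDiffAt_totalSpace] at h3
      exact h3.2
    exact h3.continuous
  obtain ⟨K, hK, hK0⟩ := A.compact_v
  obtain ⟨M, hM⟩ := hK.exists_bound_of_continuousOn hc.continuousOn
  -- The lower bound `1` makes the constant positive and dominated by its own square.
  refine ⟨max M 1, lt_max_of_lt_right one_pos, fun x => ?_⟩
  have h1 : (1 : ℝ) ≤ max M 1 := le_max_right _ _
  by_cases hx : x ∈ K
  · calc g.inner x (A.v x) (A.v x) ≤ M := (le_abs_self _).trans (hM x hx)
      _ ≤ max M 1 := le_max_left _ _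
      _ ≤ max M 1 ^ 2 := by nlinarith
  · rw [hK0 x hx, map_zero]
    positivity

/-- `gradSq` is a supremum over the unit ball, into which `w` is scaled by `C⁻¹`. -/
theorem enorm_sq_diffX_le (g : RMetric d X) (φ : X × ℝ → ℝ) (z : X × ℝ)
    {w : TangentSpace (𝓡 d) z.1} {C : ℝ} (hC : 0 < C) (hw : g.inner z.1 w w ≤ C ^ 2) :
    ‖diffX d φ z w‖ₑ ^ 2 ≤ ENNReal.ofReal C ^ 2 * gradSq g φ z := by
  have h1 : g.inner z.1 (C⁻¹ • w) (C⁻¹ • w) ≤ 1 := by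
    simp only [map_smul, smul_apply, smul_eq_mul]
    rw [← mul_assoc, ← mul_inv, inv_mul_le_iff₀ (by positivity)]
    linarith
  have h2 : ‖diffX d φ z (C⁻¹ • w)‖ₑ ^ 2 ≤ gradSq g φ z :=
    le_iSup₂ (f := fun (w : TangentSpace (𝓡 d) z.1) (_ : g.inner z.1 w w ≤ 1) =>
      ‖diffX d φ z w‖ₑ ^ 2) (C⁻¹ • w) h1
  have h3 : diffX d φ z w = C * diffX d φ z (C⁻¹ • w) := by
    rw [map_smul, smul_eq_mul, mul_inv_cancel_left₀ hC.ne']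
  calc ‖diffX d φ z w‖ₑ ^ 2 = (ENNReal.ofReal C * ‖diffX d φ z (C⁻¹ • w)‖ₑ) ^ 2 := by
        rw [h3, enorm_mul, Real.enorm_of_nonneg hC.le]
    _ ≤ _ := by
        rw [mul_pow]
        gcongr

/-- Integrated, these bounds make the derivatives along `v` and along `a` continuous from the norm
`‖·‖_{1,2}` to `L²`. Cauchy sequences of test functions therefore have `L²`-convergent derivatives.
-/
theorem exists_enorm_sq_dirDerivXR_le (g : RMetric d X) (A : LieAlg d X) :
    ∃ C : ENNReal, C ≠ ⊤ ∧ ∀ (φ : X × ℝ → ℝ) (z : X × ℝ),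
      ‖dirDerivXR A.v (fun _ => 0) φ z‖ₑ ^ 2 ≤
        C * (gradSq g φ z + ‖z.2 * deriv (fun s => φ (z.1, s)) z.2‖ₑ ^ 2 + ‖φ z‖ₑ ^ 2) ∧
      ‖dirDerivXR (d := d) (fun _ => 0) A.a φ z‖ₑ ^ 2 ≤
        C * (gradSq g φ z + ‖z.2 * deriv (fun s => φ (z.1, s)) z.2‖ₑ ^ 2 + ‖φ z‖ₑ ^ 2) := by
  obtain ⟨C, hC, hCb⟩ := exists_inner_bound g A
  obtain ⟨K, hK, hK0⟩ := A.compact_a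
  obtain ⟨M, hM⟩ := hK.exists_bound_of_continuousOn A.smooth_a.continuous.continuousOn
  have hM' : ∀ x, ‖A.a x‖ ≤ max M 0 := by
    intro x
    by_cases hx : x ∈ K
    · exact (hM x hx).trans (le_max_left _ _)
    · rw [hK0 x hx]; simp
  refine ⟨ENNReal.ofReal C ^ 2 + ENNReal.ofReal (max M 0) ^ 2, by simp, fun φ z => ⟨?_, ?_⟩⟩
  · have h1 : dirDerivXR A.v (fun _ => 0) φ z = diffX d φ z (A.v z.1) := by simp [dirDerivXR]
    rw [h1]
    refine (enorm_sq_diffX_le g φ z hC (hCb z.1)).trans ?_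
    gcongr
    · exact le_self_add
    · rw [add_assoc]; exact le_self_add
  · have h1 : dirDerivXR (d := d) (fun _ => 0) A.a φ z =
        A.a z.1 * (z.2 * deriv (fun s => φ (z.1, s)) z.2) := by simp [dirDerivXR]
    rw [h1, enorm_mul, mul_pow]
    have h2 : ‖A.a z.1‖ₑ ≤ ENNReal.ofReal (max M 0) := by
      rw [← ofReal_norm]
      exact ENNReal.ofReal_le_ofReal (hM' _)
    gcongr
    · exact (pow_le_pow_left' h2 2).trans le_add_self
    · exact le_add_self.trans le_self_add

theorem SmoothXR.hasDerivAt_flow {φ : X × ℝ → ℝ} (hφ : SmoothXR d φ) (A : LieAlg d X) {z : X × ℝ}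
    (hz : 0 < z.2) :
    HasDerivAt (fun t => φ (flow A.v t z.1, Real.exp (t * A.a (flow A.v t z.1)) * z.2))
      (dirDerivXR A.v A.a φ z) 0 := by
  obtain ⟨h1, h2, h3⟩ := hasDerivAt_chart_flow A z.1
  rw [dirDerivXR_at hφ _ _ hz]
  have hac : ContinuousAt (fun t => A.a (flow A.v t z.1)) 0 := by
    refine ContinuousAt.comp (g := A.a) (f := fun t => flow A.v t z.1)
      A.smooth_a.continuous.continuousAt ?_
    rw [ContinuousAt, h3]
    exact h2
  -- The factor `t` vanishes at `0`, so continuity of `a` along the flow is enough: the derivative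
  -- of `a` does not enter.
  have h4 : HasDerivAt (fun t => t * A.a (flow A.v t z.1)) (A.a z.1) 0 := by
    rw [hasDerivAt_iff_tendsto_slope]
    have h5 : Tendsto (fun t => A.a (flow A.v t z.1)) (𝓝[≠] 0) (𝓝 (A.a z.1)) := by
      have := hac.tendsto
      rw [h3] at this
      exact this.mono_left nhdsWithin_le_nhds
    refine h5.congr' ?_
    filter_upwards [self_mem_nhdsWithin] with t ht
    have ht' : t ≠ 0 := ht
    simp [slope, ht']
  have h5 : HasDerivAt (fun t => Real.exp (t * A.a (flow A.v t z.1)) * z.2) (A.a z.1 * z.2) 0 := by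
    have := (h4.exp).mul_const z.2
    simpa using this
  have h6 := h1.prodMk h5
  have h7 : HasFDerivAt (chartRep φ z.1)
      (fderiv ℝ (chartRep φ z.1) (extChartAt (𝓡 d) z.1 z.1, z.2))
      (extChartAt (𝓡 d) z.1 (flow A.v 0 z.1), Real.exp (0 * A.a (flow A.v 0 z.1)) * z.2) := by
    rw [h3, zero_mul, Real.exp_zero, one_mul]
    exact (hφ.differentiableAt (mem_chartDom_self hz)).hasFDerivAt
  have h8 := HasFDerivAt.comp_hasDerivAt (0 : ℝ) h7 h6
  refine h8.congr_of_eventuallyEq ?_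
  filter_upwards [h2.eventually (extChartAt_source_mem_nhds (I := 𝓡 d) z.1)] with t ht
  simp only [Function.comp_apply, chartRep]
  rw [(extChartAt (𝓡 d) z.1).left_inv ht]

end test

/-! ### The dilation identity on the half-line and limits in `L²` -/

section analysis

/-- Under `s = exp x` the integrand becomes the derivative of `exp x * w (exp x)` on the whole line.
That function is integrable because `w` is, so no boundary values at `0` or `∞` have to be examined.
-/
theorem integral_Ioi_deriv_scaling {w w' : ℝ → ℝ} (hw : ∀ s, 0 < s → HasDerivAt w (w' s) s)
    (h1 : IntegrableOn w (Ioi 0)) (h2 : IntegrableOn (fun s => s * w' s + w s) (Ioi 0)) :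
    ∫ s in Ioi 0, (s * w' s + w s) = 0 := by
  have himg : Real.exp '' univ = Ioi 0 := by rw [image_univ, Real.range_exp]
  have hexp : ∀ x ∈ (univ : Set ℝ), HasDerivWithinAt Real.exp (Real.exp x) univ x :=
    fun x _ => (Real.hasDerivAt_exp x).hasDerivWithinAt
  have hinj : InjOn Real.exp univ := Real.exp_injective.injOn
  rw [← himg] at h1 h2
  rw [integrableOn_image_iff_integrableOn_abs_deriv_smul MeasurableSet.univ hexp hinj,
    integrableOn_univ] at h1 h2
  rw [← himg, integral_image_eq_integral_abs_deriv_smul MeasurableSet.univ hexp hinj,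
    setIntegral_univ]
  refine integral_eq_zero_of_hasDerivAt_of_integrable
    (f := fun x => |Real.exp x| • w (Real.exp x)) (fun x => ?_) h2 h1
  simp only [Real.abs_exp, smul_eq_mul]
  have h3 := (Real.hasDerivAt_exp x).mul
    (HasDerivAt.comp x (hw _ (Real.exp_pos x)) (Real.hasDerivAt_exp x))
  refine HasDerivAt.congr_deriv (f := fun x => Real.exp x * w (Real.exp x)) h3 ?_
  simp only [Function.comp_apply]
  ring

variable {α : Type*} [MeasurableSpace α] {μ : Measure α}

theorem eLpNorm_two_eq (f : α → ℝ) :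
    eLpNorm f 2 μ = (∫⁻ x, ‖f x‖ₑ ^ 2 ∂μ) ^ (1 / 2 : ℝ) := by
  rw [eLpNorm_eq_lintegral_rpow_enorm_toReal (by simp) (by simp)]
  simp

theorem eLpNorm_two_lt_top_iff (f : α → ℝ) :
    eLpNorm f 2 μ < ⊤ ↔ ∫⁻ x, ‖f x‖ₑ ^ 2 ∂μ < ⊤ := by
  rw [eLpNorm_two_eq, ENNReal.rpow_lt_top_iff_of_pos (by norm_num)]

theorem tendsto_eLpNorm_two {f : ℕ → α → ℝ} {g : α → ℝ}
    (h : Tendsto (fun n => ∫⁻ x, ‖f n x - g x‖ₑ ^ 2 ∂μ) atTop (𝓝 0)) :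
    Tendsto (fun n => eLpNorm (f n - g) 2 μ) atTop (𝓝 0) := by
  have h2 := h.ennrpow_const (1 / 2 : ℝ)
  rw [ENNReal.zero_rpow_of_pos (by norm_num)] at h2
  refine h2.congr fun n => ?_
  rw [eLpNorm_two_eq]
  rfl

theorem memLp_two_of_tendsto {f : ℕ → α → ℝ} {g : α → ℝ} (hf : ∀ n, MemLp (f n) 2 μ)
    (hg : AEStronglyMeasurable g μ)
    (h : Tendsto (fun n => ∫⁻ x, ‖f n x - g x‖ₑ ^ 2 ∂μ) atTop (𝓝 0)) : MemLp g 2 μ := by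
  have h2 := (tendsto_eLpNorm_two h).eventually (gt_mem_nhds ENNReal.zero_lt_top)
  obtain ⟨n, hn⟩ := h2.exists
  have h3 : MemLp (f n - g) 2 μ := ⟨(hf n).1.sub hg, hn⟩
  have := (hf n).sub h3
  simpa using this

theorem MemLp.bdd_mul_two {b f : α → ℝ} {C : ℝ} (hb : AEStronglyMeasurable b μ)
    (hbC : ∀ᵐ x ∂μ, |b x| ≤ C) (hf : MemLp f 2 μ) : MemLp (fun x => b x * f x) 2 μ :=
  hf.of_le_mul (c := C) (hb.mul hf.1) (by
    filter_upwards [hbC] with x hx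
    rw [norm_mul]
    gcongr
    exact hx)

/-- The integrals are inner products of `b f` and `g` in `L²`; multiplication by the bounded `b`
preserves `L²` convergence, and the inner product is continuous. -/
theorem tendsto_integral_mul_mul {b : α → ℝ} {C : ℝ} (hb : AEStronglyMeasurable b μ)
    (hbC : ∀ᵐ x ∂μ, |b x| ≤ C) {f g : ℕ → α → ℝ} {f' g' : α → ℝ} (hf : ∀ n, MemLp (f n) 2 μ)
    (hg : ∀ n, MemLp (g n) 2 μ) (hf' : MemLp f' 2 μ) (hg' : MemLp g' 2 μ)
    (h1 : Tendsto (fun n => ∫⁻ x, ‖f n x - f' x‖ₑ ^ 2 ∂μ) atTop (𝓝 0))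
    (h2 : Tendsto (fun n => ∫⁻ x, ‖g n x - g' x‖ₑ ^ 2 ∂μ) atTop (𝓝 0)) :
    Tendsto (fun n => ∫ x, b x * f n x * g n x ∂μ) atTop (𝓝 (∫ x, b x * f' x * g' x ∂μ)) := by
  have hbf := fun n => MemLp.bdd_mul_two hb hbC (hf n)
  have hbf' := MemLp.bdd_mul_two hb hbC hf'
  have key : ∀ {u w : α → ℝ} (hu : MemLp u 2 μ) (hw : MemLp w 2 μ),
      inner ℝ (hu.toLp u) (hw.toLp w) = ∫ x, u x * w x ∂μ := by
    intro u w hu hw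
    rw [L2.inner_def]
    refine integral_congr_ae ?_
    filter_upwards [hu.coeFn_toLp, hw.coeFn_toLp] with x hx1 hx2
    rw [hx1, hx2]
    simp [mul_comm]
  have t1 : Tendsto (fun n => (hbf n).toLp _) atTop (𝓝 (hbf'.toLp _)) := by
    rw [Lp.tendsto_Lp_iff_tendsto_eLpNorm'']
    have hz : Tendsto (fun n => ENNReal.ofReal C * eLpNorm (f n - f') 2 μ) atTop (𝓝 0) := by
      have := ENNReal.Tendsto.const_mul (tendsto_eLpNorm_two h1)
        (Or.inr (ENNReal.ofReal_ne_top (r := C)))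
      simpa using this
    refine tendsto_of_tendsto_of_tendsto_of_le_of_le tendsto_const_nhds hz
      (fun _ => bot_le) fun n => ?_
    refine eLpNorm_le_mul_eLpNorm_of_ae_le_mul ?_ 2
    filter_upwards [hbC] with x hx
    simp only [Pi.sub_apply]
    rw [← mul_sub, norm_mul]
    gcongr
    exact hx
  have t2 : Tendsto (fun n => (hg n).toLp _) atTop (𝓝 (hg'.toLp _)) := by
    rw [Lp.tendsto_Lp_iff_tendsto_eLpNorm'']
    exact tendsto_eLpNorm_two h2
  have t3 := t1.inner (𝕜 := ℝ) t2
  simpa only [key] using t3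

/-- Completeness of `L²`, in terms of integrals. -/
theorem exists_limit_of_cauchy {f : ℕ → α → ℝ} (hf : ∀ n, MemLp (f n) 2 μ)
    (hc : ∀ ε : ENNReal, 0 < ε → ∃ N : ℕ, ∀ j ≥ N, ∀ k ≥ N,
      ∫⁻ x, ‖f j x - f k x‖ₑ ^ 2 ∂μ < ε) :
    ∃ g : α → ℝ, AEStronglyMeasurable g μ ∧
      Tendsto (fun n => ∫⁻ x, ‖f n x - g x‖ₑ ^ 2 ∂μ) atTop (𝓝 0) := by
  have hcs : CauchySeq fun n => (hf n).toLp (f n) := by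
    rw [EMetric.cauchySeq_iff]
    intro ε hε
    obtain ⟨N, hN⟩ := hc (ε ^ 2) (by positivity)
    refine ⟨N, fun j hj k hk => ?_⟩
    rw [Lp.edist_toLp_toLp, eLpNorm_two_eq]
    have h3 := hN j hj k hk
    have h4 := ENNReal.rpow_lt_rpow h3 (z := 1 / 2) (by norm_num)
    rwa [← ENNReal.rpow_natCast, ← ENNReal.rpow_mul, show ((2 : ℕ) : ℝ) * (1 / 2) = 1 by norm_num,
      ENNReal.rpow_one] at h4
  obtain ⟨g, hg⟩ := cauchySeq_tendsto_of_complete hcs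
  refine ⟨g, (Lp.memLp g).1, ?_⟩
  rw [Lp.tendsto_Lp_iff_tendsto_eLpNorm'] at hg
  have h5 : ∀ n, eLpNorm (⇑((hf n).toLp (f n)) - ⇑g) 2 μ ^ 2 = ∫⁻ x, ‖f n x - g x‖ₑ ^ 2 ∂μ := by
    intro n
    have h6 : ⇑((hf n).toLp (f n)) - ⇑g =ᵐ[μ] f n - ⇑g := (hf n).coeFn_toLp.sub (ae_eq_refl _)
    rw [eLpNorm_congr_ae h6, eLpNorm_two_eq, ← ENNReal.rpow_natCast, ← ENNReal.rpow_mul,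
      show (1 / 2 : ℝ) * ((2 : ℕ) : ℝ) = 1 by norm_num, ENNReal.rpow_one]
    rfl
  have h7 := ENNReal.Tendsto.pow (n := 2) hg
  simp only [h5] at h7
  simpa using h7

end analysis

/-! ### The reference measure `m ⊗ λ` -/

section reference

variable {d : ℕ} {X : Type*} [TopologicalSpace X] [Nonempty X] [SecondCountableTopology X]
  [ChartedSpace (Eu d) X] [IsManifold (𝓡 d) ∞ X] [MeasurableSpace X] [BorelSpace X]

theorem refMeasure_eq (g : RMetric d X) :
    refMeasure g = ((riemannianVolume g).prod volume).restrict (univ ×ˢ Ioi (0 : ℝ)) := by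
  rw [← Measure.prod_restrict, Measure.restrict_univ, refMeasure]

theorem measurableSet_univ_Ioi : MeasurableSet ((univ : Set X) ×ˢ Ioi (0 : ℝ)) :=
  MeasurableSet.univ.prod measurableSet_Ioi

theorem ae_pos_mark (g : RMetric d X) : ∀ᵐ z ∂(refMeasure g), 0 < z.2 := by
  rw [refMeasure_eq]
  filter_upwards [ae_restrict_mem measurableSet_univ_Ioi] with z hz using hz.2

theorem aestronglyMeasurable_of_continuousOn (g : RMetric d X) {f : X × ℝ → ℝ}
    (hf : ContinuousOn f (univ ×ˢ Ioi (0 : ℝ))) : AEStronglyMeasurable f (refMeasure g) := by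
  rw [refMeasure_eq]
  exact hf.aestronglyMeasurable measurableSet_univ_Ioi

instance (g : RMetric d X) : SFinite (refMeasure g) := by unfold refMeasure; infer_instance

end reference

/-! ### Integration by parts for one particle -/

section oneParticle

variable {d : ℕ} {X : Type*} [TopologicalSpace X] [T2Space X] [Nonempty X]
  [SecondCountableTopology X] [ChartedSpace (Eu d) X] [IsManifold (𝓡 d) ∞ X] [MeasurableSpace X]
  [BorelSpace X]

/-- Fubini with the mark outside: each slice at a fixed mark is smooth on `X`, and the divergence
theorem applies to it. -/
theorem integral_field (g : RMetric d X) (A : LieAlg d X) {w : X × ℝ → ℝ} (hw : SmoothXR d w)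
    (hi : Integrable (fun z => dirDerivXR A.v (fun _ => 0) w z + divergence g A.v z.1 * w z)
      (refMeasure g)) :
    ∫ z, (dirDerivXR A.v (fun _ => 0) w z + divergence g A.v z.1 * w z) ∂(refMeasure g) = 0 := by
  rw [refMeasure] at hi ⊢
  rw [integral_prod_symm _ hi]
  refine setIntegral_eq_zero_of_forall_eq_zero fun s hs => ?_
  have h := integral_divIntegrand g A.smooth_v (isCompact_closure_v A) (hw.contMDiff_slice hs)
  refine Eq.trans (integral_congr_ae (Eventually.of_forall fun x => ?_)) h
  simp only [dirDerivXR, zero_mul, add_zero, divIntegrand, diffX_eq]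
  ring

/-- Fubini with the position outside: `a x` is then a constant factor in front of the dilation
identity. -/
theorem integral_mark (g : RMetric d X) (A : LieAlg d X) {w : X × ℝ → ℝ} (hw : SmoothXR d w)
    (h1 : Integrable w (refMeasure g))
    (hi : Integrable (fun z => dirDerivXR (d := d) (fun _ => 0) A.a w z + A.a z.1 * w z)
      (refMeasure g)) :
    ∫ z, (dirDerivXR (d := d) (fun _ => 0) A.a w z + A.a z.1 * w z) ∂(refMeasure g) = 0 := by
  have hpt : ∀ z : X × ℝ, dirDerivXR (d := d) (fun _ => 0) A.a w z + A.a z.1 * w z =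
      A.a z.1 * (z.2 * deriv (fun s => w (z.1, s)) z.2 + w z) := by
    intro z
    simp only [dirDerivXR, map_zero, zero_add]
    ring
  simp only [hpt] at hi ⊢
  rw [refMeasure] at hi h1 ⊢
  rw [integral_prod _ hi]
  refine integral_eq_zero_of_ae ?_
  filter_upwards [hi.prod_right_ae, h1.prod_right_ae] with x hx1 hx2
  simp only [Pi.zero_apply]
  rw [integral_const_mul]
  -- Integrability is known only for the product with `a x`; it is recovered by division when `a x ≠
  -- 0`, and not needed otherwise.
  by_cases hax : A.a x = 0
  · rw [hax, zero_mul]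
  · have h3 : IntegrableOn (fun s => s * deriv (fun s => w (x, s)) s + w (x, s)) (Ioi 0) := by
      have := hx1.const_mul (A.a x)⁻¹
      refine this.congr (Eventually.of_forall fun s => ?_)
      simp only
      rw [inv_mul_cancel_left₀ hax]
    rw [integral_Ioi_deriv_scaling (w := fun s => w (x, s))
      (fun s hs => (hw.differentiableAt_mark x hs).hasDerivAt) hx2 h3, mul_zero]

theorem integrable_mul_mul {α : Type*} [MeasurableSpace α] {μ : Measure α} {b f g : α → ℝ} {C : ℝ}
    (hb : AEStronglyMeasurable b μ) (hbC : ∀ᵐ x ∂μ, |b x| ≤ C) (hf : MemLp f 2 μ)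
    (hg : MemLp g 2 μ) : Integrable (fun x => b x * f x * g x) μ :=
  (MemLp.bdd_mul_two hb hbC hf).integrable_mul hg

variable {g : RMetric d X}

theorem memLp_test {φ : X × ℝ → ℝ} (hφ : IsTest d φ) (hfin : sobolevNormSq g φ < ⊤) :
    MemLp φ 2 (refMeasure g) := by
  refine ⟨aestronglyMeasurable_of_continuousOn g hφ.smoothXR.continuousOn, ?_⟩
  rw [eLpNorm_two_lt_top_iff]
  exact (lintegral_mono fun z => le_add_self).trans_lt hfin

theorem lintegral_dirDerivXR_le {v : (x : X) → TangentSpace (𝓡 d) x} {a : X → ℝ} {C : ENNReal}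
    (hC : C ≠ ⊤) (hb : ∀ (φ : X × ℝ → ℝ) (z : X × ℝ), ‖dirDerivXR v a φ z‖ₑ ^ 2 ≤
      C * (gradSq g φ z + ‖z.2 * deriv (fun s => φ (z.1, s)) z.2‖ₑ ^ 2 + ‖φ z‖ₑ ^ 2))
    (φ : X × ℝ → ℝ) :
    ∫⁻ z, ‖dirDerivXR v a φ z‖ₑ ^ 2 ∂(refMeasure g) ≤ C * sobolevNormSq g φ := by
  rw [sobolevNormSq, ← lintegral_const_mul' _ _ hC]
  exact lintegral_mono fun z => hb φ z

theorem memLp_dirDerivXR_test {v : (x : X) → TangentSpace (𝓡 d) x} {a : X → ℝ}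
    (hv : ContMDiff (𝓡 d) (𝓡 d).tangent ∞ (fun x => (⟨x, v x⟩ : TangentBundle (𝓡 d) X)))
    (ha : Continuous a) {C : ENNReal}
    (hC : C ≠ ⊤) (hb : ∀ (φ : X × ℝ → ℝ) (z : X × ℝ), ‖dirDerivXR v a φ z‖ₑ ^ 2 ≤
      C * (gradSq g φ z + ‖z.2 * deriv (fun s => φ (z.1, s)) z.2‖ₑ ^ 2 + ‖φ z‖ₑ ^ 2))
    {φ : X × ℝ → ℝ} (hφ : IsTest d φ) (hfin : sobolevNormSq g φ < ⊤) :
    MemLp (dirDerivXR v a φ) 2 (refMeasure g) := by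
  refine ⟨aestronglyMeasurable_of_continuousOn g
    (continuousOn_dirDerivXR hφ.smoothXR hv ha), ?_⟩
  rw [eLpNorm_two_lt_top_iff]
  exact (lintegral_dirDerivXR_le hC hb φ).trans_lt (ENNReal.mul_lt_top hC.lt_top hfin)

/-- Integration by parts against a squared Sobolev function; `e` is the divergence of the
direction `(v, a)`. -/
theorem sobolev_integration_by_parts {v : (x : X) → TangentSpace (𝓡 d) x} {a e : X → ℝ}
    (hv : ContMDiff (𝓡 d) (𝓡 d).tangent ∞ (fun x => (⟨x, v x⟩ : TangentBundle (𝓡 d) X)))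
    (ha : Continuous a) (he : Continuous e) {Ce : ℝ} (heC : ∀ x, |e x| ≤ Ce)
    (hes : ∀ x, x ∉ closure {x | v x ≠ 0} → x ∉ closure {x | a x ≠ 0} → e x = 0)
    (hI : ∀ w : X × ℝ → ℝ, SmoothXR d w → Integrable w (refMeasure g) →
      Integrable (fun z => dirDerivXR v a w z + e z.1 * w z) (refMeasure g) →
      ∫ z, (dirDerivXR v a w z + e z.1 * w z) ∂(refMeasure g) = 0)
    {Cb : ENNReal} (hCb : Cb ≠ ⊤)
    (hb : ∀ (φ : X × ℝ → ℝ) (z : X × ℝ), ‖dirDerivXR v a φ z‖ₑ ^ 2 ≤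
      Cb * (gradSq g φ z + ‖z.2 * deriv (fun s => φ (z.1, s)) z.2‖ₑ ^ 2 + ‖φ z‖ₑ ^ 2))
    {f D : X × ℝ → ℝ} (hD : IsSobolevDeriv g v a f D) :
    MemLp D 2 (refMeasure g) ∧ ∀ {ψ : X × ℝ → ℝ}, SmoothXR d ψ → ∀ {C : ℝ},
      (∀ x s, 0 < s → |ψ (x, s)| ≤ C) → (∀ x s, 0 < s → |dirDerivXR v a ψ (x, s)| ≤ C) →
      Integrable (fun z => dirDerivXR v a ψ z * f z * f z + 2 * ψ z * f z * D z +
        ψ z * e z.1 * f z * f z) (refMeasure g) ∧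
      ∫ z, (dirDerivXR v a ψ z * f z * f z + 2 * ψ z * f z * D z +
        ψ z * e z.1 * f z * f z) ∂(refMeasure g) = 0 := by
  obtain ⟨hDm, hD0, U, h, φ, hU, hvU, haU, hfh, happ, hDt⟩ := hD
  have hφ2 := fun n => memLp_test (happ.test n) (happ.finite n)
  have hDφ2 := fun n => memLp_dirDerivXR_test hv ha hCb hb (happ.test n) (happ.finite n)
  have hh2 := memLp_two_of_tendsto hφ2 happ.aestronglyMeasurable happ.tendsto
  have hD2 := memLp_two_of_tendsto hDφ2 hDm hDt
  refine ⟨hD2, fun {ψ} hψ {C} hψC hψD => ?_⟩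
  set μR := refMeasure g with hR
  have hpos : ∀ᵐ z ∂μR, 0 < z.2 := ae_pos_mark g
  have b1m : AEStronglyMeasurable (dirDerivXR v a ψ) μR :=
    aestronglyMeasurable_of_continuousOn g (continuousOn_dirDerivXR hψ hv ha)
  have ψm : AEStronglyMeasurable ψ μR := aestronglyMeasurable_of_continuousOn g hψ.continuousOn
  have em : AEStronglyMeasurable (fun z : X × ℝ => e z.1) μR :=
    (he.comp continuous_fst).aestronglyMeasurable
  have b2m : AEStronglyMeasurable (fun z => 2 * ψ z) μR := ψm.const_mul 2
  have b3m : AEStronglyMeasurable (fun z => ψ z * e z.1) μR := ψm.mul em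
  have b1C : ∀ᵐ z ∂μR, |dirDerivXR v a ψ z| ≤ C := by
    filter_upwards [hpos] with z hz using hψD z.1 z.2 hz
  have b2C : ∀ᵐ z ∂μR, |2 * ψ z| ≤ 2 * C := by
    filter_upwards [hpos] with z hz
    rw [abs_mul, abs_two]
    exact mul_le_mul_of_nonneg_left (hψC z.1 z.2 hz) zero_le_two
  have b3C : ∀ᵐ z ∂μR, |ψ z * e z.1| ≤ C * Ce := by
    filter_upwards [hpos] with z hz
    rw [abs_mul]
    exact mul_le_mul (hψC z.1 z.2 hz) (heC _) (abs_nonneg _)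
      ((abs_nonneg _).trans (hψC z.1 z.2 hz))
  have ψC' : ∀ᵐ z ∂μR, |ψ z| ≤ C := by
    filter_upwards [hpos] with z hz using hψC z.1 z.2 hz
  -- The smooth identity for `w = ψ (φ n)²`, expanded by the product rule.
  have hzero : ∀ n, (∫ z, dirDerivXR v a ψ z * φ n z * φ n z ∂μR) +
      (∫ z, 2 * ψ z * φ n z * dirDerivXR v a (φ n) z ∂μR) +
      (∫ z, ψ z * e z.1 * φ n z * φ n z ∂μR) = 0 := by
    intro n
    have i1 := integrable_mul_mul b1m b1C (hφ2 n) (hφ2 n)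
    have i2 := integrable_mul_mul b2m b2C (hφ2 n) (hDφ2 n)
    have i3 := integrable_mul_mul b3m b3C (hφ2 n) (hφ2 n)
    have i12 : Integrable (fun z => dirDerivXR v a ψ z * φ n z * φ n z +
        2 * ψ z * φ n z * dirDerivXR v a (φ n) z) μR := i1.add i2
    rw [← integral_add i1 i2, ← integral_add i12 i3]
    have hφs := (happ.test n).smoothXR
    have hw : SmoothXR d (fun z => ψ z * (φ n z * φ n z)) := hψ.mul (hφs.mul hφs)
    have hE : (fun z => dirDerivXR v a ψ z * φ n z * φ n z +
        2 * ψ z * φ n z * dirDerivXR v a (φ n) z + ψ z * e z.1 * φ n z * φ n z) =ᵐ[μR]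
        fun z => dirDerivXR v a (fun z => ψ z * (φ n z * φ n z)) z +
          e z.1 * (ψ z * (φ n z * φ n z)) := by
      filter_upwards [hpos] with z hz
      rw [dirDerivXR_mul hψ (hφs.mul hφs) v a hz, dirDerivXR_mul hφs hφs v a hz]
      ring
    have hwi : Integrable (fun z => ψ z * (φ n z * φ n z)) μR := by
      refine (integrable_mul_mul ψm ψC' (hφ2 n) (hφ2 n)).congr
        (Eventually.of_forall fun z => ?_)
      simp only [mul_assoc]
    have := hI _ hw hwi (((i1.add i2).add i3).congr hE)
    rw [← this]
    exact integral_congr_ae hE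
  have hlim := ((tendsto_integral_mul_mul b1m b1C hφ2 hφ2 hh2 hh2 happ.tendsto happ.tendsto).add
    (tendsto_integral_mul_mul b2m b2C hφ2 hDφ2 hh2 hD2 happ.tendsto hDt)).add
    (tendsto_integral_mul_mul b3m b3C hφ2 hφ2 hh2 hh2 happ.tendsto happ.tendsto)
  simp only [hzero] at hlim
  have hlim0 := tendsto_nhds_unique hlim tendsto_const_nhds
  have i1 := integrable_mul_mul b1m b1C hh2 hh2
  have i2 := integrable_mul_mul b2m b2C hh2 hD2
  have i3 := integrable_mul_mul b3m b3C hh2 hh2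
  have i12 : Integrable (fun z => dirDerivXR v a ψ z * h z * h z + 2 * ψ z * h z * D z) μR :=
    i1.add i2
  rw [← integral_add i1 i2, ← integral_add i12 i3] at hlim0
  -- On `U` the functions `f` and `h` agree almost everywhere; outside `U` the direction, its
  -- divergence `e` and `D` all vanish, so both sides are zero.
  have hE : (fun z => dirDerivXR v a ψ z * h z * h z + 2 * ψ z * h z * D z +
      ψ z * e z.1 * h z * h z) =ᵐ[μR] fun z => dirDerivXR v a ψ z * f z * f z +
      2 * ψ z * f z * D z + ψ z * e z.1 * f z * f z := by
    have hfh' : ∀ᵐ z ∂μR, z ∈ U ×ˢ Ioi (0 : ℝ) → f z = h z :=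
      (ae_restrict_iff' (hU.measurableSet.prod measurableSet_Ioi)).1 hfh
    filter_upwards [hpos, hfh'] with z hz hz2
    by_cases hzU : z.1 ∈ U
    · rw [hz2 ⟨hzU, hz⟩]
    · have hv1 : z.1 ∉ closure {x | v x ≠ 0} := fun h => hzU (hvU h)
      have ha1 : z.1 ∉ closure {x | a x ≠ 0} := fun h => hzU (haU h)
      have hv0 : v z.1 = 0 := by_contra fun h => hv1 (subset_closure h)
      have ha0 : a z.1 = 0 := by_contra fun h => ha1 (subset_closure h)
      rw [dirDerivXR_eq_zero ψ hv0 ha0, hD0 z hv1 ha1, hes _ hv1 ha1]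
      ring
  exact ⟨((i1.add i2).add i3).congr hE, by rw [← hlim0]; exact (integral_congr_ae hE).symm⟩

theorem exists_bound_of_compact_support {f : X → ℝ} (hf : Continuous f) {K : Set X}
    (hK : IsCompact K) (h0 : ∀ x ∉ K, f x = 0) : ∃ C : ℝ, 0 ≤ C ∧ ∀ x, |f x| ≤ C := by
  obtain ⟨M, hM⟩ := hK.exists_bound_of_continuousOn hf.continuousOn
  refine ⟨max M 0, le_max_right _ _, fun x => ?_⟩
  by_cases hx : x ∈ K
  · exact (hM x hx).trans (le_max_left _ _)
  · rw [h0 x hx]; simp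

variable {ρ : X → ℝ} {p : X → ℝ → ℝ}

theorem IsAdmissible.measurable_q (hadm : IsAdmissible g ρ p) :
    Measurable (fun z : X × ℝ => ρ z.1 * p z.1 z.2) :=
  (hadm.measurable_ρ.comp measurable_fst).mul hadm.measurable_p

theorem IsAdmissible.ae_q_pos (hadm : IsAdmissible g ρ p) :
    ∀ᵐ z ∂(refMeasure g), 0 < ρ z.1 * p z.1 z.2 := by
  rw [refMeasure, Measure.ae_prod_iff_ae_ae (measurableSet_lt measurable_const hadm.measurable_q)]
  filter_upwards [hadm.ρ_pos, hadm.p_pos] with x hx hpx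
  filter_upwards [hpx] with s hs using mul_pos hx hs

theorem IsAdmissible.levyMeasure_lt_top (hadm : IsAdmissible g ρ p) {K : Set X}
    (hK : IsCompact K) : levyMeasure g ρ p (K ×ˢ Ioi (0 : ℝ)) < ⊤ := by
  rw [levyMeasure, withDensity_apply']
  refine (lintegral_mono_ae ?_).trans_lt (hadm.moment K hK)
  filter_upwards [ae_restrict_of_ae hadm.ae_q_pos] with z hz
  refine ENNReal.ofReal_le_ofReal ?_
  exact le_mul_of_one_le_left hz.le (le_max_left _ _)

theorem levyMeasure_absolutelyContinuous : levyMeasure g ρ p ≪ refMeasure g :=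
  withDensity_absolutelyContinuous _ _

theorem ae_pos_levyMeasure : ∀ᵐ z ∂(levyMeasure g ρ p), 0 < z.2 :=
  levyMeasure_absolutelyContinuous.ae_le (ae_pos_mark g)

theorem IsAdmissible.levyMeasure_lt_top' (hadm : IsAdmissible g ρ p) {K : Set X}
    (hK : IsCompact K) : levyMeasure g ρ p (K ×ˢ univ) < ⊤ := by
  refine lt_of_le_of_lt (le_of_eq (measure_congr ?_)) (hadm.levyMeasure_lt_top hK)
  filter_upwards [ae_pos_levyMeasure (g := g) (ρ := ρ) (p := p)] with z hz
  refine propext ⟨fun h => ⟨h.1, hz⟩, fun h => ⟨h.1, mem_univ _⟩⟩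

theorem IsAdmissible.memLp_of_bounded (hadm : IsAdmissible g ρ p) {f : X × ℝ → ℝ}
    (hf : AEStronglyMeasurable f (levyMeasure g ρ p)) {K : Set X} (hK : IsCompact K) {C : ℝ}
    (hC : ∀ x s, 0 < s → |f (x, s)| ≤ C) (h0 : ∀ x ∉ K, ∀ s, 0 < s → f (x, s) = 0) :
    MemLp f 2 (levyMeasure g ρ p) := by
  have h1 : MemLp ((K ×ˢ (univ : Set ℝ)).indicator fun _ => C) 2 (levyMeasure g ρ p) :=
    memLp_indicator_const 2 (hK.measurableSet.prod MeasurableSet.univ) C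
      (Or.inr (hadm.levyMeasure_lt_top' hK).ne)
  refine h1.mono hf ?_
  filter_upwards [ae_pos_levyMeasure (g := g) (ρ := ρ) (p := p)] with z hz
  by_cases hzK : z.1 ∈ K
  · rw [indicator_of_mem (show z ∈ K ×ˢ (univ : Set ℝ) from ⟨hzK, mem_univ _⟩)]
    exact (hC z.1 z.2 hz).trans (le_abs_self C)
  · rw [h0 z.1 hzK z.2 hz, norm_zero]; positivity

/-- The square of the function times the density `q` is `4 D²`: the division by `q` costs nothing in
the weighted space. -/
theorem IsAdmissible.memLp_sqrt_mul_div (hadm : IsAdmissible g ρ p) {D : X × ℝ → ℝ}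
    (hD : MemLp D 2 (refMeasure g)) :
    MemLp (fun z => 2 * √(ρ z.1 * p z.1 z.2) * D z / (ρ z.1 * p z.1 z.2)) 2
      (levyMeasure g ρ p) := by
  have hm : AEStronglyMeasurable
      (fun z : X × ℝ => 2 * √(ρ z.1 * p z.1 z.2) * D z / (ρ z.1 * p z.1 z.2)) (refMeasure g) :=
    ((((hadm.measurable_q.sqrt.const_mul 2).aemeasurable).mul hD.1.aemeasurable).div
      hadm.measurable_q.aemeasurable).aestronglyMeasurable
  refine ⟨hm.mono_ac levyMeasure_absolutelyContinuous, ?_⟩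
  rw [eLpNorm_two_lt_top_iff, levyMeasure, lintegral_withDensity_eq_lintegral_mul₀
    hadm.measurable_q.ennreal_ofReal.aemeasurable (hm.enorm.pow_const 2)]
  have h2 : MemLp (fun z => 2 * D z) 2 (refMeasure g) := hD.const_mul 2
  refine lt_of_le_of_lt (lintegral_mono_ae ?_) ((eLpNorm_two_lt_top_iff _).1 h2.2)
  filter_upwards [hadm.ae_q_pos] with z hz
  simp only [Pi.mul_apply]
  set q := ρ z.1 * p z.1 z.2
  rw [← Real.enorm_of_nonneg hz.le, ← enorm_pow, ← enorm_mul, ← enorm_pow]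
  refine le_of_eq (congrArg _ ?_)
  rw [div_pow, mul_pow, mul_pow, Real.sq_sqrt hz.le]
  field_simp

/-- The logarithmic derivative is square integrable, vanishes off the supports, and satisfies the
integration by parts formula for the intensity measure. -/
theorem logDeriv_props (hadm : IsAdmissible g ρ p) (A : LieAlg d X) {β : X × ℝ → ℝ}
    (hβ : IsLogDeriv g (fun z => ρ z.1 * p z.1 z.2) A β) :
    MemLp β 2 (levyMeasure g ρ p) ∧
    (∀ z, z.1 ∉ closure {x | A.v x ≠ 0} → z.1 ∉ closure {x | A.a x ≠ 0} → β z = 0) ∧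
    ∀ {ψ : X × ℝ → ℝ}, SmoothXR d ψ → ∀ {C : ℝ},
      (∀ x s, 0 < s → |ψ (x, s)| ≤ C) →
      (∀ x s, 0 < s → |dirDerivXR A.v (fun _ => 0) ψ (x, s)| ≤ C) →
      (∀ x s, 0 < s → |dirDerivXR (d := d) (fun _ => 0) A.a ψ (x, s)| ≤ C) →
      ∫ z, (dirDerivXR A.v A.a ψ z + ψ z * β z) ∂(levyMeasure g ρ p) = 0 := by
  obtain ⟨Dv, Da, hDv, hDa, hβe⟩ := hβ
  obtain ⟨Cb, hCb, hb⟩ := exists_enorm_sq_dirDerivXR_le g A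
  have hdiv0 : ∀ x, x ∉ closure {x | A.v x ≠ 0} → divergence g A.v x = 0 :=
    fun x hx => divergence_eq_zero g hx
  have ha0 : ∀ x, x ∉ closure {x | A.a x ≠ 0} → A.a x = 0 :=
    fun x hx => by_contra fun h => hx (subset_closure h)
  have hdivc := continuous_divergence g A.smooth_v
  have hac := A.smooth_a.continuous
  obtain ⟨Cd, -, hCd⟩ := exists_bound_of_compact_support hdivc (isCompact_closure_v A) hdiv0
  obtain ⟨Ca, -, hCa⟩ := exists_bound_of_compact_support hac (isCompact_closure_a A) ha0
  obtain ⟨hv2, hvI⟩ := sobolev_integration_by_parts A.smooth_v continuous_const hdivc hCd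
    (fun x hx _ => hdiv0 x hx) (fun w hw _ hi => integral_field g A hw hi) hCb
    (fun φ z => (hb φ z).1) hDv
  obtain ⟨ha2, haI⟩ := sobolev_integration_by_parts contMDiff_zero_field hac hac hCa
    (fun x _ hx => ha0 x hx) (fun w hw h1 hi => integral_mark g A hw h1 hi) hCb
    (fun φ z => (hb φ z).2) hDa
  have hβfun : β = fun z => (2 * √(ρ z.1 * p z.1 z.2) * Dv z / (ρ z.1 * p z.1 z.2) +
      divergence g A.v z.1) + (2 * √(ρ z.1 * p z.1 z.2) * Da z / (ρ z.1 * p z.1 z.2) +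
      A.a z.1) := funext hβe
  refine ⟨?_, ?_, ?_⟩
  · rw [hβfun]
    refine ((hadm.memLp_sqrt_mul_div hv2).add ?_).add ((hadm.memLp_sqrt_mul_div ha2).add ?_)
    · exact hadm.memLp_of_bounded (f := fun z => divergence g A.v z.1)
        (hdivc.comp continuous_fst).aestronglyMeasurable (isCompact_closure_v A)
        (fun x s _ => hCd x) fun x hx s _ => hdiv0 x hx
    · exact hadm.memLp_of_bounded (f := fun z => A.a z.1)
        (hac.comp continuous_fst).aestronglyMeasurable (isCompact_closure_a A)
        (fun x s _ => hCa x) fun x hx s _ => ha0 x hx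
  · intro z hzv hza
    have h1 : z.1 ∉ closure {x : X | (fun _ => (0 : ℝ)) x ≠ 0} := by simp
    have h2 : z.1 ∉ closure {x : X | (fun x => (0 : TangentSpace (𝓡 d) x)) x ≠ 0} := by simp
    rw [hβe, hDv.2.1 z hzv h1, hDa.2.1 z h2 hza, hdiv0 _ hzv, ha0 _ hza]
    simp
  · intro ψ hψ C hC hCv hCa'
    obtain ⟨i1, e1⟩ := hvI hψ hC hCv
    obtain ⟨i2, e2⟩ := haI hψ hC hCa'
    rw [levyMeasure, integral_withDensity_eq_integral_toReal_smul₀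
      hadm.measurable_q.ennreal_ofReal.aemeasurable
      (Eventually.of_forall fun _ => ENNReal.ofReal_lt_top)]
    -- The sum of the two identities is the claim, since multiplying by `q` clears the denominators
    -- of `β` and leaves `2 ψ √q D` for both derivatives.
    have h3 := integral_add i1 i2
    rw [e1, e2, add_zero] at h3
    rw [← h3]
    refine integral_congr_ae ?_
    filter_upwards [hadm.ae_q_pos] with z hz
    rw [hβe, ENNReal.toReal_ofReal hz.le, smul_eq_mul, dirDerivXR_add_zero]
    beta_reduce
    generalize ρ z.1 * p z.1 z.2 = q at hz
    have hq : √q * √q = q := Real.mul_self_sqrt hz.le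
    have e1 : ∀ y : ℝ, y * √q * √q = y * q := fun y => by rw [mul_assoc, hq]
    rw [e1, e1, e1, e1]
    field_simp
    ring

/-- Locally Sobolev functions have Sobolev derivatives along compactly supported directions. -/
theorem exists_sobolevDeriv {v : (x : X) → TangentSpace (𝓡 d) x} {a : X → ℝ}
    (hv : ContMDiff (𝓡 d) (𝓡 d).tangent ∞ (fun x => (⟨x, v x⟩ : TangentBundle (𝓡 d) X)))
    (ha : Continuous a) (hvc : IsCompact (closure {x | v x ≠ 0}))
    (hac : IsCompact (closure {x | a x ≠ 0})) {Cb : ENNReal} (hCb : Cb ≠ ⊤)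
    (hb : ∀ (φ : X × ℝ → ℝ) (z : X × ℝ), ‖dirDerivXR v a φ z‖ₑ ^ 2 ≤
      Cb * (gradSq g φ z + ‖z.2 * deriv (fun s => φ (z.1, s)) z.2‖ₑ ^ 2 + ‖φ z‖ₑ ^ 2))
    {f : X × ℝ → ℝ} (hf : MemLocalSobolev g f) : ∃ D, IsSobolevDeriv g v a f D := by
  have : LocallyCompactSpace X := Manifold.locallyCompact_of_finiteDimensional (𝓡 d)
  -- A compact neighbourhood of the supports: the local Sobolev condition applies over its interior,
  -- which serves as the open set `U`.
  obtain ⟨L, hL, hsub⟩ := exists_compact_superset (hvc.union hac)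
  set U := interior L with hU
  have hUm : MeasurableSet (U ×ˢ Ioi (0 : ℝ)) := isOpen_interior.measurableSet.prod measurableSet_Ioi
  obtain ⟨h, ⟨φ, happ⟩, hfh⟩ := hf (U ×ˢ Ioi (0 : ℝ))
    ⟨hUm, L, hL, prod_mono_left interior_subset⟩
  have hDφ2 := fun n => memLp_dirDerivXR_test hv ha hCb hb (happ.test n) (happ.finite n)
  obtain ⟨D, hDm, hDt⟩ := exists_limit_of_cauchy hDφ2 (by
    intro ε hε
    obtain ⟨δ, hδ, hδε⟩ : ∃ δ : ENNReal, 0 < δ ∧ Cb * δ < ε := by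
      have ht : Tendsto (fun δ : ENNReal => Cb * δ) (𝓝[>] 0) (𝓝 (Cb * 0)) :=
        (ENNReal.Tendsto.const_mul tendsto_id (Or.inr hCb)).mono_left nhdsWithin_le_nhds
      rw [mul_zero] at ht
      obtain ⟨δ, h1, h2⟩ := ((ht.eventually (gt_mem_nhds hε)).and self_mem_nhdsWithin).exists
      exact ⟨δ, h2, h1⟩
    obtain ⟨N, hN⟩ := happ.cauchy δ hδ
    refine ⟨N, fun j hj k hk => ?_⟩
    refine lt_of_le_of_lt ?_ ((mul_le_mul_right (hN j hj k hk).le Cb).trans_lt hδε)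
    refine le_trans (le_of_eq (lintegral_congr_ae ?_))
      (lintegral_dirDerivXR_le hCb hb (fun z => φ j z - φ k z))
    filter_upwards [ae_pos_mark g] with z hz
    rw [dirDerivXR_sub (happ.test j).smoothXR (happ.test k).smoothXR v a hz])
  -- The `L²` limit is determined only almost everywhere, whereas a Sobolev derivative must vanish
  -- at every point off the supports; so the limit is cut off.
  set S : Set (X × ℝ) := (closure {x | v x ≠ 0} ∪ closure {x | a x ≠ 0}) ×ˢ univ with hS
  have hSm : MeasurableSet S :=
    (isClosed_closure.union isClosed_closure).measurableSet.prod MeasurableSet.univ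
  refine ⟨S.indicator D, hDm.indicator hSm, ?_, U, h, φ, isOpen_interior,
    subset_union_left.trans hsub, subset_union_right.trans hsub, hfh, happ, ?_⟩
  · intro z hz1 hz2
    refine indicator_of_notMem ?_ _
    rintro ⟨h | h, -⟩
    · exact hz1 h
    · exact hz2 h
  · refine tendsto_of_tendsto_of_tendsto_of_le_of_le tendsto_const_nhds hDt
      (fun _ => bot_le) fun n => lintegral_mono fun z => ?_
    by_cases hz : z ∈ S
    · simp only [indicator_of_mem hz]; exact le_rfl
    · simp only [indicator_of_notMem hz]
      have hv0 : v z.1 = 0 := by_contra fun h =>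
        hz ⟨Or.inl (subset_closure h), mem_univ _⟩
      have ha0 : a z.1 = 0 := by_contra fun h =>
        hz ⟨Or.inr (subset_closure h), mem_univ _⟩
      rw [dirDerivXR_eq_zero _ hv0 ha0]
      simp

theorem exists_logDeriv (hadm : IsAdmissible g ρ p) (A : LieAlg d X) :
    ∃ β, IsLogDeriv g (fun z => ρ z.1 * p z.1 z.2) A β := by
  obtain ⟨Cb, hCb, hb⟩ := exists_enorm_sq_dirDerivXR_le g A
  obtain ⟨Dv, hDv⟩ := exists_sobolevDeriv A.smooth_v (continuous_const (y := (0 : ℝ)))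
    (isCompact_closure_v A) (by simp) hCb (fun φ z => (hb φ z).1) hadm.sobolev
  obtain ⟨Da, hDa⟩ := exists_sobolevDeriv contMDiff_zero_field A.smooth_a.continuous
    (by simp) (isCompact_closure_a A) hCb (fun φ z => (hb φ z).2) hadm.sobolev
  exact ⟨_, Dv, Da, hDv, hDa, fun z => rfl⟩

end oneParticle

theorem measurable_of_forall_eq {α β : Type*} [MeasurableSpace α] [MeasurableSpace β]
    {f f' : α → β} (hf : Measurable f) (h : ∀ a, f a = f' a) : Measurable f' :=
  (funext h : f = f') ▸ hf

/-! ### Configurations: local finiteness, point measures and measurability -/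

section configurations

variable {X : Type*} [TopologicalSpace X]

theorem Config.finite_inter (η : Config X) {K : Set X} (hK : IsCompact K) :
    (η.carrier ∩ K ×ˢ univ).Finite := by
  refine Set.Finite.of_finite_image ((η.locallyFinite K hK).subset ?_) ?_ (f := Prod.fst)
  · rintro _ ⟨z, hz, rfl⟩
    exact ⟨⟨z, hz.1, rfl⟩, hz.2.1⟩
  · intro z hz z' hz' h
    by_contra hne
    exact η.inj z hz.1 z' hz'.1 hne h

theorem Config.finite_of_subset (η : Config X) {K : Set X} (hK : IsCompact K)
    {B : Set (X × ℝ)} (hB : B ⊆ K ×ˢ univ) : (η.carrier ∩ B).Finite :=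
  (η.finite_inter hK).subset (inter_subset_inter_right _ hB)

theorem count_eq_zero_iff (η : Config X) {K : Set X} (hK : IsCompact K)
    {B : Set (X × ℝ)} (hB : B ⊆ K ×ˢ univ) : count B η = 0 ↔ ∀ z ∈ η.carrier, z ∉ B := by
  rw [count, Set.ncard_eq_zero (η.finite_of_subset hK hB), Set.eq_empty_iff_forall_notMem]
  exact ⟨fun h z hz hzB => h z ⟨hz, hzB⟩, fun h z hz => h z hz.1 hz.2⟩

theorem pairing_congr {b b' : X × ℝ → ℝ} {η : Config X} (h : ∀ z ∈ η.carrier, b z = b' z) :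
    pairing b η = pairing b' η :=
  finsum_mem_congr rfl h

theorem pairing_eq_sum {b : X × ℝ → ℝ} {η : Config X} {s : Finset (X × ℝ)}
    (hs : (s : Set (X × ℝ)) ⊆ η.carrier) (h0 : ∀ z ∈ η.carrier, z ∉ s → b z = 0) :
    pairing b η = ∑ z ∈ s, b z := by
  refine finsum_mem_eq_sum_of_inter_support_eq b ?_
  ext z
  simp only [mem_inter_iff, Function.mem_support, Finset.mem_coe]
  refine ⟨fun h => ⟨by_contra fun hz => h.2 (h0 z h.1 hz), h.2⟩, fun h => ⟨hs h.1, h.2⟩⟩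

/-- The finite set of the points of `η` over `K`. -/
def Config.points (η : Config X) {K : Set X} (hK : IsCompact K) : Finset (X × ℝ) :=
  (η.finite_inter hK).toFinset

theorem Config.mem_points {η : Config X} {K : Set X} {hK : IsCompact K} {z : X × ℝ} :
    z ∈ η.points hK ↔ z ∈ η.carrier ∧ z.1 ∈ K := by
  simp [Config.points]

theorem pairing_eq_sum_points {b : X × ℝ → ℝ} (η : Config X) {K : Set X} (hK : IsCompact K)
    (h0 : ∀ x ∉ K, ∀ s, 0 < s → b (x, s) = 0) : pairing b η = ∑ z ∈ η.points hK, b z := by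
  refine pairing_eq_sum (fun z hz => (Config.mem_points.1 hz).1) fun z hz hzs => ?_
  exact h0 z.1 (fun h => hzs (Config.mem_points.2 ⟨hz, h⟩)) z.2 (η.pos z hz)

/-- Locality: linear functionals of functions supported over `Λ` can be computed in the window. -/
theorem pairing_restrictConfig {b : X × ℝ → ℝ} (η : Config X) {Λ : Set X}
    (h0 : ∀ x ∉ Λ, ∀ s, 0 < s → b (x, s) = 0) : pairing b (restrictConfig Λ η) = pairing b η := by
  refine finsum_mem_inter_support_eq' b _ _ fun z hz => ?_
  constructor
  · exact fun h => h.1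
  · intro h
    refine ⟨h, by_contra fun hΛ => hz (h0 z.1 hΛ z.2 (η.pos z h)), η.pos z h⟩

theorem pairing_indicator_one {B : Set (X × ℝ)} (η : Config X) {K : Set X} (hK : IsCompact K)
    (hB : B ⊆ K ×ˢ univ) : pairing (B.indicator fun _ => (1 : ℝ)) η = count B η := by
  classical
  have hf := η.finite_of_subset hK hB
  rw [pairing_eq_sum (s := hf.toFinset) (by simp), count, Set.ncard_eq_toFinset_card _ hf]
  · rw [Finset.sum_congr rfl fun z hz => indicator_of_mem (hf.mem_toFinset.1 hz).2 _]
    simp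
  · intro z hz hzs
    exact indicator_of_notMem (fun h => hzs (hf.mem_toFinset.2 ⟨hz, h⟩)) _

variable [MeasurableSpace X]

theorem measurable_count {B : Set (X × ℝ)} (hB : B ∈ BorelC X) : Measurable (count B) := by
  refine Measurable.of_comap_le ?_
  exact le_iSup₂_of_le B hB le_rfl

theorem measurable_toConfig {α : Type*} [MeasurableSpace α] {f : α → Config X}
    (hf : ∀ B ∈ BorelC X, Measurable fun a => count B (f a)) : Measurable f := by
  refine measurable_iff_comap_le.2 ?_
  simp only [instMeasurableSpaceConfig, MeasurableSpace.comap_iSup, MeasurableSpace.comap_comp]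
  exact iSup₂_le fun B hB => (hf B hB).comap_le

theorem measurable_restrictConfig {Λ : Set X} (hΛ : MeasurableSet Λ) :
    Measurable (restrictConfig Λ : Config X → Config X) := by
  refine measurable_toConfig fun B hB => ?_
  have : B ∩ Λ ×ˢ Ioi (0 : ℝ) ∈ BorelC X := by
    obtain ⟨hBm, K, hK, hBK⟩ := hB
    exact ⟨hBm.inter (hΛ.prod measurableSet_Ioi), K, hK, inter_subset_left.trans hBK⟩
  refine measurable_of_forall_eq (measurable_count this) fun η => ?_
  simp only [count, restrictConfig, inter_assoc, inter_comm B]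

/-- The configuration of the points `ξ 0, …, ξ (n - 1)`, if they have distinct positions and
positive marks, and the empty configuration otherwise. -/
def ofPoints {n : ℕ} (ξ : Fin n → X × ℝ) : Config X where
  carrier := {z | (Function.Injective (fun i => (ξ i).1) ∧ ∀ i, 0 < (ξ i).2) ∧ z ∈ range ξ}
  pos := by
    rintro _ ⟨h, i, rfl⟩
    exact h.2 i
  inj := by
    rintro _ ⟨h, i, rfl⟩ _ ⟨-, j, rfl⟩ hne h'
    exact hne (congrArg ξ (h.1 h'))
  locallyFinite K _ := by
    refine (((finite_range ξ).subset fun z hz => hz.2).image Prod.fst).subset inter_subset_left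

/-- Distinct positions and positive marks. -/
def IsSimple {n : ℕ} (ξ : Fin n → X × ℝ) : Prop :=
  Function.Injective (fun i => (ξ i).1) ∧ ∀ i, 0 < (ξ i).2

theorem ofPoints_carrier {n : ℕ} {ξ : Fin n → X × ℝ} (h : IsSimple ξ) :
    (ofPoints ξ).carrier = range ξ := by
  ext z
  exact ⟨fun hz => hz.2, fun hz => ⟨h, hz⟩⟩

theorem ofPoints_carrier_of_not {n : ℕ} {ξ : Fin n → X × ℝ} (h : ¬ IsSimple ξ) :
    (ofPoints ξ).carrier = ∅ :=
  eq_empty_of_forall_notMem fun _ hz => h hz.1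

theorem IsSimple.injective {n : ℕ} {ξ : Fin n → X × ℝ} (h : IsSimple ξ) :
    Function.Injective ξ :=
  fun _ _ hij => h.1 (congrArg Prod.fst hij)

theorem pairing_ofPoints {n : ℕ} {ξ : Fin n → X × ℝ} (h : IsSimple ξ) (b : X × ℝ → ℝ) :
    pairing b (ofPoints ξ) = ∑ i, b (ξ i) := by
  rw [pairing, ofPoints_carrier h, finsum_mem_range h.injective, finsum_eq_sum_of_fintype]

theorem count_ofPoints {n : ℕ} {ξ : Fin n → X × ℝ} (h : IsSimple ξ) {B : Set (X × ℝ)}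
    (hB : B ∈ BorelC X) : (count B (ofPoints ξ) : ℝ) = ∑ i, B.indicator (fun _ => (1 : ℝ)) (ξ i) := by
  obtain ⟨-, K, hK, hBK⟩ := hB
  rw [← pairing_ofPoints h, pairing_indicator_one _ hK (hBK.trans (prod_mono_right (subset_univ _)))]

variable [T2Space X] [SecondCountableTopology X] [BorelSpace X]

theorem measurableSet_isSimple (n : ℕ) :
    MeasurableSet {ξ : Fin n → X × ℝ | IsSimple ξ} := by
  have h1 : {ξ : Fin n → X × ℝ | IsSimple ξ} =
      (⋂ (i) (j) (_ : i ≠ j), {ξ : Fin n → X × ℝ | (ξ i).1 = (ξ j).1}ᶜ) ∩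
        ⋂ i, {ξ : Fin n → X × ℝ | 0 < (ξ i).2} := by
    ext ξ
    simp only [IsSimple, Function.Injective, mem_ofPred_eq, mem_inter_iff, mem_iInter,
      mem_compl_iff]
    refine and_congr_left fun _ => ⟨fun h i j hij h' => hij (h h'), fun h i j h' => ?_⟩
    exact by_contra fun hij => h i j hij h'
  rw [h1]
  refine MeasurableSet.inter ?_ (MeasurableSet.iInter fun i =>
    measurableSet_lt measurable_const (measurable_snd.comp (measurable_pi_apply i)))
  refine MeasurableSet.iInter fun i => MeasurableSet.iInter fun j => MeasurableSet.iInter fun _ => ?_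
  refine (IsClosed.measurableSet ?_).compl
  exact isClosed_eq (continuous_fst.comp (continuous_apply i)) (continuous_fst.comp (continuous_apply j))

theorem measurable_ofPoints (n : ℕ) : Measurable (ofPoints : (Fin n → X × ℝ) → Config X) := by
  classical
  refine measurable_toConfig fun B hB => ?_
  have h1 : (fun ξ : Fin n → X × ℝ => (count B (ofPoints ξ) : ℝ)) =
      {ξ | IsSimple ξ}.indicator fun ξ => ∑ i, B.indicator (fun _ => (1 : ℝ)) (ξ i) := by
    funext ξ
    by_cases h : IsSimple ξ
    · rw [indicator_of_mem (show ξ ∈ {ξ | IsSimple ξ} from h), count_ofPoints h hB]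
    · rw [indicator_of_notMem (show ξ ∉ {ξ | IsSimple ξ} from h), count, ofPoints_carrier_of_not h]
      simp
  have h2 : Measurable (fun ξ : Fin n → X × ℝ => (count B (ofPoints ξ) : ℝ)) := by
    rw [h1]
    refine Measurable.indicator ?_ (measurableSet_isSimple n)
    exact Finset.measurable_sum _ fun i _ =>
      (measurable_const.indicator hB.1).comp (measurable_pi_apply i)
  have h3 := Nat.measurable_floor.comp h2
  simpa [Function.comp_def] using h3

/-- The points of a configuration over `K`, as a measure. -/
def Config.toMeasure (η : Config X) {K : Set X} (hK : IsCompact K) : Measure (X × ℝ) :=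
  ∑ z ∈ η.points hK, Measure.dirac z

/-- The mass that it gives to `B` is the count of `B ∩ (K × ℝ₊)`, and such counts are measurable by
the definition of the σ-algebra. -/
theorem measurable_toMeasure {K : Set X} (hK : IsCompact K) :
    Measurable fun η : Config X => η.toMeasure hK := by
  classical
  refine Measure.measurable_of_measurable_coe _ fun B hB => ?_
  have hB' : B ∩ K ×ˢ Ioi (0 : ℝ) ∈ BorelC X :=
    ⟨hB.inter (hK.measurableSet.prod measurableSet_Ioi), K, hK, inter_subset_right⟩
  have h : Measurable fun η : Config X => ((count (B ∩ K ×ˢ Ioi (0 : ℝ)) η : ℕ) : ENNReal) :=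
    (measurable_from_top (f := fun n : ℕ => (n : ENNReal))).comp (measurable_count hB')
  refine measurable_of_forall_eq h fun η => ?_
  have hset : η.carrier ∩ (B ∩ K ×ˢ Ioi (0 : ℝ)) = ((η.points hK).filter (· ∈ B) : Finset _) := by
    ext z
    simp only [mem_inter_iff, mem_prod, mem_Ioi, Finset.coe_filter, Config.mem_points,
      mem_ofPred_eq]
    exact ⟨fun h => ⟨⟨h.1, h.2.2.1⟩, h.2.1⟩, fun h => ⟨h.1.1, h.2, h.1.2, η.pos z h.1.1⟩⟩
  rw [count, hset, ncard_coe_finset, Config.toMeasure, Measure.finsetSum_apply]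
  simp only [Measure.dirac_apply' _ hB, indicator_apply, Pi.one_apply]
  rw [Finset.sum_boole]

/-- The pairing is an integral against the random point measure over `K`, hence measurable for
nonnegative functions; the positive and the negative part are treated separately. -/
theorem measurable_pairing {b : X × ℝ → ℝ} (hb : Measurable b) {K : Set X} (hK : IsCompact K)
    (h0 : ∀ x ∉ K, ∀ s, 0 < s → b (x, s) = 0) : Measurable (pairing b : Config X → ℝ) := by
  have key : ∀ f : X × ℝ → ENNReal, Measurable f →
      Measurable fun η : Config X => (∑ z ∈ η.points hK, f z) := by
    intro f hf
    refine measurable_of_forall_eq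
      ((Measure.measurable_lintegral hf).comp (measurable_toMeasure hK)) fun η => ?_
    simp only [Function.comp, Config.toMeasure]
    rw [lintegral_finsetSum_measure]
    exact Finset.sum_congr rfl fun z _ => lintegral_dirac' _ hf
  have h1 := (key _ hb.ennreal_ofReal).ennreal_toReal
  have h2 := (key _ hb.neg.ennreal_ofReal).ennreal_toReal
  refine measurable_of_forall_eq (h1.sub h2) fun η => ?_
  rw [pairing_eq_sum_points η hK h0]
  simp only [Pi.sub_apply]
  rw [ENNReal.toReal_sum (by simp), ENNReal.toReal_sum (by simp), ← Finset.sum_sub_distrib]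
  refine Finset.sum_congr rfl fun z _ => ?_
  simp only [ENNReal.toReal_ofReal', Pi.neg_apply]
  exact max_zero_sub_max_neg_zero_eq_self (b z)

end configurations

/-! ### Exponential series and finite products of a finite measure -/

theorem hasSum_exp_ennreal {r : ℝ} (hr : 0 ≤ r) :
    ∑' n : ℕ, ((n.factorial : ENNReal))⁻¹ * ENNReal.ofReal r ^ n =
      ENNReal.ofReal (Real.exp r) := by
  have h := NormedSpace.expSeries_div_hasSum_exp (𝔸 := ℝ) r
  rw [← Real.exp_eq_exp_ℝ] at h
  rw [← h.tsum_eq, ENNReal.ofReal_tsum_of_nonneg (fun n => by positivity) h.summable]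
  refine tsum_congr fun n => ?_
  rw [ENNReal.ofReal_div_of_pos (by positivity), ENNReal.ofReal_pow hr, ENNReal.ofReal_natCast,
    ENNReal.div_eq_inv_mul]

theorem pi_univ_pow {α : Type*} [MeasurableSpace α] (ν : Measure α) [IsFiniteMeasure ν] (n : ℕ) :
    Measure.pi (fun _ : Fin n => ν) univ = ENNReal.ofReal (ν univ).toReal ^ n := by
  rw [Measure.pi_univ, Finset.prod_const, Finset.card_univ, Fintype.card_fin,
    ENNReal.ofReal_toReal (measure_ne_top ν univ)]

theorem quasi_eval {α : Type*} [MeasurableSpace α] (ν : Measure α) [IsFiniteMeasure ν] {n : ℕ}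
    (i : Fin n) : Measure.QuasiMeasurePreserving (Function.eval i)
      (Measure.pi fun _ : Fin n => ν) ν :=
  Measure.quasiMeasurePreserving_eval (fun _ : Fin n => ν) i

theorem lintegral_eval {α : Type*} [MeasurableSpace α] (ν : Measure α) [IsFiniteMeasure ν] {n : ℕ}
    (i : Fin n) {f : α → ENNReal} (hf : Measurable f) :
    ∫⁻ ξ, f (ξ i) ∂(Measure.pi fun _ : Fin n => ν) = (ν univ) ^ (n - 1) * ∫⁻ z, f z ∂ν := by
  have h := Measure.pi_map_eval (μ := fun _ : Fin n => ν) i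
  have h2 := lintegral_map hf (measurable_pi_apply i) (μ := Measure.pi fun _ : Fin n => ν)
  rw [← h2]
  change ∫⁻ a, f a ∂(Measure.map (Function.eval i : (Fin n → α) → α) _) = _
  rw [h, lintegral_smul_measure, Finset.prod_const, Finset.card_erase_of_mem (Finset.mem_univ i),
    Finset.card_univ, Fintype.card_fin, smul_eq_mul]

theorem memLp_eval {α : Type*} [MeasurableSpace α] {ν : Measure α} [IsFiniteMeasure ν] {n : ℕ}
    (i : Fin n) {f : α → ℝ} {p : ENNReal} (hf : MemLp f p ν) :
    MemLp (fun ξ : Fin n → α => f (ξ i)) p (Measure.pi fun _ : Fin n => ν) := by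
  have h := Measure.pi_map_eval (μ := fun _ : Fin n => ν) i
  have h1 : MemLp f p ((Measure.pi fun _ : Fin n => ν).map (Function.eval i)) := by
    rw [h]
    refine hf.smul_measure ?_
    exact (ENNReal.prod_lt_top fun _ _ => measure_lt_top ν univ).ne
  exact h1.comp_of_map (measurable_pi_apply i).aemeasurable

/-- If the integrals over one coordinate vanish, so does the integral. -/
theorem integral_pi_eq_zero {α : Type*} [MeasurableSpace α] {ν : Measure α} [IsFiniteMeasure ν]
    {n : ℕ} (i : Fin (n + 1)) {T : (Fin (n + 1) → α) → ℝ}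
    (hT : Integrable T (Measure.pi fun _ => ν))
    (h0 : ∀ ξ : Fin n → α, ∫ z, T (i.insertNth z ξ) ∂ν = 0) :
    ∫ ξ, T ξ ∂(Measure.pi fun _ => ν) = 0 := by
  have hmp := (measurePreserving_piFinSuccAbove (fun _ : Fin (n + 1) => ν) i).symm
  rw [← hmp.integral_comp' T]
  have hi := (hmp.integrable_comp_emb (MeasurableEquiv.measurableEmbedding _)).2 hT
  refine (integral_prod_symm _ hi).trans ?_
  exact integral_eq_zero_of_ae (Eventually.of_forall fun ξ => h0 ξ)

/-! ### Poisson measures of finite intensity and the law in a window -/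

section law

variable {X : Type*} [TopologicalSpace X] [MeasurableSpace X] [T2Space X]
  [SecondCountableTopology X] [BorelSpace X]

/-- The Poisson measure of finite intensity `ν`. -/
def finitePoisson (ν : Measure (X × ℝ)) : Measure (Config X) :=
  ENNReal.ofReal (Real.exp (-(ν univ).toReal)) • Measure.sum fun n : ℕ =>
    ((n.factorial : ENNReal))⁻¹ • (Measure.pi fun _ : Fin n => ν).map ofPoints

theorem finitePoisson_apply (ν : Measure (X × ℝ)) {A : Set (Config X)} (hA : MeasurableSet A) :
    finitePoisson ν A = ENNReal.ofReal (Real.exp (-(ν univ).toReal)) * ∑' n : ℕ,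
      ((n.factorial : ENNReal))⁻¹ * (Measure.pi fun _ : Fin n => ν) (ofPoints ⁻¹' A) := by
  rw [finitePoisson, Measure.smul_apply, Measure.sum_apply _ hA, smul_eq_mul]
  congr 1
  refine tsum_congr fun n => ?_
  rw [Measure.smul_apply, Measure.map_apply (measurable_ofPoints n) hA, smul_eq_mul]

theorem lintegral_finitePoisson (ν : Measure (X × ℝ)) {H : Config X → ENNReal}
    (hH : Measurable H) :
    ∫⁻ η, H η ∂(finitePoisson ν) = ENNReal.ofReal (Real.exp (-(ν univ).toReal)) * ∑' n : ℕ,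
      ((n.factorial : ENNReal))⁻¹ * ∫⁻ ξ, H (ofPoints ξ) ∂(Measure.pi fun _ : Fin n => ν) := by
  rw [finitePoisson, lintegral_smul_measure, lintegral_sum_measure, smul_eq_mul]
  congr 1
  refine tsum_congr fun n => ?_
  rw [lintegral_smul_measure, lintegral_map hH (measurable_ofPoints n), smul_eq_mul]

theorem ae_finitePoisson {ν : Measure (X × ℝ)} {P : Config X → Prop}
    (hP : MeasurableSet {η | P η})
    (h : ∀ n : ℕ, ∀ᵐ ξ ∂(Measure.pi fun _ : Fin n => ν), P (ofPoints ξ)) :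
    ∀ᵐ η ∂(finitePoisson ν), P η := by
  rw [finitePoisson]
  refine Measure.ae_smul_measure ?_ _
  rw [Measure.ae_sum_iff]
  intro n
  refine Measure.ae_smul_measure ?_ _
  exact (ae_map_iff (measurable_ofPoints n).aemeasurable hP).2 (h n)

theorem integral_finitePoisson_eq_zero {ν : Measure (X × ℝ)} {H : Config X → ℝ}
    (hH : Integrable H (finitePoisson ν))
    (h : ∀ n : ℕ, ∫ ξ, H (ofPoints ξ) ∂(Measure.pi fun _ : Fin n => ν) = 0) :
    ∫ η, H η ∂(finitePoisson ν) = 0 := by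
  have hH' := hH
  rw [finitePoisson] at hH' ⊢
  rw [integral_smul_measure]
  rw [integrable_smul_measure (by simpa using Real.exp_pos _) ENNReal.ofReal_ne_top] at hH'
  rw [integral_sum_measure hH']
  convert smul_zero _
  refine (tsum_congr fun n => ?_).trans tsum_zero
  rw [integral_smul_measure]
  have hm : Integrable H ((Measure.pi fun _ : Fin n => ν).map ofPoints) := by
    have := hH'.mono_measure (Measure.le_sum _ n)
    rwa [integrable_smul_measure (by simp) (by simp [n.factorial_ne_zero])] at this
  rw [integral_map (measurable_ofPoints n).aemeasurable hm.1, h n, smul_zero]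

variable {μ : Measure (X × ℝ)} {π : Measure (Config X)}

/-- A configuration is determined by its set of points, so the existential condition in the law is a
preimage under `ofPoints`. Positivity of the marks comes from the configuration itself. -/
theorem IsMarkedPoisson.law_apply (hπ : IsMarkedPoisson μ π) {Λ : Set X} (hΛ : IsOpen Λ)
    (hc : IsCompact (closure Λ)) {A : Set (Config X)} (hA : MeasurableSet A) :
    π (restrictConfig Λ ⁻¹' A) =
      ENNReal.ofReal (Real.exp (-((μ.restrict (Λ ×ˢ Ioi (0 : ℝ))) univ).toReal)) * ∑' n : ℕ,
        ((n.factorial : ENNReal))⁻¹ * (Measure.pi fun _ : Fin n => μ.restrict (Λ ×ˢ Ioi (0 : ℝ)))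
          ({ξ | IsSimple ξ} ∩ ofPoints ⁻¹' A) := by
  rw [hπ.law Λ hΛ hc A hA, Measure.restrict_apply_univ]
  congr 1
  refine tsum_congr fun n => ?_
  congr 2
  ext ξ
  constructor
  · rintro ⟨hinj, η, hη, hc⟩
    have hs : IsSimple ξ := ⟨hinj, fun i => η.pos _ (hc ▸ mem_range_self i)⟩
    refine ⟨hs, ?_⟩
    have : ofPoints ξ = η := Config.ext (by rw [ofPoints_carrier hs, hc])
    rwa [mem_preimage, this]
  · rintro ⟨hs, hA'⟩
    exact ⟨hs.1, _, hA', ofPoints_carrier hs⟩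

/-- Let `r` be the mass of the window. For the sure event the law says that the masses of the simple
tuples, weighted by `1/n!`, sum to `exp r`. The full masses `r^n` with the same weights have the
same sum and dominate term by term, so no mass is lost in any sector. No property of `μ` other than
finiteness on the window is needed. -/
theorem IsMarkedPoisson.ae_isSimple (hπ : IsMarkedPoisson μ π) {Λ : Set X} (hΛ : IsOpen Λ)
    (hc : IsCompact (closure Λ)) (hfin : μ (Λ ×ˢ Ioi (0 : ℝ)) < ⊤) (n : ℕ) :
    ∀ᵐ ξ ∂(Measure.pi fun _ : Fin n => μ.restrict (Λ ×ˢ Ioi (0 : ℝ))), IsSimple ξ := by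
  set ν := μ.restrict (Λ ×ˢ Ioi (0 : ℝ)) with hν
  have : IsFiniteMeasure ν := ⟨by rw [hν, Measure.restrict_apply_univ]; exact hfin⟩
  have hprob := hπ.isProbabilityMeasure
  set r := (ν univ).toReal
  have h1 := hπ.law_apply hΛ hc MeasurableSet.univ
  rw [preimage_univ, measure_univ] at h1
  simp only [preimage_univ, inter_univ] at h1
  set b : ℕ → ENNReal := fun n =>
    ((n.factorial : ENNReal))⁻¹ * (Measure.pi fun _ : Fin n => ν) univ with hb
  set a : ℕ → ENNReal := fun n =>
    ((n.factorial : ENNReal))⁻¹ * (Measure.pi fun _ : Fin n => ν) {ξ | IsSimple ξ} with ha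
  have hbs : ∑' n, b n = ENNReal.ofReal (Real.exp r) := by
    rw [← hasSum_exp_ennreal (r := r) ENNReal.toReal_nonneg]
    exact tsum_congr fun n => by rw [hb]; simp only [pi_univ_pow]; rfl
  have hab : a ≤ b := fun n => mul_le_mul_right (measure_mono (subset_univ _)) _
  have hsum : ∑' n, a n = ∑' n, b n := by
    refine le_antisymm (ENNReal.tsum_le_tsum hab) ?_
    rw [hbs]
    have hE : ENNReal.ofReal (Real.exp r) * ENNReal.ofReal (Real.exp (-r)) = 1 := by
      rw [← ENNReal.ofReal_mul (Real.exp_pos _).le, ← Real.exp_add, add_neg_cancel, Real.exp_zero,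
        ENNReal.ofReal_one]
    calc ENNReal.ofReal (Real.exp r) = ENNReal.ofReal (Real.exp r) * 1 := (mul_one _).symm
      _ = ∑' n, a n := by rw [h1, ← mul_assoc, hE, one_mul]
      _ ≤ _ := le_rfl
  have hne : ∑' n, a n ≠ ⊤ := by rw [hsum, hbs]; exact ENNReal.ofReal_ne_top
  -- A strict inequality in one term would make the finite sums differ.
  have heq : a n = b n := by
    by_contra hn
    exact (ENNReal.tsum_lt_tsum hne hab (lt_of_le_of_ne (hab n) hn)).ne hsum
  have hfac0 : ((n.factorial : ENNReal))⁻¹ ≠ 0 := by simp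
  have hfact : ((n.factorial : ENNReal))⁻¹ ≠ ⊤ := by simp [n.factorial_ne_zero]
  have hm : (Measure.pi fun _ : Fin n => ν) {ξ | IsSimple ξ} =
      (Measure.pi fun _ : Fin n => ν) univ :=
    (ENNReal.mul_right_inj hfac0 hfact).1 heq
  exact (ae_iff_measure_eq (measurableSet_isSimple n).nullMeasurableSet).2 hm

theorem IsMarkedPoisson.measurePreserving (hπ : IsMarkedPoisson μ π) {Λ : Set X} (hΛ : IsOpen Λ)
    (hc : IsCompact (closure Λ)) (hfin : μ (Λ ×ˢ Ioi (0 : ℝ)) < ⊤) :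
    MeasurePreserving (restrictConfig Λ) π (finitePoisson (μ.restrict (Λ ×ˢ Ioi (0 : ℝ)))) := by
  refine ⟨measurable_restrictConfig hΛ.measurableSet, ?_⟩
  ext A hA
  rw [Measure.map_apply (measurable_restrictConfig hΛ.measurableSet) hA, hπ.law_apply hΛ hc hA,
    finitePoisson_apply _ hA]
  congr 1
  refine tsum_congr fun n => ?_
  congr 1
  refine measure_congr ?_
  filter_upwards [hπ.ae_isSimple hΛ hc hfin n] with ξ hξ
  exact propext ⟨fun h => h.2, fun h => ⟨hξ, h⟩⟩

theorem tsum_sq_factorial_lt_top {r : ENNReal} (hr : r ≠ ⊤) :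
    ∑' n : ℕ, ((n.factorial : ENNReal))⁻¹ * ((n : ENNReal) * (n * r ^ (n - 1))) < ⊤ := by
  -- Comparison with an exponential series: `n * n ≤ 4 ^ n` and `r ^ (n - 1) ≤ (r + 1) ^ n`, where
  -- the added `1` takes care of small `r` and of `n = 0`.
  set M : ℝ := 4 * (r.toReal + 1) with hM
  have hM0 : 0 ≤ M := by positivity
  refine lt_of_le_of_lt (ENNReal.tsum_le_tsum fun n => mul_le_mul_right ?_ _)
    ((hasSum_exp_ennreal hM0).trans_lt ENNReal.ofReal_lt_top)
  have h1 : ENNReal.ofReal M = 4 * (r + 1) := by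
    rw [hM, ENNReal.ofReal_mul (by norm_num), ENNReal.ofReal_add ENNReal.toReal_nonneg zero_le_one,
      ENNReal.ofReal_toReal hr]
    norm_num
  rw [h1, mul_pow, ← mul_assoc]
  refine mul_le_mul' ?_ ?_
  · have h2 : n * n ≤ 4 ^ n := by
      calc n * n ≤ 2 ^ n * 2 ^ n := Nat.mul_le_mul Nat.lt_two_pow_self.le Nat.lt_two_pow_self.le
        _ = 4 ^ n := by rw [← mul_pow]; norm_num
    exact_mod_cast h2
  · calc r ^ (n - 1) ≤ (r + 1) ^ (n - 1) := pow_le_pow_left' le_self_add _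
      _ ≤ (r + 1) ^ n := pow_le_pow_right₀ le_add_self (Nat.sub_le n 1)

/-- Linear functionals are square integrable. -/
theorem memLp_pairing_finitePoisson {ν : Measure (X × ℝ)} [IsFiniteMeasure ν]
    (hν : ∀ᵐ z ∂ν, 0 < z.2)
    (hs : ∀ n : ℕ, ∀ᵐ ξ ∂(Measure.pi fun _ : Fin n => ν), IsSimple ξ)
    {b : X × ℝ → ℝ} (hb : MemLp b 2 ν) {K : Set X} (hK : IsCompact K)
    (h0 : ∀ x ∉ K, ∀ s, 0 < s → b (x, s) = 0) : MemLp (pairing b) 2 (finitePoisson ν) := by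
  obtain ⟨b₀, hb₀m, hbb₀⟩ := hb.1
  have hSm : MeasurableSet (K ×ˢ Ioi (0 : ℝ)) := hK.measurableSet.prod measurableSet_Ioi
  -- A measurable version of `b` supported over `K`: `b` itself is measurable only up to a null set,
  -- and its pairing need not be measurable.
  set c := (K ×ˢ Ioi (0 : ℝ)).indicator b₀ with hc
  have hcm : Measurable c := hb₀m.measurable.indicator hSm
  have hc0 : ∀ x ∉ K, ∀ s, 0 < s → c (x, s) = 0 := fun x hx s _ =>
    indicator_of_notMem (fun h => hx h.1) _
  have hbc : b =ᵐ[ν] c := by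
    filter_upwards [hν, hbb₀] with z hz hz'
    by_cases hzS : z ∈ K ×ˢ Ioi (0 : ℝ)
    · rw [hc, indicator_of_mem hzS, hz']
    · rw [hc, indicator_of_notMem hzS]
      exact h0 z.1 (fun h => hzS ⟨h, hz⟩) z.2 hz
  have hcL : MemLp c 2 ν := (memLp_congr_ae hbc).1 hb
  have hpm := measurable_pairing hcm hK hc0
  -- Versions do not matter: almost surely no point of the configuration falls into the null set
  -- where `b` and `c` differ.
  have hae : pairing b =ᵐ[finitePoisson ν] pairing c := by
    set N := toMeasurable ν {z | b z ≠ c z} with hN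
    have hN0 : ν N = 0 := by rw [hN, measure_toMeasurable]; exact hbc
    set B := N ∩ K ×ˢ Ioi (0 : ℝ) with hB
    have hBc : B ∈ BorelC X :=
      ⟨(measurableSet_toMeasurable _ _).inter hSm, K, hK, inter_subset_right⟩
    have hBK : B ⊆ K ×ˢ univ := inter_subset_right.trans (prod_mono_right (subset_univ _))
    have h1 : ∀ᵐ η ∂(finitePoisson ν), count B η = 0 := by
      refine ae_finitePoisson (measurable_count hBc (measurableSet_singleton 0)) fun n => ?_
      have h2 : ∀ᵐ ξ ∂(Measure.pi fun _ : Fin n => ν), ∀ i, ξ i ∉ N :=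
        ae_all_iff.2 fun i => (quasi_eval ν i).ae (measure_eq_zero_iff_ae_notMem.1 hN0)
      filter_upwards [hs n, h2] with ξ hξ hξN
      rw [count_eq_zero_iff _ hK hBK, ofPoints_carrier hξ]
      rintro _ ⟨i, rfl⟩ hi
      exact hξN i hi.1
    filter_upwards [h1] with η hη
    rw [count_eq_zero_iff _ hK hBK] at hη
    refine pairing_congr fun z hz => ?_
    by_contra hne
    have hzK : z.1 ∈ K := by
      by_contra hzK
      exact hne ((h0 _ hzK _ (η.pos z hz)).trans (hc0 _ hzK _ (η.pos z hz)).symm)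
    exact hη z hz ⟨subset_toMeasurable ν _ hne, hzK, η.pos z hz⟩
  rw [memLp_congr_ae hae]
  refine ⟨hpm.aestronglyMeasurable, ?_⟩
  rw [eLpNorm_two_lt_top_iff, lintegral_finitePoisson ν (hpm.enorm.pow_const 2)]
  refine ENNReal.mul_lt_top ENNReal.ofReal_lt_top ?_
  set I := ∫⁻ z, ‖c z‖ₑ ^ 2 ∂ν with hI
  have hIt : I < ⊤ := (eLpNorm_two_lt_top_iff _).1 hcL.2
  -- Cauchy–Schwarz for a sum of `n` terms, then each coordinate is integrated separately and the
  -- other `n - 1` contribute the total mass.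
  have hbound : ∀ n : ℕ, ∫⁻ ξ, ‖pairing c (ofPoints ξ)‖ₑ ^ 2 ∂(Measure.pi fun _ : Fin n => ν) ≤
      (n : ENNReal) * (n * (ν univ) ^ (n - 1)) * I := by
    intro n
    calc ∫⁻ ξ, ‖pairing c (ofPoints ξ)‖ₑ ^ 2 ∂(Measure.pi fun _ : Fin n => ν)
        ≤ ∫⁻ ξ, (n : ENNReal) * ∑ i, ‖c (ξ i)‖ₑ ^ 2 ∂(Measure.pi fun _ : Fin n => ν) := by
          refine lintegral_mono_ae ?_
          filter_upwards [hs n] with ξ hξ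
          rw [pairing_ofPoints hξ]
          have h3 : (∑ i, c (ξ i)) ^ 2 ≤ (n : ℝ) * ∑ i, (c (ξ i)) ^ 2 := by
            have := sq_sum_le_card_mul_sum_sq (s := (Finset.univ : Finset (Fin n)))
              (f := fun i => c (ξ i))
            simpa using this
          have h4 : ∀ y : ℝ, ‖y‖ₑ ^ 2 = ENNReal.ofReal (y ^ 2) := fun y => by
            rw [← enorm_pow, Real.enorm_of_nonneg (sq_nonneg y)]
          simp only [h4]
          rw [← ENNReal.ofReal_sum_of_nonneg fun i _ => sq_nonneg _, ← ENNReal.ofReal_natCast,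
            ← ENNReal.ofReal_mul (Nat.cast_nonneg n)]
          exact ENNReal.ofReal_le_ofReal h3
      _ = (n : ENNReal) * (n * (ν univ) ^ (n - 1)) * I := by
          have hm : ∀ i : Fin n, Measurable fun ξ : Fin n → X × ℝ => ‖c (ξ i)‖ₑ ^ 2 := fun i =>
            (hcm.enorm.pow_const 2).comp (measurable_pi_apply i)
          rw [lintegral_const_mul _ (Finset.measurable_sum _ fun i _ => hm i),
            lintegral_finsetSum _ fun i _ => hm i]
          have : ∀ i : Fin n, ∫⁻ ξ, ‖c (ξ i)‖ₑ ^ 2 ∂(Measure.pi fun _ : Fin n => ν) =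
              (ν univ) ^ (n - 1) * I := fun i =>
            lintegral_eval ν i (f := fun z => ‖c z‖ₑ ^ 2) (hcm.enorm.pow_const 2)
          simp only [this, Finset.sum_const, Finset.card_univ, Fintype.card_fin, nsmul_eq_mul]
          ring
  refine lt_of_le_of_lt (ENNReal.tsum_le_tsum fun n => mul_le_mul_right (hbound n) _) ?_
  simp only [← mul_assoc]
  rw [ENNReal.tsum_mul_right]
  refine ENNReal.mul_lt_top ?_ hIt
  have := tsum_sq_factorial_lt_top (measure_ne_top ν univ)
  simpa only [← mul_assoc] using this

end law

/-! ### The class `C_b^∞(ℝ^N)` -/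

section CbInfty

variable {N M : ℕ} {f : (Fin N → ℝ) → ℝ}

theorem IsCbInfty.bounded (hf : IsCbInfty f) : ∃ C : ℝ, ∀ r, |f r| ≤ C := by
  obtain ⟨C, hC⟩ := hf.2 0
  exact ⟨C, fun r => by simpa using hC r⟩

theorem IsCbInfty.bounded_fderiv (hf : IsCbInfty f) : ∃ C : ℝ, 0 ≤ C ∧ ∀ r, ‖fderiv ℝ f r‖ ≤ C := by
  obtain ⟨C, hC⟩ := hf.2 1
  have h : ∀ r, ‖fderiv ℝ f r‖ ≤ C := fun r => by
    rw [← norm_iteratedFDeriv_one]; exact hC r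
  exact ⟨C, (norm_nonneg _).trans (h 0), h⟩

theorem IsCbInfty.add {g : (Fin N → ℝ) → ℝ} (hf : IsCbInfty f) (hg : IsCbInfty g) :
    IsCbInfty fun r => f r + g r := by
  refine ⟨hf.1.add hg.1, fun k => ?_⟩
  obtain ⟨C, hC⟩ := hf.2 k
  obtain ⟨D, hD⟩ := hg.2 k
  refine ⟨C + D, fun r => ?_⟩
  have hk : ((k : ℕ) : WithTop ℕ∞) ≤ ∞ := by exact_mod_cast le_top
  have := iteratedFDeriv_add_apply (𝕜 := ℝ) (i := k) (x := r) (hf.1.of_le hk).contDiffAt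
    (hg.1.of_le hk).contDiffAt
  change ‖iteratedFDeriv ℝ k (f + g) r‖ ≤ _
  rw [this]
  exact (norm_add_le _ _).trans (add_le_add (hC r) (hD r))

theorem IsCbInfty.mul {g : (Fin N → ℝ) → ℝ} (hf : IsCbInfty f) (hg : IsCbInfty g) :
    IsCbInfty fun r => f r * g r := by
  refine ⟨hf.1.mul hg.1, fun k => ?_⟩
  choose C hC using hf.2
  choose D hD using hg.2
  refine ⟨∑ i ∈ Finset.range (k + 1), (k.choose i : ℝ) * C i * D (k - i), fun r => ?_⟩
  have hk : ((k : ℕ) : WithTop ℕ∞) ≤ ∞ := by exact_mod_cast le_top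
  refine (norm_iteratedFDeriv_mul_le hf.1 hg.1 r hk).trans (Finset.sum_le_sum fun i _ => ?_)
  have h0 : 0 ≤ C i := (norm_nonneg _).trans (hC i r)
  gcongr
  · exact hC i r
  · exact hD _ r

theorem IsCbInfty.comp_clm (hf : IsCbInfty f) (L : (Fin M → ℝ) →L[ℝ] (Fin N → ℝ)) :
    IsCbInfty fun r => f (L r) := by
  refine ⟨hf.1.comp L.contDiff, fun k => ?_⟩
  obtain ⟨C, hC⟩ := hf.2 k
  refine ⟨C * ‖L‖ ^ k, fun r => ?_⟩
  have hk : ((k : ℕ) : WithTop ℕ∞) ≤ ∞ := by exact_mod_cast le_top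
  change ‖iteratedFDeriv ℝ k (f ∘ L) r‖ ≤ _
  rw [L.iteratedFDeriv_comp_right hf.1 r hk]
  refine (ContinuousMultilinearMap.norm_compContinuousLinearMap_le _ _).trans ?_
  rw [Finset.prod_const, Finset.card_univ, Fintype.card_fin]
  gcongr
  exact hC _

theorem isCbInfty_const (c : ℝ) : IsCbInfty fun _ : Fin N → ℝ => c := by
  refine ⟨contDiff_const, fun k => ?_⟩
  rcases Nat.eq_zero_or_pos k with rfl | hk
  · exact ⟨|c|, fun r => by simp⟩
  · exact ⟨0, fun r => by rw [iteratedFDeriv_const_of_ne (𝕜 := ℝ) hk.ne']; simp⟩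

/-- Smooth functions of compact support are bounded with all derivatives. -/
theorem isCbInfty_of_hasCompactSupport (hf : ContDiff ℝ ∞ f) (hc : HasCompactSupport f) :
    IsCbInfty f := by
  refine ⟨hf, fun k => ?_⟩
  have hk : ((k : ℕ) : WithTop ℕ∞) ≤ ∞ := by exact_mod_cast le_top
  have h1 : Continuous (iteratedFDeriv ℝ k f) := hf.continuous_iteratedFDeriv hk
  obtain ⟨C, hC⟩ := h1.bounded_above_of_compact_support (hc.iteratedFDeriv k)
  exact ⟨C, hC⟩

theorem continuous_fderiv_of (hf : IsCbInfty f) : Continuous (fderiv ℝ f) :=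
  hf.1.continuous_fderiv (by simp)

variable {α : Type*} [MeasurableSpace α] {μ : Measure α}

theorem IsCbInfty.aestronglyMeasurable (hf : IsCbInfty f) {P : α → Fin N → ℝ}
    (hP : ∀ j, AEStronglyMeasurable (fun a => P a j) μ) :
    AEStronglyMeasurable (fun a => f (P a)) μ :=
  hf.1.continuous.comp_aestronglyMeasurable
    (aemeasurable_pi_lambda _ fun j => (hP j).aemeasurable).aestronglyMeasurable

theorem IsCbInfty.memLp_mul (hf : IsCbInfty f) {P : α → Fin N → ℝ}
    (hP : ∀ j, AEStronglyMeasurable (fun a => P a j) μ) {B : α → ℝ} (hB : MemLp B 2 μ) :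
    MemLp (fun a => f (P a) * B a) 2 μ := by
  obtain ⟨C, hC⟩ := hf.bounded
  exact MemLp.bdd_mul_two (hf.aestronglyMeasurable hP) (Eventually.of_forall fun a => hC _) hB

theorem IsCbInfty.memLp_fderiv (hf : IsCbInfty f) {P Q : α → Fin N → ℝ}
    (hP : ∀ j, AEStronglyMeasurable (fun a => P a j) μ) (hQ : ∀ j, MemLp (fun a => Q a j) 2 μ) :
    MemLp (fun a => fderiv ℝ f (P a) (Q a)) 2 μ := by
  classical
  obtain ⟨C, hC0, hC⟩ := hf.bounded_fderiv
  -- Expansion in the standard basis: bounded coefficients times square integrable functions.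
  have h1 : (fun a => fderiv ℝ f (P a) (Q a)) = fun a => ∑ j,
      fderiv ℝ f (P a) (fun k => if j = k then 1 else 0) * Q a j := by
    funext a
    have := LinearMap.pi_apply_eq_sum_univ (fderiv ℝ f (P a)).toLinearMap (Q a)
    simpa [mul_comm] using this
  rw [h1]
  refine memLp_finsetSum _ fun j _ => MemLp.bdd_mul_two (C := C) ?_ ?_ (hQ j)
  · exact ((continuous_fderiv_of hf).clm_apply continuous_const).comp_aestronglyMeasurable
      (aemeasurable_pi_lambda _ fun j => (hP j).aemeasurable).aestronglyMeasurable
  · refine Eventually.of_forall fun a => ?_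
    refine ((fderiv ℝ f (P a)).le_opNorm _).trans ?_
    refine (mul_le_of_le_one_right (norm_nonneg _) ?_).trans (hC _)
    refine (pi_norm_le_iff_of_nonneg zero_le_one).2 fun k => ?_
    split_ifs <;> simp

end CbInfty

/-! ### Cylinder functions and their directional derivatives -/

section cylinder

variable {d : ℕ} {X : Type*} [TopologicalSpace X] [ChartedSpace (Eu d) X]

/-- The restriction of coordinates along an index map. -/
def coordRestrict {N M : ℕ} (e : Fin N → Fin M) : (Fin M → ℝ) →L[ℝ] (Fin N → ℝ) :=
  ContinuousLinearMap.pi fun j => ContinuousLinearMap.proj (e j)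

/-- Concatenating the two lists of test functions reduces sums and products of cylinder functions to
those in `C_b^∞`. -/
theorem cylinder_pair {F G : Config X → ℝ} (hF : F ∈ cylinder d X) (hG : G ∈ cylinder d X) :
    ∃ (N : ℕ) (φ : Fin N → X × ℝ → ℝ) (f g : (Fin N → ℝ) → ℝ), (∀ j, IsTest d (φ j)) ∧
      IsCbInfty f ∧ IsCbInfty g ∧ (∀ η, F η = f (fun j => pairing (φ j) η)) ∧
      ∀ η, G η = g (fun j => pairing (φ j) η) := by
  obtain ⟨N, φ, f, hφ, hf, hFf⟩ := hF
  obtain ⟨M, γ, g, hγ, hg, hGg⟩ := hG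
  refine ⟨N + M, Fin.append φ γ, fun r => f (coordRestrict (Fin.castAdd M) r),
    fun r => g (coordRestrict (Fin.natAdd N) r), ?_, hf.comp_clm _, hg.comp_clm _, ?_, ?_⟩
  · intro j
    refine Fin.addCases (fun i => ?_) (fun i => ?_) j
    · rw [Fin.append_left]; exact hφ i
    · rw [Fin.append_right]; exact hγ i
  · intro η
    rw [hFf]
    refine congrArg f (funext fun j => ?_)
    simp [coordRestrict]
  · intro η
    rw [hGg]
    refine congrArg g (funext fun j => ?_)
    simp [coordRestrict]

theorem cylinder_add {F G : Config X → ℝ} (hF : F ∈ cylinder d X) (hG : G ∈ cylinder d X) :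
    (fun η => F η + G η) ∈ cylinder d X := by
  obtain ⟨N, φ, f, g, hφ, hf, hg, hFf, hGg⟩ := cylinder_pair hF hG
  exact ⟨N, φ, _, hφ, hf.add hg, fun η => by simp only [hFf, hGg]⟩

theorem cylinder_mul {F G : Config X → ℝ} (hF : F ∈ cylinder d X) (hG : G ∈ cylinder d X) :
    (fun η => F η * G η) ∈ cylinder d X := by
  obtain ⟨N, φ, f, g, hφ, hf, hg, hFf, hGg⟩ := cylinder_pair hF hG
  exact ⟨N, φ, _, hφ, hf.mul hg, fun η => by simp only [hFf, hGg]⟩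

theorem cylinder_const (c : ℝ) : (fun _ : Config X => c) ∈ cylinder d X :=
  ⟨0, fun _ _ => 0, _, fun j => j.elim0, isCbInfty_const c, fun _ => rfl⟩

variable [T2Space X] [IsManifold (𝓡 d) ∞ X]

theorem act_zero (A : LieAlg d X) (η : Config X) : act A 0 η = η := by
  refine Config.ext ?_
  change (fun z : X × ℝ => (flow A.v 0 z.1, Real.exp (0 * A.a (flow A.v 0 z.1)) * z.2)) ''
    η.carrier = η.carrier
  have : (fun z : X × ℝ => (flow A.v 0 z.1, Real.exp (0 * A.a (flow A.v 0 z.1)) * z.2)) = id := by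
    funext z
    rw [(hasDerivAt_chart_flow A z.1).2.2]
    simp
  rw [this, image_id]

/-- A compact set that contains the supports of a vector field and a function. -/
theorem LieAlg.exists_compact (A : LieAlg d X) :
    ∃ K : Set X, IsCompact K ∧ closure {x | A.v x ≠ 0} ⊆ K ∧ closure {x | A.a x ≠ 0} ⊆ K ∧
      ∀ x ∉ K, A.v x = 0 ∧ A.a x = 0 :=
  ⟨_, (isCompact_closure_v A).union (isCompact_closure_a A), subset_union_left,
    subset_union_right, fun _ hx => ⟨by_contra fun h => hx (Or.inl (subset_closure h)),
      by_contra fun h => hx (Or.inr (subset_closure h))⟩⟩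

theorem hasDerivAt_pairing_act {φ : X × ℝ → ℝ} (hφ : IsTest d φ) (A : LieAlg d X)
    (η : Config X) : HasDerivAt (fun t => pairing φ (act A t η))
      (pairing (dirDerivXR A.v A.a φ) η) 0 := by
  obtain ⟨K, hK, hK0⟩ := hφ.support
  obtain ⟨L, hL, -, -, hL0⟩ := A.exists_compact
  have hKL := hK.union hL
  -- One finite set of points serves for all `t`: a point outside `L` is fixed by the flow, and
  -- outside `K` it contributes nothing.
  have h1 : ∀ t, pairing φ (act A t η) = ∑ z ∈ η.points hKL,
      φ (flow A.v t z.1, Real.exp (t * A.a (flow A.v t z.1)) * z.2) := by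
    intro t
    have hinj : InjOn (fun z : X × ℝ =>
        (flow A.v t z.1, Real.exp (t * A.a (flow A.v t z.1)) * z.2)) η.carrier := by
      intro z hz z' hz' h
      by_contra hne
      exact η.inj z hz z' hz' hne (flow_injective A t (congrArg Prod.fst h))
    have h2 : pairing φ (act A t η) = pairing (fun z : X × ℝ =>
        φ (flow A.v t z.1, Real.exp (t * A.a (flow A.v t z.1)) * z.2)) η :=
      finsum_mem_image hinj
    rw [h2]
    refine pairing_eq_sum_points η hKL fun x hx s hs => ?_
    simp only
    rw [flow_of_eq_zero A (hL0 x fun h => hx (Or.inr h)).1]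
    exact hK0 x (fun h => hx (Or.inl h)) _ (mul_pos (Real.exp_pos _) hs)
  rw [pairing_eq_sum_points η hKL fun x hx s _ =>
    dirDerivXR_eq_zero φ (hL0 x fun h => hx (Or.inr h)).1 (hL0 x fun h => hx (Or.inr h)).2]
  rw [funext h1]
  exact HasDerivAt.fun_sum fun z hz => hφ.smoothXR.hasDerivAt_flow A
    (η.pos z (Config.mem_points.1 hz).1)

theorem hasDerivAt_cylinder {N : ℕ} {φ : Fin N → X × ℝ → ℝ} {f : (Fin N → ℝ) → ℝ}
    (hφ : ∀ j, IsTest d (φ j)) (hf : IsCbInfty f) (A : LieAlg d X) (η : Config X) :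
    HasDerivAt (fun t => f (fun j => pairing (φ j) (act A t η)))
      (fderiv ℝ f (fun j => pairing (φ j) η) (fun j => pairing (dirDerivXR A.v A.a (φ j)) η)) 0 := by
  have h1 : HasDerivAt (fun t => fun j => pairing (φ j) (act A t η))
      (fun j => pairing (dirDerivXR A.v A.a (φ j)) η) 0 :=
    hasDerivAt_pi.2 fun j => hasDerivAt_pairing_act (hφ j) A η
  have h2 : HasFDerivAt f (fderiv ℝ f (fun j => pairing (φ j) (act A 0 η)))
      (fun j => pairing (φ j) (act A 0 η)) :=
    (hf.1.differentiable (by simp)).differentiableAt.hasFDerivAt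
  have := h2.comp_hasDerivAt (0 : ℝ) h1
  rwa [act_zero] at this

theorem dirDeriv_cylinder {N : ℕ} {φ : Fin N → X × ℝ → ℝ} {f : (Fin N → ℝ) → ℝ}
    (hφ : ∀ j, IsTest d (φ j)) (hf : IsCbInfty f) (A : LieAlg d X) {F : Config X → ℝ}
    (hF : ∀ η, F η = f (fun j => pairing (φ j) η)) (η : Config X) :
    dirDeriv A F η =
      fderiv ℝ f (fun j => pairing (φ j) η) (fun j => pairing (dirDerivXR A.v A.a (φ j)) η) := by
  rw [dirDeriv, funext fun t => hF (act A t η)]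
  exact (hasDerivAt_cylinder hφ hf A η).deriv

theorem differentiableAt_cylinder {F : Config X → ℝ} (hF : F ∈ cylinder d X) (A : LieAlg d X)
    (η : Config X) : DifferentiableAt ℝ (fun t => F (act A t η)) 0 := by
  obtain ⟨N, φ, f, hφ, hf, hFf⟩ := hF
  simp only [hFf]
  exact (hasDerivAt_cylinder hφ hf A η).differentiableAt

theorem dirDeriv_mul {F G : Config X → ℝ} (hF : F ∈ cylinder d X) (hG : G ∈ cylinder d X)
    (A : LieAlg d X) (η : Config X) :
    dirDeriv A (fun η => F η * G η) η = dirDeriv A F η * G η + F η * dirDeriv A G η := by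
  have := deriv_fun_mul (differentiableAt_cylinder hF A η) (differentiableAt_cylinder hG A η)
  simp only [act_zero] at this
  exact this

end cylinder

/-! ### Integration by parts for the marked Poisson measure -/

section integrationByParts

variable {d : ℕ} {X : Type*} [TopologicalSpace X] [T2Space X] [Nonempty X]
  [SecondCountableTopology X] [ChartedSpace (Eu d) X] [IsManifold (𝓡 d) ∞ X] [MeasurableSpace X]
  [BorelSpace X] {g : RMetric d X} {ρ : X → ℝ} {p : X → ℝ → ℝ} {π : Measure (Config X)}

theorem IsAdmissible.exists_window (hadm : IsAdmissible g ρ p) {K : Set X} (hK : IsCompact K) :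
    ∃ Λ : Set X, IsOpen Λ ∧ IsCompact (closure Λ) ∧ K ⊆ Λ ∧
      levyMeasure g ρ p (Λ ×ˢ Ioi (0 : ℝ)) < ⊤ := by
  have : LocallyCompactSpace X := Manifold.locallyCompact_of_finiteDimensional (𝓡 d)
  obtain ⟨Λ, hΛ, hKΛ, hc⟩ := exists_isOpen_superset_and_isCompact_closure hK
  exact ⟨Λ, hΛ, hc, hKΛ, (measure_mono (prod_mono_left subset_closure)).trans_lt
    (hadm.levyMeasure_lt_top hc)⟩

/-- The pairing factors through the restriction to a window, whose law is a Poisson measure of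
finite intensity. -/
theorem memLp_pairing (hadm : IsAdmissible g ρ p) (hπ : IsMarkedPoisson (levyMeasure g ρ p) π)
    {b : X × ℝ → ℝ} (hb : MemLp b 2 (levyMeasure g ρ p)) {K : Set X} (hK : IsCompact K)
    (h0 : ∀ x ∉ K, ∀ s, 0 < s → b (x, s) = 0) : MemLp (pairing b) 2 π := by
  obtain ⟨Λ, hΛ, hc, hKΛ, hfin⟩ := hadm.exists_window hK
  have : IsFiniteMeasure ((levyMeasure g ρ p).restrict (Λ ×ˢ Ioi (0 : ℝ))) :=
    ⟨by rwa [Measure.restrict_apply_univ]⟩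
  have h := (memLp_pairing_finitePoisson (ae_restrict_of_ae ae_pos_levyMeasure)
    (hπ.ae_isSimple hΛ hc hfin) (hb.restrict _) hK h0).comp_measurePreserving
    (hπ.measurePreserving hΛ hc hfin)
  have he : pairing b ∘ restrictConfig Λ = pairing b := funext fun η =>
    pairing_restrictConfig η fun x hx => h0 x fun hxK => hx (hKΛ hxK)
  rwa [he] at h

theorem IsTest.memLp_levyMeasure (hadm : IsAdmissible g ρ p) {φ : X × ℝ → ℝ} (hφ : IsTest d φ) :
    MemLp φ 2 (levyMeasure g ρ p) := by
  obtain ⟨C, hC⟩ := hφ.bounded_val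
  obtain ⟨K, hK, hK0⟩ := hφ.support
  exact hadm.memLp_of_bounded ((aestronglyMeasurable_of_continuousOn g
    hφ.smoothXR.continuousOn).mono_ac levyMeasure_absolutelyContinuous) hK hC hK0

theorem IsTest.memLp_dirDerivXR (hadm : IsAdmissible g ρ p) {φ : X × ℝ → ℝ} (hφ : IsTest d φ)
    (A : LieAlg d X) : MemLp (dirDerivXR A.v A.a φ) 2 (levyMeasure g ρ p) := by
  obtain ⟨C, hC⟩ := hφ.bounded_dirDerivXR A
  obtain ⟨K, hK, -, -, hK0⟩ := A.exists_compact
  exact hadm.memLp_of_bounded ((aestronglyMeasurable_of_continuousOn g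
    (continuousOn_dirDerivXR hφ.smoothXR A.smooth_v A.smooth_a.continuous)).mono_ac
    levyMeasure_absolutelyContinuous) hK hC fun x hx s _ =>
    dirDerivXR_eq_zero φ (hK0 x hx).1 (hK0 x hx).2

theorem memLp_pairing_test (hadm : IsAdmissible g ρ p)
    (hπ : IsMarkedPoisson (levyMeasure g ρ p) π) {φ : X × ℝ → ℝ} (hφ : IsTest d φ) :
    MemLp (pairing φ) 2 π := by
  obtain ⟨K, hK, hK0⟩ := hφ.support
  exact memLp_pairing hadm hπ (hφ.memLp_levyMeasure hadm) hK hK0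

theorem memLp_pairing_dirDerivXR (hadm : IsAdmissible g ρ p)
    (hπ : IsMarkedPoisson (levyMeasure g ρ p) π) {φ : X × ℝ → ℝ} (hφ : IsTest d φ)
    (A : LieAlg d X) : MemLp (pairing (dirDerivXR A.v A.a φ)) 2 π := by
  obtain ⟨K, hK, -, -, hK0⟩ := A.exists_compact
  exact memLp_pairing hadm hπ (hφ.memLp_dirDerivXR hadm A) hK fun x hx s _ =>
    dirDerivXR_eq_zero φ (hK0 x hx).1 (hK0 x hx).2

theorem memLp_pairing_logDeriv (hadm : IsAdmissible g ρ p)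
    (hπ : IsMarkedPoisson (levyMeasure g ρ p) π) (A : LieAlg d X) {β : X × ℝ → ℝ}
    (hβ : IsLogDeriv g (fun z => ρ z.1 * p z.1 z.2) A β) : MemLp (pairing β) 2 π := by
  obtain ⟨h2, h0, -⟩ := logDeriv_props hadm A hβ
  obtain ⟨K, hK, hKv, hKa, -⟩ := A.exists_compact
  exact memLp_pairing hadm hπ h2 hK fun x hx s _ =>
    h0 (x, s) (fun h => hx (hKv h)) fun h => hx (hKa h)

theorem memLp_cylinder (hadm : IsAdmissible g ρ p) (hπ : IsMarkedPoisson (levyMeasure g ρ p) π)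
    {F : Config X → ℝ} (hF : F ∈ cylinder d X) {B : Config X → ℝ} (hB : MemLp B 2 π) :
    MemLp (fun η => F η * B η) 2 π := by
  obtain ⟨N, φ, f, hφ, hf, hFf⟩ := hF
  simp only [hFf]
  exact hf.memLp_mul (fun j => (memLp_pairing_test hadm hπ (hφ j)).1) hB

theorem memLp_dirDeriv (hadm : IsAdmissible g ρ p) (hπ : IsMarkedPoisson (levyMeasure g ρ p) π)
    (A : LieAlg d X) {F : Config X → ℝ} (hF : F ∈ cylinder d X) : MemLp (dirDeriv A F) 2 π := by
  obtain ⟨N, φ, f, hφ, hf, hFf⟩ := hF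
  rw [funext (dirDeriv_cylinder hφ hf A hFf)]
  exact hf.memLp_fderiv (fun j => (memLp_pairing_test hadm hπ (hφ j)).1)
    fun j => memLp_pairing_dirDerivXR hadm hπ (hφ j) A

theorem fderiv_apply_le {N : ℕ} {f : (Fin N → ℝ) → ℝ} {C : ℝ} (hC0 : 0 ≤ C)
    (hC : ∀ r, ‖fderiv ℝ f r‖ ≤ C) {w M : Fin N → ℝ} (hw : ∀ j, |w j| ≤ M j) (r : Fin N → ℝ) :
    |fderiv ℝ f r w| ≤ C * ∑ j, M j := by
  refine ((fderiv ℝ f r).le_opNorm w).trans ?_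
  have hM : ∀ j, 0 ≤ M j := fun j => (abs_nonneg _).trans (hw j)
  have h1 : ‖w‖ ≤ ∑ j, M j := (pi_norm_le_iff_of_nonneg (Finset.sum_nonneg fun j _ => hM j)).2
    fun j => (hw j).trans (Finset.single_le_sum (fun j _ => hM j) (Finset.mem_univ j))
  exact mul_le_mul (hC r) h1 (norm_nonneg _) hC0

/-- The one-particle formula for `z ↦ f (c + φ z)`. -/
theorem integral_oneParticle (hadm : IsAdmissible g ρ p) (A : LieAlg d X) {β : X × ℝ → ℝ}
    (hβ : IsLogDeriv g (fun z => ρ z.1 * p z.1 z.2) A β) {N : ℕ} {φ : Fin N → X × ℝ → ℝ}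
    {f : (Fin N → ℝ) → ℝ} (hφ : ∀ j, IsTest d (φ j)) (hf : IsCbInfty f) {Λ : Set X}
    (hvΛ : closure {x | A.v x ≠ 0} ⊆ Λ) (haΛ : closure {x | A.a x ≠ 0} ⊆ Λ) (c : Fin N → ℝ) :
    ∫ z, (fderiv ℝ f (fun j => c j + φ j z) (fun j => dirDerivXR A.v A.a (φ j) z) +
      f (fun j => c j + φ j z) * β z) ∂((levyMeasure g ρ p).restrict (Λ ×ˢ Ioi (0 : ℝ))) = 0 := by
  obtain ⟨-, hβ0, hI⟩ := logDeriv_props hadm A hβ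
  obtain ⟨C0, hC0⟩ := hf.bounded
  obtain ⟨C1, hC1, hfC1⟩ := hf.bounded_fderiv
  choose Mv hMv using fun j => (hφ j).bounded_field A
  choose Ma hMa using fun j => (hφ j).bounded_mark A
  have hs : ∀ j, SmoothXR d (φ j) := fun j => (hφ j).smoothXR
  have hψ := SmoothXR.comp hf.1 hs c
  set C := max C0 (max (C1 * ∑ j, Mv j) (C1 * ∑ j, Ma j)) with hC
  have h := hI hψ (C := C) (fun x s _ => (hC0 _).trans (le_max_left _ _))
    (fun x s hs' => by
      rw [dirDerivXR_comp hf.1 hs c _ _ (z := (x, s)) hs']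
      exact (fderiv_apply_le hC1 hfC1 (fun j => hMv j x s hs') _).trans
        ((le_max_left _ _).trans (le_max_right _ _)))
    (fun x s hs' => by
      rw [dirDerivXR_comp hf.1 hs c _ _ (z := (x, s)) hs']
      exact (fderiv_apply_le hC1 hfC1 (fun j => hMa j x s hs') _).trans
        ((le_max_right _ _).trans (le_max_right _ _)))
  -- Outside `Λ` the direction and `β` vanish, so the integral over the window is the integral over
  -- everything, where the one-particle identity holds.
  rw [setIntegral_eq_integral_of_ae_compl_eq_zero]
  · refine Eq.trans (integral_congr_ae ?_) h
    filter_upwards [ae_pos_levyMeasure (g := g) (ρ := ρ) (p := p)] with z hz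
    rw [dirDerivXR_comp hf.1 hs c _ _ hz]
  · filter_upwards [ae_pos_levyMeasure (g := g) (ρ := ρ) (p := p)] with z hz hzΛ
    have hz1 : z.1 ∉ Λ := fun h => hzΛ ⟨h, hz⟩
    have hv := fun h => hz1 (hvΛ h)
    have ha := fun h => hz1 (haΛ h)
    have hv0 : A.v z.1 = 0 := by_contra fun h => hv (subset_closure h)
    have ha0 : A.a z.1 = 0 := by_contra fun h => ha (subset_closure h)
    have : (fun j => dirDerivXR A.v A.a (φ j) z) = 0 :=
      funext fun j => dirDerivXR_eq_zero _ hv0 ha0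
    rw [this, map_zero, hβ0 z hv ha, mul_zero, add_zero]

/-- The derivative of `f` is linear in its direction, so the integrand splits into one term per
particle. The `i`-th term integrates to zero already over its own variable, with `c` the sum over
the other particles. -/
theorem integral_pi_logDeriv (hadm : IsAdmissible g ρ p) (A : LieAlg d X) {β : X × ℝ → ℝ}
    (hβ : IsLogDeriv g (fun z => ρ z.1 * p z.1 z.2) A β) {N : ℕ} {φ : Fin N → X × ℝ → ℝ}
    {f : (Fin N → ℝ) → ℝ} (hφ : ∀ j, IsTest d (φ j)) (hf : IsCbInfty f) {Λ : Set X}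
    (hfin : levyMeasure g ρ p (Λ ×ˢ Ioi (0 : ℝ)) < ⊤)
    (hvΛ : closure {x | A.v x ≠ 0} ⊆ Λ) (haΛ : closure {x | A.a x ≠ 0} ⊆ Λ) (n : ℕ) :
    ∫ ξ : Fin n → X × ℝ, (fderiv ℝ f (fun j => ∑ k, φ j (ξ k))
        (fun j => ∑ i, dirDerivXR A.v A.a (φ j) (ξ i)) +
      f (fun j => ∑ k, φ j (ξ k)) * ∑ i, β (ξ i))
      ∂(Measure.pi fun _ => (levyMeasure g ρ p).restrict (Λ ×ˢ Ioi (0 : ℝ))) = 0 := by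
  set ν := (levyMeasure g ρ p).restrict (Λ ×ˢ Ioi (0 : ℝ)) with hν
  have hfi : IsFiniteMeasure ν := ⟨by rwa [hν, Measure.restrict_apply_univ]⟩
  have hP : ∀ j, MemLp (fun ξ : Fin n → X × ℝ => ∑ k, φ j (ξ k)) 2 (Measure.pi fun _ => ν) :=
    fun j => memLp_finsetSum _ fun k _ => memLp_eval k (((hφ j).memLp_levyMeasure hadm).restrict _)
  have hexp : ∀ ξ : Fin n → X × ℝ, fderiv ℝ f (fun j => ∑ k, φ j (ξ k))
        (fun j => ∑ i, dirDerivXR A.v A.a (φ j) (ξ i)) +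
      f (fun j => ∑ k, φ j (ξ k)) * ∑ i, β (ξ i) =
      ∑ i, (fderiv ℝ f (fun j => ∑ k, φ j (ξ k)) (fun j => dirDerivXR A.v A.a (φ j) (ξ i)) +
        f (fun j => ∑ k, φ j (ξ k)) * β (ξ i)) := by
    intro ξ
    rw [Finset.sum_add_distrib, ← Finset.mul_sum, ← map_sum]
    congr 2
    funext j
    rw [Finset.sum_apply]
  simp only [hexp]
  have hTi : ∀ i : Fin n, Integrable (fun ξ : Fin n → X × ℝ =>
      fderiv ℝ f (fun j => ∑ k, φ j (ξ k)) (fun j => dirDerivXR A.v A.a (φ j) (ξ i)) +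
        f (fun j => ∑ k, φ j (ξ k)) * β (ξ i)) (Measure.pi fun _ => ν) := by
    intro i
    refine Integrable.add ?_ ?_
    · exact (hf.memLp_fderiv (fun j => (hP j).1) fun j =>
        memLp_eval i (((hφ j).memLp_dirDerivXR hadm A).restrict _)).integrable one_le_two
    · exact (hf.memLp_mul (fun j => (hP j).1)
        (memLp_eval i ((logDeriv_props hadm A hβ).1.restrict _))).integrable one_le_two
  rw [integral_finsetSum _ fun i _ => hTi i]
  refine Finset.sum_eq_zero fun i _ => ?_
  obtain _ | m := n
  · exact i.elim0
  refine integral_pi_eq_zero i (hTi i) fun ξ => ?_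
  simp only [Fin.insertNth_apply_same, Fin.sum_univ_succAbove _ i, Fin.insertNth_apply_succAbove]
  refine (integral_congr_ae (Eventually.of_forall fun z => ?_)).trans
    (integral_oneParticle hadm A hβ hφ hf hvΛ haΛ fun j => ∑ k, φ j (ξ k))
  simp only [add_comm (φ _ z)]

/-- The integral of a divergence vanishes. -/
theorem integral_dirDeriv_add (hadm : IsAdmissible g ρ p)
    (hπ : IsMarkedPoisson (levyMeasure g ρ p) π) (A : LieAlg d X) {β : X × ℝ → ℝ}
    (hβ : IsLogDeriv g (fun z => ρ z.1 * p z.1 z.2) A β) {F : Config X → ℝ}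
    (hF : F ∈ cylinder d X) : ∫ η, (dirDeriv A F η + F η * pairing β η) ∂π = 0 := by
  obtain ⟨N, φ, f, hφ, hf, hFf⟩ := hF
  obtain ⟨hβ2, hβ0, -⟩ := logDeriv_props hadm A hβ
  obtain ⟨L, hL, hLv, hLa, hL0⟩ := A.exists_compact
  choose K hK hK0 using fun j => (hφ j).support
  -- The window contains the supports of the direction and of all the test functions, so the whole
  -- integrand depends only on the restricted configuration.
  obtain ⟨Λ, hΛ, hc, hsub, hfin⟩ := hadm.exists_window (hL.union (isCompact_iUnion hK))
  have hLΛ : L ⊆ Λ := subset_union_left.trans hsub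
  have hKΛ : ∀ j, K j ⊆ Λ := fun j => (subset_iUnion K j).trans (subset_union_right.trans hsub)
  have hβ0' : ∀ x ∉ L, ∀ s, 0 < s → β (x, s) = 0 := fun x hx s _ =>
    hβ0 (x, s) (fun h => hx (hLv h)) fun h => hx (hLa h)
  have hD0 : ∀ j, ∀ x ∉ L, ∀ s, 0 < s → dirDerivXR A.v A.a (φ j) (x, s) = 0 := fun j x hx s _ =>
    dirDerivXR_eq_zero _ (hL0 x hx).1 (hL0 x hx).2
  set ν := (levyMeasure g ρ p).restrict (Λ ×ˢ Ioi (0 : ℝ)) with hν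
  have hfi : IsFiniteMeasure ν := ⟨by rwa [hν, Measure.restrict_apply_univ]⟩
  have hpos : ∀ᵐ z ∂ν, 0 < z.2 := ae_restrict_of_ae ae_pos_levyMeasure
  have hs := hπ.ae_isSimple hΛ hc hfin
  have hmp := hπ.measurePreserving hΛ hc hfin
  have hprob := hπ.isProbabilityMeasure
  set H : Config X → ℝ := fun η =>
    fderiv ℝ f (fun j => pairing (φ j) η) (fun j => pairing (dirDerivXR A.v A.a (φ j)) η) +
      f (fun j => pairing (φ j) η) * pairing β η with hH
  have hFH : ∀ η, dirDeriv A F η + F η * pairing β η = H (restrictConfig Λ η) := by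
    intro η
    rw [dirDeriv_cylinder hφ hf A hFf, hFf, hH]
    simp only
    rw [pairing_restrictConfig η fun x hx => hβ0' x fun h => hx (hLΛ h),
      funext fun j => pairing_restrictConfig (b := φ j) η fun x hx => hK0 j x fun h => hx (hKΛ j h),
      funext fun j => pairing_restrictConfig (b := dirDerivXR A.v A.a (φ j)) η fun x hx =>
        hD0 j x fun h => hx (hLΛ h)]
  simp only [hFH]
  have hfp : IsFiniteMeasure (finitePoisson ν) := by
    rw [← hmp.map_eq]; infer_instance
  have hPφ := fun j => memLp_pairing_finitePoisson hpos hs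
    (((hφ j).memLp_levyMeasure hadm).restrict _) (hK j) (hK0 j)
  have hPD := fun j => memLp_pairing_finitePoisson hpos hs
    (((hφ j).memLp_dirDerivXR hadm A).restrict _) hL (hD0 j)
  have hPβ := memLp_pairing_finitePoisson hpos hs (hβ2.restrict _) hL hβ0'
  have hHi : Integrable H (finitePoisson ν) :=
    ((hf.memLp_fderiv (fun j => (hPφ j).1) hPD).integrable one_le_two).add
      ((hf.memLp_mul (fun j => (hPφ j).1) hPβ).integrable one_le_two)
  have hHm : AEStronglyMeasurable H (Measure.map (restrictConfig Λ) π) := by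
    rw [hmp.map_eq]; exact hHi.1
  rw [← integral_map hmp.measurable.aemeasurable hHm, hmp.map_eq]
  refine integral_finitePoisson_eq_zero hHi fun n => ?_
  refine Eq.trans (integral_congr_ae ?_)
    (integral_pi_logDeriv hadm A hβ hφ hf hfin (hLv.trans hLΛ) (hLa.trans hLΛ) n)
  filter_upwards [hs n] with ξ hξ
  simp only [hH, pairing_ofPoints hξ]

/-- The vanishing of the integral of the divergence, applied to the cylinder function `F G`, and the
product rule; the integral may be split since each term is integrable. -/
theorem integration_by_parts (hadm : IsAdmissible g ρ p)
    (hπ : IsMarkedPoisson (levyMeasure g ρ p) π) (A : LieAlg d X) {β : X × ℝ → ℝ}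
    (hβ : IsLogDeriv g (fun z => ρ z.1 * p z.1 z.2) A β) {F G : Config X → ℝ}
    (hF : F ∈ cylinder d X) (hG : G ∈ cylinder d X) :
    ∫ η, dirDeriv A F η * G η ∂π =
      -(∫ η, F η * dirDeriv A G η ∂π) - ∫ η, F η * G η * pairing β η ∂π := by
  have hprob := hπ.isProbabilityMeasure
  have hB := memLp_pairing_logDeriv hadm hπ A hβ
  have i1 : Integrable (fun η => dirDeriv A F η * G η) π := by
    refine ((memLp_cylinder hadm hπ hG (memLp_dirDeriv hadm hπ A hF)).integrable one_le_two).congr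
      (Eventually.of_forall fun η => mul_comm _ _)
  have i2 : Integrable (fun η => F η * dirDeriv A G η) π :=
    (memLp_cylinder hadm hπ hF (memLp_dirDeriv hadm hπ A hG)).integrable one_le_two
  have i3 : Integrable (fun η => F η * G η * pairing β η) π :=
    (memLp_cylinder hadm hπ (cylinder_mul hF hG) hB).integrable one_le_two
  have h := integral_dirDeriv_add hadm hπ A hβ (cylinder_mul hF hG)
  simp only [dirDeriv_mul hF hG] at h
  have i12 : Integrable (fun η => dirDeriv A F η * G η + F η * dirDeriv A G η) π := i1.add i2
  rw [integral_add i12 i3, integral_add i1 i2] at h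
  linarith

end integrationByParts

/-! ### Rectangles, approximation of counts, and generators of the σ-algebra -/

section rectangles

variable {d : ℕ} {X : Type*} [TopologicalSpace X] [T2Space X]
  [SecondCountableTopology X] [ChartedSpace (Eu d) X] [IsManifold (𝓡 d) ∞ X]

/-- Products of compactly supported smooth functions are test functions. -/
theorem isTest_mul {χ : X → ℝ} (hχ : ContMDiff (𝓡 d) 𝓘(ℝ, ℝ) ∞ χ) {K : Set X}
    (hK : IsCompact K) (hχ0 : ∀ x ∉ K, χ x = 0) {b : ℝ → ℝ} (hb : ContDiff ℝ ∞ b)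
    (hbc : HasCompactSupport b) : IsTest d (fun z : X × ℝ => χ z.1 * b z.2) := by
  obtain ⟨R, hR0, hR⟩ : ∃ R : ℝ, 0 < R ∧ ∀ s ∈ tsupport b, ‖s‖ ≤ R := by
    obtain ⟨R, hR⟩ := hbc.isCompact.isBounded.exists_norm_le
    exact ⟨max R 1, lt_max_of_lt_right one_pos, fun s hs => (hR s hs).trans (le_max_left _ _)⟩
  have hinf : ∀ k : ℕ, ((k : ℕ) : WithTop ℕ∞) ≤ ∞ := fun k => by exact_mod_cast le_top
  refine ⟨?_, ⟨K, hK, fun x hx s _ => by simp only [hχ0 x hx, zero_mul]⟩, ?_, ?_⟩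
  · have h1 : ContMDiff ((𝓡 d).prod 𝓘(ℝ, ℝ)) 𝓘(ℝ, ℝ) ∞ (fun z : X × ℝ => χ z.1) :=
      hχ.comp contMDiff_fst
    have h2 : ContMDiff ((𝓡 d).prod 𝓘(ℝ, ℝ)) 𝓘(ℝ, ℝ) ∞ (fun z : X × ℝ => b z.2) :=
      hb.contMDiff.comp contMDiff_snd
    exact (h1.mul h2).contMDiffOn
  · intro x₀ L hL hLt k
    set Φ : Eu d × ℝ → ℝ := fun z => χ ((extChartAt (𝓡 d) x₀).symm z.1) * b z.2 with hΦ
    set W : Set (Eu d × ℝ) := (extChartAt (𝓡 d) x₀).target ×ˢ univ with hW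
    have hWo : IsOpen W := (isOpen_extChartAt_target x₀).prod isOpen_univ
    have hΦs : ContDiffOn ℝ ∞ Φ W := by
      have h1 : ContDiffOn ℝ ∞ (fun y => χ ((extChartAt (𝓡 d) x₀).symm y))
          (extChartAt (𝓡 d) x₀).target := by
        rw [← contMDiffOn_iff_contDiffOn]
        exact hχ.comp_contMDiffOn (contMDiffOn_extChartAt_symm x₀)
      exact (h1.comp contDiff_fst.contDiffOn fun z hz => hz.1).mul
        (hb.comp contDiff_snd).contDiffOn
    have hcont : ContinuousOn (iteratedFDeriv ℝ k Φ) W :=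
      ContinuousOn.continuousOn_iteratedFDeriv hΦs hWo (hinf k)
    obtain ⟨C, hC⟩ := (hL.prod (isCompact_Icc (a := -R) (b := R))).exists_bound_of_continuousOn
      (hcont.mono (prod_mono hLt (subset_univ _)))
    refine ⟨max C 0, fun y hy s _ => ?_⟩
    by_cases hs : s ∈ Icc (-R) R
    · exact (hC (y, s) ⟨hy, hs⟩).trans (le_max_left _ _)
    · have hz : Φ =ᶠ[𝓝 (y, s)] fun _ => 0 := by
        have hsn : s ∉ tsupport b := fun h => hs (abs_le.1 (hR s h))
        have h1 : ∀ᶠ z : Eu d × ℝ in 𝓝 (y, s), b z.2 = 0 :=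
          continuous_snd.continuousAt.eventually
            (notMem_tsupport_iff_eventuallyEq.1 hsn)
        filter_upwards [h1] with z hz
        simp only [hΦ, hz, mul_zero]
      have h2 := (hz.iteratedFDeriv ℝ k).eq_of_nhds
      rw [h2]
      have : iteratedFDeriv ℝ k (fun _ : Eu d × ℝ => (0 : ℝ)) = 0 := iteratedFDeriv_fun_zero
      rw [this]
      simp
  · intro n
    obtain ⟨M, hM⟩ := hK.exists_bound_of_continuousOn hχ.continuous.continuousOn
    have hM' : ∀ x, |χ x| ≤ max M 0 := fun x => by
      by_cases hx : x ∈ K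
      · exact (hM x hx).trans (le_max_left _ _)
      · rw [hχ0 x hx]; simp
    obtain ⟨D, hD'⟩ := (hb.continuous_iteratedFDeriv (hinf n)).bounded_above_of_compact_support
      (hbc.iteratedFDeriv n)
    have hD : ∀ s, ‖iteratedDeriv n b s‖ ≤ D := fun s => by
      rw [← norm_iteratedFDeriv_eq_norm_iteratedDeriv]
      exact hD' s
    have hD0 : 0 ≤ D := (norm_nonneg _).trans (hD 0)
    -- For `s ≤ R` the last factor outweighs the prescribed decay; beyond `R` the function `b`
    -- vanishes.
    refine ⟨max M 0 * D * (max 1 R) ^ n, fun x s hs => ?_⟩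
    have hd : iteratedDeriv n (fun r => χ x * b r) s = χ x * iteratedDeriv n b s :=
      iteratedDeriv_const_mul_field (χ x) b
    simp only
    rw [hd, abs_mul]
    by_cases hsR : s ≤ R
    · have h1 : 1 ≤ (max 1 R) ^ n * ((max 1 s) ^ n)⁻¹ := by
        have hp : 0 < (max 1 s) ^ n := by positivity
        rw [← div_eq_mul_inv, one_le_div hp]
        gcongr
      calc |χ x| * |iteratedDeriv n b s| ≤ max M 0 * D :=
            mul_le_mul (hM' x) (hD s) (abs_nonneg _) (le_max_right _ _)
        _ ≤ max M 0 * D * ((max 1 R) ^ n * ((max 1 s) ^ n)⁻¹) :=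
            le_mul_of_one_le_right (by positivity) h1
        _ = _ := by ring
    · have hsn : s ∉ tsupport b := fun h => hsR ((le_abs_self s).trans (hR s h))
      have h0 : iteratedDeriv n b s = 0 := by
        have := ((notMem_tsupport_iff_eventuallyEq.1 hsn).iteratedDeriv n).eq_of_nhds
        rw [this]
        have hz : iteratedDeriv n (0 : ℝ → ℝ) = 0 := by
          funext y
          simp
        rw [hz]; rfl
      rw [h0, abs_zero, mul_zero]
      positivity

/-- The indicator function of an open set is a limit of smooth functions. -/
theorem exists_smooth_approx {U : Set X} (hU : IsOpen U) :
    ∃ χ : ℕ → X → ℝ, (∀ n, ContMDiff (𝓡 d) 𝓘(ℝ, ℝ) ∞ (χ n)) ∧ (∀ n, ∀ x ∉ U, χ n x = 0) ∧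
      ∀ x, Tendsto (fun n => χ n x) atTop (𝓝 (U.indicator (fun _ => 1) x)) := by
  have : LocallyCompactSpace X := Manifold.locallyCompact_of_finiteDimensional (𝓡 d)
  obtain ⟨f, hfs, hf, hf0⟩ := hU.exists_contMDiff_support_eq (𝓡 d) (n := ⊤)
  have hz : ∀ x ∉ U, f x = 0 := fun x hx => by
    rw [← hfs] at hx
    exact Function.notMem_support.1 hx
  -- Here `f` is positive exactly on `U`, and the transition function equals `1` as soon as `n * f x
  -- ≥ 1`.
  refine ⟨fun n x => Real.smoothTransition (n * f x), fun n => ?_, fun n x hx => ?_, fun x => ?_⟩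
  · exact (Real.smoothTransition.contDiff (n := ⊤)).contMDiff.comp
      (contMDiff_const.mul (hf.of_le (by simp)))
  · simp only [hz x hx, mul_zero, Real.smoothTransition.zero]
  · by_cases hx : x ∈ U
    · rw [indicator_of_mem hx]
      have hpos : 0 < f x := lt_of_le_of_ne (hf0 x) fun h => by
        rw [← hfs] at hx; exact hx h.symm
      refine tendsto_const_nhds.congr' ?_
      obtain ⟨m, hm⟩ := exists_nat_ge (1 / f x)
      filter_upwards [eventually_ge_atTop m] with n hn
      refine (Real.smoothTransition.one_of_one_le ?_).symm
      rw [div_le_iff₀ hpos] at hm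
      exact hm.trans (mul_le_mul_of_nonneg_right (by exact_mod_cast hn) hpos.le)
    · rw [indicator_of_notMem hx]
      refine tendsto_const_nhds.congr fun n => ?_
      simp only
      rw [hz x hx, mul_zero, Real.smoothTransition.zero]

/-- As on the manifold; the factors `B n`, equal to `1` on balls of growing radius, supply compact
support without changing the pointwise limit. -/
theorem exists_smooth_approx_real {V : Set ℝ} (hV : IsOpen V) :
    ∃ b : ℕ → ℝ → ℝ, (∀ n, ContDiff ℝ ∞ (b n)) ∧ (∀ n, HasCompactSupport (b n)) ∧
      ∀ s, Tendsto (fun n => b n s) atTop (𝓝 (V.indicator (fun _ => 1) s)) := by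
  obtain ⟨f, hfs, hf, hf0⟩ := hV.exists_contDiff_support_eq (n := ⊤)
  have hz : ∀ x ∉ V, f x = 0 := fun x hx => by
    rw [← hfs] at hx
    exact Function.notMem_support.1 hx
  let B : ∀ n : ℕ, ContDiffBump (0 : ℝ) := fun n =>
    ⟨n + 1, n + 2, by positivity, by linarith⟩
  refine ⟨fun n s => Real.smoothTransition (n * f s) * B n s, fun n => ?_, fun n => ?_, fun s => ?_⟩
  · exact ((Real.smoothTransition.contDiff (n := ⊤)).comp (contDiff_const.mul hf)).mul
      (B n).contDiff
  · exact (B n).hasCompactSupport.mul_left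
  · obtain ⟨m', hm'⟩ := exists_nat_ge |s|
    have hB : ∀ n ≥ m', B n s = 1 := fun n hn => by
      refine (B n).one_of_mem_closedBall ?_
      rw [mem_closedBall_zero_iff]
      have : (m' : ℝ) ≤ n := by exact_mod_cast hn
      change |s| ≤ (n : ℝ) + 1
      linarith
    refine tendsto_const_nhds.congr' ?_
    by_cases hx : s ∈ V
    · rw [indicator_of_mem hx]
      have hpos : 0 < f s := lt_of_le_of_ne (hf0 (mem_range_self s)).1 fun h => by
        rw [← hfs] at hx; exact hx h.symm
      obtain ⟨m, hm⟩ := exists_nat_ge (1 / f s)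
      filter_upwards [eventually_ge_atTop m, eventually_ge_atTop m'] with n hn hn'
      rw [hB n hn', mul_one]
      refine (Real.smoothTransition.one_of_one_le ?_).symm
      rw [div_le_iff₀ hpos] at hm
      exact hm.trans (mul_le_mul_of_nonneg_right (by exact_mod_cast hn) hpos.le)
    · rw [indicator_of_notMem hx]
      filter_upwards with n
      rw [hz s hx, mul_zero, Real.smoothTransition.zero, zero_mul]

/-- The rectangles `U × V` with `U` open and relatively compact and `V ⊆ ℝ₊` open. -/
def rectangles (X : Type*) [TopologicalSpace X] : Set (Set (X × ℝ)) :=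
  {R | ∃ (U : Set X) (V : Set ℝ), IsOpen U ∧ IsCompact (closure U) ∧ IsOpen V ∧ V ⊆ Ioi 0 ∧
    R = U ×ˢ V}

/-- Only finitely many points of a configuration lie over the closure of `U`, so pointwise
convergence of the smooth products to the indicator suffices. -/
theorem exists_test_approx {R : Set (X × ℝ)} (hR : R ∈ rectangles X) :
    ∃ φ : ℕ → X × ℝ → ℝ, (∀ n, IsTest d (φ n)) ∧
      ∀ η : Config X, Tendsto (fun n => pairing (φ n) η) atTop (𝓝 (count R η)) := by
  obtain ⟨U, V, hU, hUc, hV, hV0, rfl⟩ := hR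
  obtain ⟨χ, hχ, hχ0, hχ1⟩ := exists_smooth_approx (d := d) hU
  obtain ⟨b, hb, hbc, hb1⟩ := exists_smooth_approx_real hV
  have h0 : ∀ n, ∀ x ∉ closure U, χ n x = 0 := fun n x hx => hχ0 n x fun h => hx (subset_closure h)
  refine ⟨fun n z => χ n z.1 * b n z.2, fun n => isTest_mul (hχ n) hUc (h0 n) (hb n) (hbc n),
    fun η => ?_⟩
  have hsub : U ×ˢ V ⊆ closure U ×ˢ univ := prod_mono subset_closure (subset_univ _)
  rw [← pairing_indicator_one η hUc hsub, pairing_eq_sum_points η hUc fun x hx s _ =>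
    indicator_of_notMem (fun h => hx (subset_closure h.1)) _]
  have hpt : ∀ n, pairing (fun z : X × ℝ => χ n z.1 * b n z.2) η =
      ∑ z ∈ η.points hUc, χ n z.1 * b n z.2 := fun n =>
    pairing_eq_sum_points η hUc fun x hx s _ => by simp only [h0 n x hx, zero_mul]
  simp only [hpt]
  refine tendsto_finsetSum _ fun z _ => ?_
  have : (U ×ˢ V).indicator (fun _ => (1 : ℝ)) z =
      U.indicator (fun _ => 1) z.1 * V.indicator (fun _ => 1) z.2 := by
    by_cases h1 : z.1 ∈ U <;> by_cases h2 : z.2 ∈ V <;> simp [indicator, h1, h2]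
  rw [this]
  exact (hχ1 z.1).mul (hb1 z.2)

variable [MeasurableSpace X] [BorelSpace X]

/-- The sets `{η | #(η ∩ R_j) = k_j for all j}`. -/
def countEvents (X : Type*) [TopologicalSpace X] : Set (Set (Config X)) :=
  {S | ∃ (N : ℕ) (R : Fin N → Set (X × ℝ)) (k : Fin N → ℕ), (∀ j, R j ∈ rectangles X) ∧
    S = {η | ∀ j, count (R j) η = k j}}

theorem rectangles_subset_borelC {R : Set (X × ℝ)} (hR : R ∈ rectangles X) : R ∈ BorelC X := by
  obtain ⟨U, V, hU, hUc, hV, hV0, rfl⟩ := hR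
  exact ⟨hU.measurableSet.prod hV.measurableSet, _, hUc, prod_mono subset_closure hV0⟩

theorem isPiSystem_countEvents : IsPiSystem (countEvents X) := by
  rintro _ ⟨N, R, k, hR, rfl⟩ _ ⟨M, R', k', hR', rfl⟩ -
  refine ⟨N + M, Fin.append R R', Fin.append k k', fun j => ?_, ?_⟩
  · refine Fin.addCases (fun i => ?_) (fun i => ?_) j
    · rw [Fin.append_left]; exact hR i
    · rw [Fin.append_right]; exact hR' i
  · ext η
    simp only [mem_inter_iff, mem_ofPred_eq]
    refine ⟨fun h j => ?_, fun h => ⟨fun i => ?_, fun i => ?_⟩⟩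
    · refine Fin.addCases (fun i => ?_) (fun i => ?_) j
      · rw [Fin.append_left, Fin.append_left]; exact h.1 i
      · rw [Fin.append_right, Fin.append_right]; exact h.2 i
    · simpa using h (Fin.castAdd M i)
    · simpa using h (Fin.natAdd N i)

theorem measurable_count_of_rectangle (m : MeasurableSpace (Config X))
    (hm : MeasurableSpace.generateFrom (countEvents X) ≤ m) {R : Set (X × ℝ)}
    (hR : R ∈ rectangles X) : Measurable[m] (count R) := by
  refine measurable_to_countable' fun k => hm _ (MeasurableSpace.measurableSet_generateFrom ?_)
  refine ⟨1, fun _ => R, fun _ => k, fun _ => hR, ?_⟩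
  ext η
  simp

/-- The counts of rectangles generate the σ-algebra. -/
theorem generateFrom_countEvents [LocallyCompactSpace X] :
    instMeasurableSpaceConfig X = MeasurableSpace.generateFrom (countEvents X) := by
  refine le_antisymm ?_ ?_
  · refine iSup₂_le fun B hB => ?_
    obtain ⟨hBm, K, hK, hBK⟩ := hB
    obtain ⟨Λ, hΛ, hKΛ, hc⟩ := exists_isOpen_superset_and_isCompact_closure hK
    set m := MeasurableSpace.generateFrom (countEvents X) with hm
    -- The points over `Λ` as a finite measure. Its values on open rectangles are counts of
    -- rectangles, hence `m`-measurable; open rectangles are a π-system generating the Borel sets,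
    -- so its value on every Borel set, in particular on `B`, is `m`-measurable.
    let κ : Config X → Measure (X × ℝ) := fun η =>
      (η.toMeasure hc).restrict (Λ ×ˢ univ)
    have hfin : ∀ η, IsFiniteMeasure (κ η) := fun η => by
      have : IsFiniteMeasure (η.toMeasure hc) := by
        refine ⟨?_⟩
        rw [Config.toMeasure, Measure.finsetSum_apply]
        exact ENNReal.sum_lt_top.2 fun z _ => measure_lt_top _ _
      infer_instance
    have hκ : ∀ η, ∀ D : Set (X × ℝ), MeasurableSet D →
        κ η D = (count (D ∩ Λ ×ˢ Ioi (0 : ℝ)) η : ENNReal) := by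
      intro η D hD
      classical
      have hDm : MeasurableSet (D ∩ Λ ×ˢ univ) :=
        hD.inter (hΛ.measurableSet.prod MeasurableSet.univ)
      have hset : η.carrier ∩ (D ∩ Λ ×ˢ Ioi (0 : ℝ)) =
          ((η.points hc).filter (· ∈ D ∩ Λ ×ˢ univ) : Finset _) := by
        ext z
        simp only [mem_inter_iff, mem_prod, mem_Ioi, Finset.coe_filter, Config.mem_points,
          mem_ofPred_eq, mem_univ, and_true]
        exact ⟨fun h => ⟨⟨h.1, subset_closure h.2.2.1⟩, h.2.1, h.2.2.1⟩,
          fun h => ⟨h.1.1, h.2.1, h.2.2, η.pos z h.1.1⟩⟩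
      rw [Measure.restrict_apply hD, count, hset, ncard_coe_finset, Config.toMeasure,
        Measure.finsetSum_apply]
      simp only [Measure.dirac_apply' _ hDm, indicator_apply, Pi.one_apply]
      rw [Finset.sum_boole]
    have hrect : ∀ U : Set X, ∀ V : Set ℝ, IsOpen U → IsOpen V →
        Measurable[m] fun η => κ η (U ×ˢ V) := by
      intro U V hU hV
      have h1 : (U ×ˢ V) ∩ Λ ×ˢ Ioi (0 : ℝ) ∈ rectangles X :=
        ⟨U ∩ Λ, V ∩ Ioi 0, hU.inter hΛ, hc.of_isClosed_subset isClosed_closure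
          (closure_mono inter_subset_right), hV.inter isOpen_Ioi, inter_subset_right,
          prod_inter_prod⟩
      have h2 := measurable_count_of_rectangle m le_rfl h1
      simp only [hκ _ _ (hU.measurableSet.prod hV.measurableSet)]
      exact (measurable_from_top (f := fun n : ℕ => (n : ENNReal))).comp h2
    have hκm : Measurable[m] κ := by
      have hC : IsCountablySpanning {s : Set X | IsOpen s} :=
        ⟨fun _ => univ, fun _ => by simp, iUnion_const _⟩
      have hD : IsCountablySpanning {s : Set ℝ | IsOpen s} :=
        ⟨fun _ => univ, fun _ => by simp, iUnion_const _⟩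
      refine @Measurable.measure_of_isPiSystem _ _ m _ κ hfin _
        (generateFrom_eq_prod (BorelSpace.measurable_eq (α := X)).symm
          (BorelSpace.measurable_eq (α := ℝ)).symm hC hD).symm
        (isPiSystem_isOpen.prod isPiSystem_isOpen) ?_ ?_
      · rintro _ ⟨U, hU, V, hV, rfl⟩
        exact hrect U V hU hV
      · rw [← univ_prod_univ]
        exact hrect univ univ isOpen_univ isOpen_univ
    have h3 : Measurable[m] fun η => (count B η : ENNReal) := by
      have h4 : Measurable[m] fun η => κ η B := (Measure.measurable_coe hBm).comp hκm
      have hBi : B ∩ Λ ×ˢ Ioi (0 : ℝ) = B :=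
        inter_eq_left.2 (hBK.trans (prod_mono_left hKΛ))
      simpa only [hκ _ B hBm, hBi] using h4
    have h5 : Measurable[m] (count B) := by
      have h6 : Measurable[m] fun η => (count B η : ℝ) := by
        simpa using h3.ennreal_toReal
      have h7 := Nat.measurable_floor.comp h6
      simpa [Function.comp_def] using h7
    exact h5.comap_le
  · refine MeasurableSpace.generateFrom_le ?_
    rintro _ ⟨N, R, k, hR, rfl⟩
    have : {η : Config X | ∀ j, count (R j) η = k j} =
        ⋂ j, count (R j) ⁻¹' {k j} := by ext; simp
    rw [this]
    exact MeasurableSet.iInter fun j =>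
      measurable_count (rectangles_subset_borelC (hR j)) (measurableSet_singleton _)

end rectangles

/-! ### Cylinder functions separate integrable functions -/

section density

variable {d : ℕ} {X : Type*} [TopologicalSpace X] [T2Space X] [Nonempty X]
  [SecondCountableTopology X] [ChartedSpace (Eu d) X] [IsManifold (𝓡 d) ∞ X] [MeasurableSpace X]
  [BorelSpace X] {π : Measure (Config X)}

/-- A smooth function on `ℝ^N` that is the indicator function of `k` on the integer points. -/
theorem exists_isCbInfty_indicator {N : ℕ} (k : Fin N → ℕ) : ∃ f : (Fin N → ℝ) → ℝ, IsCbInfty f ∧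
    ∀ l : Fin N → ℕ, f (fun j => l j) = if l = k then 1 else 0 := by
  -- Distinct integer points have sup-distance at least `1`, the outer radius, so the bump vanishes
  -- at all of them except `k`.
  let B : ContDiffBump (fun j => (k j : ℝ)) := ⟨1 / 2, 1, by norm_num, by norm_num⟩
  refine ⟨B, isCbInfty_of_hasCompactSupport B.contDiff B.hasCompactSupport, fun l => ?_⟩
  split_ifs with h
  · rw [h]
    exact B.one_of_mem_closedBall (Metric.mem_closedBall_self (by norm_num))
  · refine B.zero_of_le_dist ?_
    obtain ⟨j, hj⟩ := Function.ne_iff.1 h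
    refine le_trans ?_ (dist_le_pi_dist _ _ j)
    rw [Nat.dist_cast_real]
    exact Nat.pairwise_one_le_dist hj

/-- With `f` the smooth indicator of `k`, the cylinder functions obtained from test functions
approximating the counts converge boundedly to the indicator of the event; dominated convergence
carries the orthogonality over. -/
theorem setIntegral_countEvents (hm : ∀ F ∈ cylinder d X, AEStronglyMeasurable F π)
    {u : Config X → ℝ} (hu : Integrable u π)
    (h : ∀ F ∈ cylinder d X, ∫ η, F η * u η ∂π = 0) {S : Set (Config X)}
    (hS : S ∈ countEvents X) : ∫ η in S, u η ∂π = 0 := by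
  classical
  have hSm : MeasurableSet S := by
    obtain ⟨N, R, k, hR, rfl⟩ := hS
    have : {η : Config X | ∀ j, count (R j) η = k j} =
        ⋂ j, count (R j) ⁻¹' {k j} := by ext; simp
    rw [this]
    exact MeasurableSet.iInter fun j =>
      measurable_count (rectangles_subset_borelC (hR j)) (measurableSet_singleton _)
  obtain ⟨N, R, k, hR, rfl⟩ := hS
  obtain ⟨f, hf, hfk⟩ := exists_isCbInfty_indicator k
  choose φ hφ hφt using fun j => exists_test_approx (d := d) (hR j)
  obtain ⟨C, hC⟩ := hf.bounded
  have hF : ∀ n, (fun η : Config X => f fun j => pairing (φ j n) η) ∈ cylinder d X := fun n =>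
    ⟨N, fun j => φ j n, f, fun j => hφ j n, hf, fun _ => rfl⟩
  have hlim := tendsto_integral_of_dominated_convergence (μ := π)
    (F := fun n η => (f fun j => pairing (φ j n) η) * u η)
    (f := fun η => (f fun j => (count (R j) η : ℝ)) * u η) (fun η => C * |u η|)
    (fun n => (hm _ (hF n)).mul hu.1) (hu.abs.const_mul C)
    (fun n => Eventually.of_forall fun η => by
      rw [norm_mul]
      exact mul_le_mul_of_nonneg_right (hC _) (norm_nonneg _))
    (Eventually.of_forall fun η => ((hf.1.continuous.tendsto _).comp
      (tendsto_pi_nhds.2 fun j => hφt j η)).mul_const _)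
  simp only [fun n => h _ (hF n)] at hlim
  rw [← integral_indicator hSm, ← tendsto_nhds_unique hlim tendsto_const_nhds]
  refine integral_congr_ae (Eventually.of_forall fun η => ?_)
  simp only [hfk, indicator_apply, mem_ofPred_eq, funext_iff]
  split_ifs <;> simp

/-- The smooth cylinder functions separate the integrable functions. -/
theorem ae_eq_zero_of_integral_cylinder (hm : ∀ F ∈ cylinder d X, AEStronglyMeasurable F π)
    {u : Config X → ℝ} (hu : Integrable u π)
    (h : ∀ F ∈ cylinder d X, ∫ η, F η * u η ∂π = 0) : u =ᵐ[π] 0 := by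
  have : LocallyCompactSpace X := Manifold.locallyCompact_of_finiteDimensional (𝓡 d)
  have hall : ∀ S : Set (Config X), MeasurableSet S → ∫ η in S, u η ∂π = 0 := by
    intro S hS
    have huniv : ∫ η, u η ∂π = 0 := by simpa using h _ (cylinder_const 1)
    have hgen : instMeasurableSpaceConfig X = MeasurableSpace.generateFrom (countEvents X) :=
      generateFrom_countEvents
    have hpi : IsPiSystem (countEvents X) := isPiSystem_countEvents
    induction S, hS using MeasurableSpace.induction_on_inter hgen hpi with
    | empty => simp
    | basic S hS => exact setIntegral_countEvents hm hu h hS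
    | compl S hS ih =>
      have := integral_add_compl hS hu
      rw [ih, huniv, zero_add] at this
      exact this
    | iUnion f hd hf ih =>
      rw [integral_iUnion hf hd hu.integrableOn]
      simp [ih]
  exact hu.ae_eq_zero_of_forall_setIntegral_eq_zero fun S hS _ => hall S hS

end density

/-! ### The directional derivative as an operator and its adjoint -/

section operator

variable {d : ℕ} {X : Type*} [TopologicalSpace X] [T2Space X] [Nonempty X]
  [SecondCountableTopology X] [ChartedSpace (Eu d) X] [IsManifold (𝓡 d) ∞ X] [MeasurableSpace X]
  [BorelSpace X] {g : RMetric d X} {ρ : X → ℝ} {p : X → ℝ → ℝ} {π : Measure (Config X)}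

theorem memLp_of_mem_cylinder (hadm : IsAdmissible g ρ p)
    (hπ : IsMarkedPoisson (levyMeasure g ρ p) π) {F : Config X → ℝ} (hF : F ∈ cylinder d X) :
    MemLp F 2 π := by
  have := hπ.isProbabilityMeasure
  simpa using memLp_cylinder hadm hπ hF (memLp_const (1 : ℝ))

theorem inner_Lp_eq (u w : Lp ℝ 2 π) : inner ℝ u w = ∫ η, u η * w η ∂π := by
  rw [L2.inner_def]
  exact integral_congr_ae (Eventually.of_forall fun η => by simp [mul_comm])

theorem inner_toLp_eq {F G : Config X → ℝ} (hF : MemLp F 2 π) (hG : MemLp G 2 π) :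
    inner ℝ (hF.toLp F) (hG.toLp G) = ∫ η, F η * G η ∂π := by
  rw [inner_Lp_eq]
  refine integral_congr_ae ?_
  filter_upwards [hF.coeFn_toLp, hG.coeFn_toLp] with η h1 h2
  rw [h1, h2]

/-- The classes of the smooth cylinder functions. -/
def cylinderSubmodule (d : ℕ) {X : Type*} [TopologicalSpace X] [ChartedSpace (Eu d) X]
    [MeasurableSpace X] (π : Measure (Config X)) : Submodule ℝ (Lp ℝ 2 π) where
  carrier := {u | ∃ F ∈ cylinder d X, u =ᵐ[π] F}
  add_mem' := by
    rintro u w ⟨F, hF, hu⟩ ⟨G, hG, hw⟩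
    exact ⟨_, cylinder_add hF hG, (Lp.coeFn_add u w).trans (hu.add hw)⟩
  zero_mem' := ⟨_, cylinder_const 0, Lp.coeFn_zero _ _ _⟩
  smul_mem' := by
    rintro c u ⟨F, hF, hu⟩
    refine ⟨_, cylinder_mul (cylinder_const c) hF, (Lp.coeFn_smul c u).trans ?_⟩
    filter_upwards [hu] with η h
    simp [h]

theorem eq_zero_of_inner (hadm : IsAdmissible g ρ p)
    (hπ : IsMarkedPoisson (levyMeasure g ρ p) π) {w : Lp ℝ 2 π}
    (h : ∀ F (hF : F ∈ cylinder d X),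
      inner ℝ w ((memLp_of_mem_cylinder hadm hπ hF).toLp F) = 0) : w = 0 := by
  have := hπ.isProbabilityMeasure
  refine (Lp.eq_zero_iff_ae_eq_zero).2 ?_
  refine ae_eq_zero_of_integral_cylinder (d := d)
    (fun F hF => (memLp_of_mem_cylinder hadm hπ hF).1)
    ((Lp.memLp w).integrable one_le_two) fun F hF => ?_
  rw [← h F hF, inner_Lp_eq]
  refine integral_congr_ae ?_
  filter_upwards [(memLp_of_mem_cylinder hadm hπ hF).coeFn_toLp] with η h1
  rw [h1, mul_comm]

theorem toLp_eq_of_ae {F : Config X → ℝ} (hF : MemLp F 2 π) {u : Lp ℝ 2 π} (hu : u =ᵐ[π] F) :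
    hF.toLp F = u :=
  Lp.ext (hF.coeFn_toLp.trans hu.symm)

theorem memLp_adjoint (hadm : IsAdmissible g ρ p) (hπ : IsMarkedPoisson (levyMeasure g ρ p) π)
    (A : LieAlg d X) {β : X × ℝ → ℝ} (hβ : IsLogDeriv g (fun z => ρ z.1 * p z.1 z.2) A β)
    {G : Config X → ℝ} (hG : G ∈ cylinder d X) :
    MemLp (fun η => -dirDeriv A G η - pairing β η * G η) 2 π := by
  have h1 := memLp_cylinder hadm hπ hG (memLp_pairing_logDeriv hadm hπ A hβ)
  simp only [mul_comm (G _)] at h1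
  exact (memLp_dirDeriv hadm hπ A hG).neg.sub h1

/-- The Hilbert space form of integration by parts, used both to define the operator and to find its
adjoint. -/
theorem inner_dirDeriv (hadm : IsAdmissible g ρ p) (hπ : IsMarkedPoisson (levyMeasure g ρ p) π)
    (A : LieAlg d X) {β : X × ℝ → ℝ} (hβ : IsLogDeriv g (fun z => ρ z.1 * p z.1 z.2) A β)
    {F G : Config X → ℝ} (hF : F ∈ cylinder d X) (hG : G ∈ cylinder d X) :
    inner ℝ ((memLp_dirDeriv hadm hπ A hF).toLp _) ((memLp_of_mem_cylinder hadm hπ hG).toLp G) =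
      inner ℝ ((memLp_of_mem_cylinder hadm hπ hF).toLp F)
        ((memLp_adjoint hadm hπ A hβ hG).toLp _) := by
  have hprob := hπ.isProbabilityMeasure
  rw [inner_toLp_eq, inner_toLp_eq, integration_by_parts hadm hπ A hβ hF hG]
  have i2 : Integrable (fun η => F η * dirDeriv A G η) π :=
    (memLp_cylinder hadm hπ hF (memLp_dirDeriv hadm hπ A hG)).integrable one_le_two
  have i3 : Integrable (fun η => F η * G η * pairing β η) π :=
    (memLp_cylinder hadm hπ (cylinder_mul hF hG)
      (memLp_pairing_logDeriv hadm hπ A hβ)).integrable one_le_two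
  have i2' : Integrable (fun η => -(F η * dirDeriv A G η)) π := i2.neg
  rw [← integral_neg, ← integral_sub i2' i3]
  refine integral_congr_ae (Eventually.of_forall fun η => ?_)
  simp only
  ring

/-- Two cylinder functions equal almost everywhere must have equal derivatives. The value at `u` is
therefore characterized by its inner products with cylinder functions, which integration by parts
expresses through the class `u` alone. Separation by cylinder functions makes this value unique, and
linearity follows from uniqueness. -/
theorem exists_dirDerivOperator (hadm : IsAdmissible g ρ p)
    (hπ : IsMarkedPoisson (levyMeasure g ρ p) π) (A : LieAlg d X) {β : X × ℝ → ℝ}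
    (hβ : IsLogDeriv g (fun z => ρ z.1 * p z.1 z.2) A β) :
    ∃ T : Lp ℝ 2 π →ₗ.[ℝ] Lp ℝ 2 π, T.domain = cylinderSubmodule d π ∧
      IsDirDerivOperator A π T := by
  have hex : ∀ u : cylinderSubmodule d π, ∃ w : Lp ℝ 2 π, ∀ G (hG : G ∈ cylinder d X),
      inner ℝ w ((memLp_of_mem_cylinder hadm hπ hG).toLp G) =
        inner ℝ (u : Lp ℝ 2 π) ((memLp_adjoint hadm hπ A hβ hG).toLp _) := by
    rintro ⟨u, F, hF, hu⟩
    refine ⟨(memLp_dirDeriv hadm hπ A hF).toLp _, fun G hG => ?_⟩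
    rw [inner_dirDeriv hadm hπ A hβ hF hG, toLp_eq_of_ae _ hu]
  have huniq : ∀ w w' : Lp ℝ 2 π, (∀ G (hG : G ∈ cylinder d X),
      inner ℝ w ((memLp_of_mem_cylinder hadm hπ hG).toLp G) =
        inner ℝ w' ((memLp_of_mem_cylinder hadm hπ hG).toLp G)) → w = w' := by
    intro w w' h
    refine sub_eq_zero.1 (eq_zero_of_inner hadm hπ fun G hG => ?_)
    rw [inner_sub_left, h G hG, sub_self]
  choose T hT using hex
  let L : cylinderSubmodule d π →ₗ[ℝ] Lp ℝ 2 π :=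
    { toFun := T
      map_add' := fun u w => huniq _ _ fun G hG => by
        rw [hT _ G hG, inner_add_left, hT _ G hG, hT _ G hG, Submodule.coe_add, inner_add_left]
      map_smul' := fun c u => huniq _ _ fun G hG => by
        rw [hT _ G hG, RingHom.id_apply, inner_smul_left, hT _ G hG, Submodule.coe_smul, inner_smul_left] }
  refine ⟨⟨cylinderSubmodule d π, L⟩, rfl, fun u => Iff.rfl, fun F hF u hu => ?_⟩
  have h1 : T u = (memLp_dirDeriv hadm hπ A hF).toLp _ := huniq _ _ fun G hG => by
    rw [hT _ G hG, inner_dirDeriv hadm hπ A hβ hF hG, toLp_eq_of_ae _ hu]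
  change T u =ᵐ[π] _
  rw [h1]
  exact MemLp.coeFn_toLp _

/-- Its orthogonal complement is zero, because cylinder functions separate. -/
theorem dense_cylinderSubmodule (hadm : IsAdmissible g ρ p)
    (hπ : IsMarkedPoisson (levyMeasure g ρ p) π) :
    Dense (cylinderSubmodule d π : Set (Lp ℝ 2 π)) := by
  rw [Submodule.dense_iff_topologicalClosure_eq_top, Submodule.topologicalClosure_eq_top_iff,
    Submodule.eq_bot_iff]
  intro w hw
  refine eq_zero_of_inner hadm hπ fun F hF => ?_
  exact (Submodule.mem_orthogonal' _ _).1 hw _ ⟨F, hF, MemLp.coeFn_toLp _⟩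

/-- The class of `-∇G - B G` represents the functional `x ↦ ⟨u, T x⟩` on the domain, which puts `u`
into the domain of the adjoint; density makes the representing vector unique. -/
theorem adjoint_dirDerivOperator (hadm : IsAdmissible g ρ p)
    (hπ : IsMarkedPoisson (levyMeasure g ρ p) π) (A : LieAlg d X) {β : X × ℝ → ℝ}
    (hβ : IsLogDeriv g (fun z => ρ z.1 * p z.1 z.2) A β) {T : Lp ℝ 2 π →ₗ.[ℝ] Lp ℝ 2 π}
    (hT : IsDirDerivOperator A π T) (hd : Dense (T.domain : Set (Lp ℝ 2 π)))
    {G : Config X → ℝ} (hG : G ∈ cylinder d X) {u : Lp ℝ 2 π} (hu : u =ᵐ[π] G) :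
    ∃ hu : u ∈ T.adjoint.domain,
      T.adjoint ⟨u, hu⟩ =ᵐ[π] fun η => -dirDeriv A G η - pairing β η * G η := by
  have hx : ∀ x : T.domain, inner ℝ ((memLp_adjoint hadm hπ A hβ hG).toLp _) (x : Lp ℝ 2 π) =
      inner ℝ u (T x) := by
    intro x
    obtain ⟨F, hF, hxF⟩ := (hT.mem_domain x).1 x.2
    have h1 := toLp_eq_of_ae (memLp_dirDeriv hadm hπ A hF) (hT.apply_eq F hF x hxF)
    have h2 := inner_dirDeriv hadm hπ A hβ hF hG
    rw [h1, toLp_eq_of_ae _ hu, toLp_eq_of_ae _ hxF] at h2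
    rw [real_inner_comm, ← h2, real_inner_comm]
  have hmem : u ∈ T.adjoint.domain := LinearPMap.mem_adjoint_domain_of_exists _ ⟨_, hx⟩
  refine ⟨hmem, ?_⟩
  rw [LinearPMap.adjoint_apply_eq hd ⟨u, hmem⟩ hx]
  exact MemLp.coeFn_toLp _

end operator

end MarkedPoisson

end

theorem theorem3p1 {d : ℕ} {X : Type*} [TopologicalSpace X] [T2Space X]
    [SecondCountableTopology X] [ConnectedSpace X] [NoncompactSpace X]
    [ChartedSpace (Eu d) X] [IsManifold (𝓡 d) ∞ X] [MeasurableSpace X] [BorelSpace X]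
    (g : RMetric d X) (ρ : X → ℝ) (p : X → ℝ → ℝ) (hadm : IsAdmissible g ρ p)
    (π : Measure (Config X)) (hπ : IsMarkedPoisson (levyMeasure g ρ p) π) (A : LieAlg d X) :
    (∃ β : X × ℝ → ℝ, IsLogDeriv g (fun z => ρ z.1 * p z.1 z.2) A β) ∧
    ∀ β : X × ℝ → ℝ, IsLogDeriv g (fun z => ρ z.1 * p z.1 z.2) A β →
      (∀ F ∈ cylinder d X,
        (∀ η, DifferentiableAt ℝ (fun t : ℝ => F (act A t η)) 0) ∧
        MemLp F 2 π ∧ MemLp (dirDeriv A F) 2 π ∧ MemLp (fun η => F η * pairing β η) 2 π) ∧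
      (∀ F ∈ cylinder d X, ∀ G ∈ cylinder d X,
        ∫ η, dirDeriv A F η * G η ∂π =
          -(∫ η, F η * dirDeriv A G η ∂π) - ∫ η, F η * G η * pairing β η ∂π) ∧
      (∃ T : Lp ℝ 2 π →ₗ.[ℝ] Lp ℝ 2 π, IsDirDerivOperator A π T ∧
        Dense (T.domain : Set (Lp ℝ 2 π)) ∧
        ∀ G ∈ cylinder d X, ∀ u : Lp ℝ 2 π, u =ᵐ[π] G →
          ∃ hu : u ∈ T.adjoint.domain,
            T.adjoint ⟨u, hu⟩ =ᵐ[π] fun η => -dirDeriv A G η - pairing β η * G η) := by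
  obtain ⟨β₀, hβ₀⟩ := exists_logDeriv hadm A
  refine ⟨⟨β₀, hβ₀⟩, fun β hβ => ⟨fun F hF => ⟨differentiableAt_cylinder hF A,
    memLp_of_mem_cylinder hadm hπ hF, memLp_dirDeriv hadm hπ A hF,
    memLp_cylinder hadm hπ hF (memLp_pairing_logDeriv hadm hπ A hβ)⟩,
    fun F hF G hG => integration_by_parts hadm hπ A hβ hF hG, ?_⟩⟩
  obtain ⟨T, hTd, hT⟩ := exists_dirDerivOperator hadm hπ A hβ
  have hd : Dense (T.domain : Set (Lp ℝ 2 π)) := hTd ▸ dense_cylinderSubmodule hadm hπ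
  exact ⟨T, hT, hd, fun G hG u hu => adjoint_dirDerivOperator hadm hπ A hβ hT hd hG hu⟩
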